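/- **Liouville billiard tables of classical type.** Let $\omega_1,\omega_2,N>0$, let $\varphi_1,\varphi_2:\mathbb R\to\mathbb R$ and $\varphi_3:[-N,N]\to\mathbb R$ be $C^\infty$ functions, and suppose: * $(A_1)$ $\varphi_1,\varphi_2,\varphi_3$ are even, $\varphi_1(\theta_1)\ge\varphi_2(\theta_2)\ge 0\ge\varphi_3(\theta_3)$, $\varphi_k$ has period $\omega_k$ $(k=1,2)$, and $\varphi_2(\theta_2)=\varphi_2(\frac{\omega_2}{2}-\theta_2)$; * $(A_2)$ $\nu_k:=\min\varphi_k=\max\varphi_{k+1}$ $(k=1,2)$ with $\nu_1>\nu_2=0$; for $k=1,2$, $\varphi_k(\theta_k)=\nu_k$ iff $\theta_k\in\frac{\omega_k}{2}\mathbb Z$; $\varphi_2(\theta_2)=\nu_1$ iff $\theta_2\in\frac{\omega_2}{4}+\frac{\omega_2}{2}\mathbb Z$; $\varphi_3(\theta_3)=0$ iff $\theta_3=0$; * $(A_3)$ $\varphi_k''(0)=\varphi_k''(\omega_k/2)>0$ for $k=1,2$, and for all $l\ge0$: $\varphi_1^{(2l)}(0)=\varphi_1^{(2l)}(\omega_1/2)$,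 $\varphi_1^{(2l)}(0)=(-1)^l\varphi_2^{(2l)}(\omega_2/4)$, $\varphi_2^{(2l)}(0)=(-1)^l\varphi_3^{(2l)}(0)$; * $(A_4)$ $\varphi_1(\theta_1)=\varphi_1(\frac{\omega_1}{2}-\theta_1)$; * $(A_5)$ $\varphi_k'>0$ on $(0,\omega_k/4)$ for $k=1,2$, and $\varphi_3'<0$ on $(0,N]$. Put $\nu_0:=\max\varphi_1$ and $\nu_3:=\varphi_3(N)$. On $C=\mathbb R/\omega_1\mathbb Z\times\mathbb R/\omega_2\mathbb Z\times[-N,N]$ consider the involutions $\sigma_1(\theta)=(-\theta_1,\frac{\omega_2}{2}-\theta_2,\theta_3)$ and $\sigma_2(\theta)=(\theta_1,-\theta_2,-\theta_3)$, and let $\sigma:C\to X:=C/\langle\sigma_1,\sigma_2\rangle$ be the quotient map. Away from the image of the set $S$ of points fixed by a non-trivial element of $\langle\sigma_1,\sigma_2\rangle$, the metric $\tilde g$ of $X$ is the push-forward of $\Pi_1d\theta_1^2+\Pi_2d\theta_2^2+\Pi_3d\theta_3^2$, where $$\Pi_1=(\varphi_1-\varphi_2)(\varphi_1-\varphi_3),\quad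 \Pi_2=(\varphi_1-\varphi_2)(\varphi_2-\varphi_3),\quad \Pi_3=(\varphi_1-\varphi_3)(\varphi_2-\varphi_3).$$ The boundary of $X$ is $\Gamma=\sigma(\{\theta_3=\pm N\})$. The maps $(\theta_1,\theta_2,\theta_3)\mapsto(-\theta_1,\theta_2,\theta_3)$, $(\frac{\omega_1}{2}-\theta_1,\theta_2,\theta_3)$, $(\theta_1,-\theta_2,\theta_3)$ induce involutions of $X$, which generate a group $G(X)$. **Integrals and charts.** On $T^*C$, off $S$, let $$I_1=\tfrac{\varphi_2+\varphi_3}{\Pi_1}p_1^2+\tfrac{\varphi_1+\varphi_3}{\Pi_2}p_2^2+\tfrac{\varphi_1+\varphi_2}{\Pi_3}p_3^2,\qquad I_2=\tfrac{\varphi_2\varphi_3}{\Pi_1}p_1^2+\tfrac{\varphi_1\varphi_3}{\Pi_2}p_2^2+\tfrac{\varphi_1\varphi_2}{\Pi_3}p_3^2 .$$ Let $B^*\Gamma$ be the open unit coball bundle of $\Gamma\setminus\sigma(S)$, with canonical symplectic form $\omega=dp_1\wedge d\theta_1+dp_2\wedge d\theta_2$. Let $n_g$ be the inward unit normal. For $\xi\in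 B^*\Gamma$ let $\pi^+(\xi)$ be the unit covector that restricts to $\xi$ on $T\Gamma$ and is positive on $n_g$. Put $\mathcal I_j=I_j\circ\pi^+$ on $B^*\Gamma$ $(j=1,2)$. Let $U_1$ (case (A)), respectively $U_2$ (case (B)), be the set of $\xi\in B^*\Gamma$ for which the roots $\kappa_1\le\kappa_2$ of $t^2-\mathcal I_1(\xi)t+\mathcal I_2(\xi)$ satisfy $$\text{(A)}\ \ \nu_3<\kappa_1<0<\kappa_2<\nu_1,\qquad\text{respectively}\qquad\text{(B)}\ \ \nu_3<\kappa_1<0,\ \ \nu_1<\kappa_2<\nu_0 .$$ **Radon transform.** A *Liouville torus* is a compact connected component $\Lambda$ of a level set of $(\mathcal I_1,\mathcal I_2)$ in $B^*\Gamma$ on which $d\mathcal I_1\wedge d\mathcal I_2$ does not vanish. Its *Leray form* $\lambda$ is the restriction to $\Lambda$ of any two-form $\alpha$ with $\omega\wedge\omega=\alpha\wedge d\mathcal I_1\wedge d\mathcal I_2$. For $K\in C(\Gamma,\mathbb R)$, a function $\mu$ on $B^*\Gamma$, and the projection $\pi_\Gamma:B^*\Gamma\to\Gamma$, put $$\mathcal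 R_{K,\mu}(\Lambda)=\frac1{\lambda(\Lambda)}\int_\Lambda(\pi_\Gamma^*K)\,\mu\,\lambda .$$ **Theorem.** Let $(X,\tilde g)$ be a Liouville billiard table of classical type as above, and let either $\mu\equiv1$ or $\mu(\xi)=\langle\pi^+(\xi),n_g\rangle^{-1}$. Let $K\in C(\Gamma,\mathbb R)$ be invariant under the action of $G(X)$ on $\Gamma$. If $\mathcal R_{K,\mu}(\Lambda)=0$ for every Liouville torus $\Lambda\subset U_1\cup U_2$, then $K\equiv0$. -/

import Mathlib

open MeasureTheory Set Topology
open scoped ContDiff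

/-- The data `(ω₁, ω₂, N, φ₁, φ₂, φ₃)` of a three-dimensional Liouville billiard table, subject to
`(A₁)`, `(A₂)`, `(A₃)`.  The function `φ₃` matters only on `[-N, N]`. -/
structure LiouvilleTable where
  ω₁ : ℝ
  ω₂ : ℝ
  N : ℝ
  φ₁ : ℝ → ℝ
  φ₂ : ℝ → ℝ
  φ₃ : ℝ → ℝ
  /-- `ν₁ = min φ₁ = max φ₂` -/
  ν₁ : ℝ
  ω₁_pos : 0 < ω₁
  ω₂_pos : 0 < ω₂
  N_pos : 0 < N
  smooth₁ : ContDiff ℝ ∞ φ₁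
  smooth₂ : ContDiff ℝ ∞ φ₂
  smooth₃ : ContDiffOn ℝ ∞ φ₃ (Icc (-N) N)
  -- (A₁)
  even₁ : ∀ t, φ₁ (-t) = φ₁ t
  even₂ : ∀ t, φ₂ (-t) = φ₂ t
  even₃ : ∀ t ∈ Icc (-N) N, φ₃ (-t) = φ₃ t
  le₁₂ : ∀ s t, φ₂ t ≤ φ₁ s
  nonneg₂ : ∀ t, 0 ≤ φ₂ t
  nonpos₃ : ∀ t ∈ Icc (-N) N, φ₃ t ≤ 0
  periodic₁ : Function.Periodic φ₁ ω₁
  periodic₂ : Function.Periodic φ₂ ω₂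
  symm₂ : ∀ t, φ₂ (ω₂ / 2 - t) = φ₂ t
  -- (A₂)
  ν₁_pos : 0 < ν₁
  min₁ : IsLeast (range φ₁) ν₁
  max₂ : IsGreatest (range φ₂) ν₁
  min₂ : IsLeast (range φ₂) 0
  max₃ : IsGreatest (φ₃ '' Icc (-N) N) 0
  φ₁_eq_min : ∀ t, φ₁ t = ν₁ ↔ ∃ k : ℤ, t = k * (ω₁ / 2)
  φ₂_eq_min : ∀ t, φ₂ t = 0 ↔ ∃ k : ℤ, t = k * (ω₂ / 2)
  φ₂_eq_max : ∀ t, φ₂ t = ν₁ ↔ ∃ k : ℤ, t = ω₂ / 4 + k * (ω₂ / 2)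
  φ₃_eq_max : ∀ t ∈ Icc (-N) N, φ₃ t = 0 ↔ t = 0
  -- (A₃)
  second₁ : iteratedDeriv 2 φ₁ 0 = iteratedDeriv 2 φ₁ (ω₁ / 2)
  second₁_pos : 0 < iteratedDeriv 2 φ₁ 0
  second₂ : iteratedDeriv 2 φ₂ 0 = iteratedDeriv 2 φ₂ (ω₂ / 2)
  second₂_pos : 0 < iteratedDeriv 2 φ₂ 0
  compat₁ : ∀ l : ℕ, iteratedDeriv (2 * l) φ₁ 0 = iteratedDeriv (2 * l) φ₁ (ω₁ / 2)
  compat₁₂ : ∀ l : ℕ, iteratedDeriv (2 * l) φ₁ 0 = (-1) ^ l * iteratedDeriv (2 * l) φ₂ (ω₂ / 4)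
  compat₂₃ : ∀ l : ℕ, iteratedDeriv (2 * l) φ₂ 0 = (-1) ^ l * iteratedDeriv (2 * l) φ₃ 0

namespace LiouvilleTable

/-- Classical type: the conditions `(A₄)` and `(A₅)`. -/
structure IsClassical (L : LiouvilleTable) : Prop where
  symm₁ : ∀ t, L.φ₁ (L.ω₁ / 2 - t) = L.φ₁ t
  deriv₁ : ∀ t ∈ Ioo 0 (L.ω₁ / 4), 0 < deriv L.φ₁ t
  deriv₂ : ∀ t ∈ Ioo 0 (L.ω₂ / 4), 0 < deriv L.φ₂ t
  deriv₃ : ∀ t ∈ Ioc 0 L.N, derivWithin L.φ₃ (Icc (-L.N) L.N) t < 0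

variable (L : LiouvilleTable)

/-- `ν₀ = max φ₁`. -/
noncomputable def ν₀ : ℝ := sSup (range L.φ₁)

/-- `ν₃ = φ₃(N)`. -/
def ν₃ : ℝ := L.φ₃ L.N

/-! ### The cylinder, the billiard table, its boundary and its symmetries -/

/-- The circle `ℝ / ω₁ ℤ`. -/
abbrev T₁ : Type := AddCircle L.ω₁

/-- The circle `ℝ / ω₂ ℤ`. -/
abbrev T₂ : Type := AddCircle L.ω₂

/-- The cylinder `C`, with points `(θ₁, θ₂, θ₃)`. -/
abbrev Cyl : Type := L.T₁ × L.T₂ × Icc (-L.N) L.N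

/-- The class of `ω₁ / 2`. -/
noncomputable def half₁ : L.T₁ := ((L.ω₁ / 2 : ℝ) : AddCircle L.ω₁)

/-- The class of `ω₂ / 2`. -/
noncomputable def half₂ : L.T₂ := ((L.ω₂ / 2 : ℝ) : AddCircle L.ω₂)

theorem neg_half₁ : -L.half₁ = L.half₁ := by
  rw [neg_eq_iff_add_eq_zero, half₁, ← AddCircle.coe_add, add_halves, AddCircle.coe_period]

theorem neg_half₂ : -L.half₂ = L.half₂ := by
  rw [neg_eq_iff_add_eq_zero, half₂, ← AddCircle.coe_add, add_halves, AddCircle.coe_period]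

/-- The reflection `t ↦ -t` of `[-N, N]`. -/
def negI (t : Icc (-L.N) L.N) : Icc (-L.N) L.N :=
  ⟨-t.1, by obtain ⟨t, h1, h2⟩ := t; constructor <;> simp only [] <;> linarith⟩

@[simp] theorem negI_negI (t : Icc (-L.N) L.N) : L.negI (L.negI t) = t :=
  Subtype.ext (neg_neg t.1)

/-- `σ₁ (θ₁, θ₂, θ₃) = (-θ₁, ω₂/2 - θ₂, θ₃)`. -/
noncomputable def σ₁ (q : L.Cyl) : L.Cyl := (-q.1, L.half₂ - q.2.1, q.2.2)

/-- `σ₂ (θ₁, θ₂, θ₃) = (θ₁, -θ₂, -θ₃)`. -/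
def σ₂ (q : L.Cyl) : L.Cyl := (q.1, -q.2.1, L.negI q.2.2)

theorem half₂_add (b : L.T₂) : L.half₂ + b = b - L.half₂ := by
  rw [sub_eq_add_neg, L.neg_half₂, add_comm]

theorem σ₁_σ₁ (q : L.Cyl) : L.σ₁ (L.σ₁ q) = q := by
  simp [σ₁]

theorem σ₂_σ₂ (q : L.Cyl) : L.σ₂ (L.σ₂ q) = q := by
  simp [σ₂]

theorem σ₂_σ₁ (q : L.Cyl) : L.σ₂ (L.σ₁ q) = L.σ₁ (L.σ₂ q) := by
  simp [σ₁, σ₂, L.half₂_add]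

/-- Two points of `C` are equivalent iff they lie in the same orbit of the group
`{1, σ₁, σ₂, σ₁σ₂}`. -/
def tableSetoid : Setoid L.Cyl where
  r p q := q = p ∨ q = L.σ₁ p ∨ q = L.σ₂ p ∨ q = L.σ₁ (L.σ₂ p)
  iseqv :=
    { refl := fun _ => Or.inl rfl
      symm := by
        rintro p q (rfl | rfl | rfl | rfl) <;>
          simp [σ₁_σ₁, σ₂_σ₂, σ₂_σ₁]
      trans := by
        rintro p q r (rfl | rfl | rfl | rfl) (rfl | rfl | rfl | rfl) <;>
          simp [σ₁_σ₁, σ₂_σ₂, σ₂_σ₁] }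

/-- The billiard table `X = C / {1, σ₁, σ₂, σ₁σ₂}` with the quotient topology. -/
abbrev X : Type := Quotient L.tableSetoid

/-- The projection `σ : C → X`. -/
def σ (q : L.Cyl) : L.X := Quotient.mk L.tableSetoid q

/-- The boundary `Γ` of `X`, the image of `{θ₃ = ±N}`. -/
def Γ : Set L.X := L.σ '' {q | q.2.2.1 = L.N ∨ q.2.2.1 = -L.N}

/-- `(θ₁, θ₂, θ₃) ↦ (-θ₁, θ₂, θ₃)` on `C`. -/
def τ₁ (q : L.Cyl) : L.Cyl := (-q.1, q.2.1, q.2.2)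

/-- `(θ₁, θ₂, θ₃) ↦ (ω₁/2 - θ₁, θ₂, θ₃)` on `C`. -/
noncomputable def τ₂ (q : L.Cyl) : L.Cyl := (L.half₁ - q.1, q.2.1, q.2.2)

/-- `(θ₁, θ₂, θ₃) ↦ (θ₁, -θ₂, θ₃)` on `C`. -/
def τ₃ (q : L.Cyl) : L.Cyl := (q.1, -q.2.1, q.2.2)

/-- The transformation of `X` induced by an involution of `C` that commutes with `σ₁`, `σ₂`. -/
def descend (τ : L.Cyl → L.Cyl) (h : ∀ q, τ (τ q) = q) (h₁ : ∀ q, τ (L.σ₁ q) = L.σ₁ (τ q))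
    (h₂ : ∀ q, τ (L.σ₂ q) = L.σ₂ (τ q)) : Equiv.Perm L.X :=
  Function.Involutive.toPerm
    (Quotient.map' (s₁ := L.tableSetoid) (s₂ := L.tableSetoid) τ (by
      rintro p q (rfl | rfl | rfl | rfl)
      · exact Or.inl rfl
      · exact Or.inr (Or.inl (h₁ p))
      · exact Or.inr (Or.inr (Or.inl (h₂ p)))
      · exact Or.inr (Or.inr (Or.inr (by rw [h₁, h₂])))))
    (by
      intro x
      induction x using Quotient.inductionOn with
      | _ q => exact congrArg (Quotient.mk L.tableSetoid) (h q))

/-- The group `G(X)` generated by the three reflections of `X`. -/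
noncomputable def G : Subgroup (Equiv.Perm L.X) :=
  Subgroup.closure
    {L.descend L.τ₁ (by simp [τ₁]) (by simp [τ₁, σ₁]) (by simp [τ₁, σ₂]),
     L.descend L.τ₂ (by simp [τ₂])
       (by
          intro q
          have h : L.half₁ + q.1 = q.1 - L.half₁ := by
            rw [sub_eq_add_neg, L.neg_half₁, add_comm]
          simp [τ₂, σ₁, h])
       (by simp [τ₂, σ₂]),
     L.descend L.τ₃ (by simp [τ₃]) (by simp [τ₃, σ₁, L.half₂_add]) (by simp [τ₃, σ₂])}

/-- `K ∈ C(Γ, ℝ)` is invariant under the action of `G(X)` on `Γ`. -/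
def IsGInvariant (K : C(L.Γ, ℝ)) : Prop :=
  ∀ a ∈ L.G, ∀ x y : L.Γ, (y : L.X) = a (x : L.X) → K y = K x

/-! ### The metric and the two quadratic integrals on `T*C` -/

/-- `φ₁` as a function on the circle. -/
def f₁ : L.T₁ → ℝ := L.periodic₁.lift

/-- `φ₂` as a function on the circle. -/
def f₂ : L.T₂ → ℝ := L.periodic₂.lift

/-- `φ₃` as a function on the interval. -/
def f₃ (t : Icc (-L.N) L.N) : ℝ := L.φ₃ t

/-- The coefficients (`Π₁, Π₂, Π₃` in the literature) of the metric `g = g₁ dθ₁² + g₂ dθ₂² + g₃ dθ₃²`. -/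
def g₁ (q : L.Cyl) : ℝ := (L.f₁ q.1 - L.f₂ q.2.1) * (L.f₁ q.1 - L.f₃ q.2.2)

/-- See `g₁`. -/
def g₂ (q : L.Cyl) : ℝ := (L.f₁ q.1 - L.f₂ q.2.1) * (L.f₂ q.2.1 - L.f₃ q.2.2)

/-- See `g₁`. -/
def g₃ (q : L.Cyl) : ℝ := (L.f₁ q.1 - L.f₃ q.2.2) * (L.f₂ q.2.1 - L.f₃ q.2.2)

/-- The Hamiltonian of `g` (without the factor `1/2`) at the covector
`p₁ dθ₁ + p₂ dθ₂ + p₃ dθ₃` at the point `q`. -/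
noncomputable def H (q : L.Cyl) (p₁ p₂ p₃ : ℝ) : ℝ :=
  p₁ ^ 2 / L.g₁ q + p₂ ^ 2 / L.g₂ q + p₃ ^ 2 / L.g₃ q

/-- The first integral `I₁`. -/
noncomputable def I₁ (q : L.Cyl) (p₁ p₂ p₃ : ℝ) : ℝ :=
  (L.f₂ q.2.1 + L.f₃ q.2.2) / L.g₁ q * p₁ ^ 2 + (L.f₁ q.1 + L.f₃ q.2.2) / L.g₂ q * p₂ ^ 2
    + (L.f₁ q.1 + L.f₂ q.2.1) / L.g₃ q * p₃ ^ 2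

/-- The second integral `I₂`. -/
noncomputable def I₂ (q : L.Cyl) (p₁ p₂ p₃ : ℝ) : ℝ :=
  (L.f₂ q.2.1 * L.f₃ q.2.2) / L.g₁ q * p₁ ^ 2 + (L.f₁ q.1 * L.f₃ q.2.2) / L.g₂ q * p₂ ^ 2
    + (L.f₁ q.1 * L.f₂ q.2.1) / L.g₃ q * p₃ ^ 2

/-! ### The cotangent bundle of the boundary -/

/-- The cotangent bundle of the torus `{θ₃ = N}`; `(θ₁, θ₂, p₁, p₂)` is the covector
`p₁ dθ₁ + p₂ dθ₂` at `(θ₁, θ₂)`. -/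
abbrev CotTorus : Type := L.T₁ × L.T₂ × ℝ × ℝ

/-- The base point in `C` of a covector on the torus `{θ₃ = N}`. -/
def base (ξ : L.CotTorus) : L.Cyl :=
  (ξ.1, ξ.2.1, ⟨L.N, by have := L.N_pos; constructor <;> linarith⟩)

/-- The action on covectors of the restriction `(θ₁, θ₂) ↦ (-θ₁, ω₂/2 - θ₂)` of `σ₁`. -/
noncomputable def ι (ξ : L.CotTorus) : L.CotTorus :=
  (-ξ.1, L.half₂ - ξ.2.1, -ξ.2.2.1, -ξ.2.2.2)

theorem ι_ι (ξ : L.CotTorus) : L.ι (L.ι ξ) = ξ := by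
  simp [ι]

/-- Covectors on the torus `{θ₃ = N}` which `σ` identifies. -/
def cotSetoid : Setoid L.CotTorus where
  r ξ η := η = ξ ∨ η = L.ι ξ
  iseqv :=
    { refl := fun _ => Or.inl rfl
      symm := by rintro ξ η (rfl | rfl) <;> simp [ι_ι]
      trans := by rintro ξ η ζ (rfl | rfl) (rfl | rfl) <;> simp [ι_ι] }

/-- The quotient of the cotangent bundle of the torus `{θ₃ = N}` by the lifted involution.  Over the
complement `Γ ∖ σ(S)` of the four branch points this is the cotangent bundle `T*(Γ ∖ σ(S))`; the
fibres over the branch points are never used (see `coball`). -/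
abbrev CotΓ : Type := Quotient L.cotSetoid

theorem f₁_neg (a : L.T₁) : L.f₁ (-a) = L.f₁ a := by
  induction a using QuotientAddGroup.induction_on with
  | H t => exact L.even₁ t

theorem f₂_half_sub (b : L.T₂) : L.f₂ (L.half₂ - b) = L.f₂ b := by
  induction b using QuotientAddGroup.induction_on with
  | H t => exact L.symm₂ t

/-- The function on `CotΓ` induced by an `ι`-invariant function. -/
def liftCot {α : Type*} (F : L.CotTorus → α) (h : ∀ ξ, F (L.ι ξ) = F ξ) : L.CotΓ → α :=
  Quotient.lift F (by rintro ξ η (rfl | rfl); exacts [rfl, (h ξ).symm])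

/-- The projection `π_Γ : T*Γ → Γ`. -/
def πΓ : L.CotΓ → L.Γ :=
  L.liftCot (fun ξ => ⟨L.σ (L.base ξ), L.base ξ, Or.inl rfl, rfl⟩) (by
    intro ξ
    refine Subtype.ext (Quotient.sound ?_)
    exact Or.inr (Or.inl (by simp [σ₁, base, ι])))

/-- The squared norm `p₁²/g₁ + p₂²/g₂` of a covector on the boundary. -/
noncomputable def normSqT (ξ : L.CotTorus) : ℝ := L.H (L.base ξ) ξ.2.2.1 ξ.2.2.2 0

/-- The component `p₃` of `π⁺(ξ)`, the unit covector which restricts to `ξ` on the boundary and is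
non-negative on the inward normal `-g₃^(-1/2) ∂/∂θ₃`. -/
noncomputable def p₃T (ξ : L.CotTorus) : ℝ :=
  -(√(L.g₃ (L.base ξ)) * √(1 - L.normSqT ξ))

/-- `𝓘₁ = I₁ ∘ π⁺` on the torus. -/
noncomputable def F₁T (ξ : L.CotTorus) : ℝ := L.I₁ (L.base ξ) ξ.2.2.1 ξ.2.2.2 (L.p₃T ξ)

/-- `𝓘₂ = I₂ ∘ π⁺` on the torus. -/
noncomputable def F₂T (ξ : L.CotTorus) : ℝ := L.I₂ (L.base ξ) ξ.2.2.1 ξ.2.2.2 (L.p₃T ξ)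

/-- The pairing `⟨π⁺(ξ), n_g⟩` with the inward unit normal `n_g = -g₃^(-1/2) ∂/∂θ₃`. -/
noncomputable def pairT (ξ : L.CotTorus) : ℝ := L.p₃T ξ * (-(√(L.g₃ (L.base ξ)))⁻¹)

theorem normSqT_ι (ξ : L.CotTorus) : L.normSqT (L.ι ξ) = L.normSqT ξ := by
  simp [normSqT, H, g₁, g₂, g₃, base, ι, f₁_neg, f₂_half_sub]

theorem p₃T_ι (ξ : L.CotTorus) : L.p₃T (L.ι ξ) = L.p₃T ξ := by
  rw [p₃T, p₃T, normSqT_ι]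
  simp [g₃, base, ι, f₁_neg, f₂_half_sub]

theorem F₁T_ι (ξ : L.CotTorus) : L.F₁T (L.ι ξ) = L.F₁T ξ := by
  rw [F₁T, F₁T, p₃T_ι]
  simp [I₁, g₁, g₂, g₃, base, ι, f₁_neg, f₂_half_sub]

theorem F₂T_ι (ξ : L.CotTorus) : L.F₂T (L.ι ξ) = L.F₂T ξ := by
  rw [F₂T, F₂T, p₃T_ι]
  simp [I₂, g₁, g₂, g₃, base, ι, f₁_neg, f₂_half_sub]

theorem pairT_ι (ξ : L.CotTorus) : L.pairT (L.ι ξ) = L.pairT ξ := by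
  rw [pairT, pairT, p₃T_ι]
  simp [g₃, base, ι, f₁_neg, f₂_half_sub]

/-- The integral `𝓘₁` of the billiard ball map on `T*Γ`. -/
noncomputable def F₁ : L.CotΓ → ℝ := L.liftCot L.F₁T L.F₁T_ι

/-- The integral `𝓘₂` of the billiard ball map on `T*Γ`. -/
noncomputable def F₂ : L.CotΓ → ℝ := L.liftCot L.F₂T L.F₂T_ι

/-- The density `μ(ξ) = ⟨π⁺(ξ), n_g⟩⁻¹`. -/
noncomputable def normalDensity : L.CotΓ → ℝ :=
  L.liftCot (fun ξ => (L.pairT ξ)⁻¹) (fun ξ => congrArg (·⁻¹) (L.pairT_ι ξ))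

/-- The open coball bundle `B*(Γ ∖ σ(S))`: covectors of norm less than one at points which are not
branch points, i.e. whose preimages on the torus are not fixed by `(θ₁, θ₂) ↦ (-θ₁, ω₂/2 - θ₂)`. -/
def coball : Set L.CotΓ :=
  Quotient.mk L.cotSetoid ''
    {ξ | ¬ (-ξ.1 = ξ.1 ∧ L.half₂ - ξ.2.1 = ξ.2.1) ∧ L.normSqT ξ < 1}

/-- The chart `U₁`, case (A) with strict inequalities for the roots `κ₁ ≤ κ₂` of
`t² - h₁ t + h₂`. -/
def U₁ : Set L.CotΓ :=
  {ξ | ξ ∈ L.coball ∧ ∃ κ₁ κ₂ : ℝ, L.F₁ ξ = κ₁ + κ₂ ∧ L.F₂ ξ = κ₁ * κ₂ ∧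
    L.ν₃ < κ₁ ∧ κ₁ < 0 ∧ 0 < κ₂ ∧ κ₂ < L.ν₁}

/-- The chart `U₂`, case (B) with strict inequalities for the roots `κ₁ ≤ κ₂` of
`t² - h₁ t + h₂`. -/
def U₂ : Set L.CotΓ :=
  {ξ | ξ ∈ L.coball ∧ ∃ κ₁ κ₂ : ℝ, L.F₁ ξ = κ₁ + κ₂ ∧ L.F₂ ξ = κ₁ * κ₂ ∧
    L.ν₃ < κ₁ ∧ κ₁ < 0 ∧ L.ν₁ < κ₂ ∧ κ₂ < L.ν₀}

/-! ### Symplectic form, Liouville tori, Leray form, Radon transform -/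

/-- Local canonical coordinates `(θ₁, θ₂, p₁, p₂)`. -/
abbrev E : Type := ℝ × ℝ × ℝ × ℝ

/-- The covering `(θ₁, θ₂, p₁, p₂) ↦` covector on `Γ`; away from the branch points it is a local
diffeomorphism, its local inverses are the canonical charts of `T*Γ`. -/
def cov (x : E) : L.CotΓ :=
  Quotient.mk L.cotSetoid ((x.1 : AddCircle L.ω₁), (x.2.1 : AddCircle L.ω₂), x.2.2.1, x.2.2.2)

/-- The differential of `𝓘₁` in canonical coordinates. -/
noncomputable def dF₁ (x : E) : E →L[ℝ] ℝ := fderiv ℝ (fun y => L.F₁ (L.cov y)) x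

/-- The differential of `𝓘₂` in canonical coordinates. -/
noncomputable def dF₂ (x : E) : E →L[ℝ] ℝ := fderiv ℝ (fun y => L.F₂ (L.cov y)) x

/-- The wedge product of two one-forms at a point. -/
def wedge₁ (a b : E →L[ℝ] ℝ) (u v : E) : ℝ := a u * b v - a v * b u

/-- The wedge product of two two-forms at a point. -/
def wedge₂ (α β : E → E → ℝ) (u v w z : E) : ℝ :=
  α u v * β w z - α u w * β v z + α u z * β v w
    + α v w * β u z - α v z * β u w + α w z * β u v

/-- The symplectic form `dp₁ ∧ dθ₁ + dp₂ ∧ dθ₂`. -/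
def symplectic (u v : E) : ℝ :=
  (u.2.2.1 * v.1 - v.2.2.1 * u.1) + (u.2.2.2 * v.2.1 - v.2.2.2 * u.2.1)

/-- `Λ` is a Liouville torus: a compact connected component of a level set of `(𝓘₁, 𝓘₂)` in the
coball bundle on which `d𝓘₁ ∧ d𝓘₂` does not vanish. -/
def IsLiouvilleTorus (Λ : Set L.CotΓ) : Prop :=
  (∃ c₁ c₂ : ℝ, ∃ ξ ∈ {η | η ∈ L.coball ∧ L.F₁ η = c₁ ∧ L.F₂ η = c₂},
    Λ = connectedComponentIn {η | η ∈ L.coball ∧ L.F₁ η = c₁ ∧ L.F₂ η = c₂} ξ) ∧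
  IsCompact Λ ∧
  ∀ x : E, L.cov x ∈ Λ → ∃ u v : E, wedge₁ (L.dF₁ x) (L.dF₂ x) u v ≠ 0

/-- The two-form `α` satisfies `ω ∧ ω = α ∧ d𝓘₁ ∧ d𝓘₂` at the points of `Λ`.  The restriction of
`α` to the tangent planes of `Λ` is then uniquely determined: it is the Leray form of `Λ`. -/
def IsLerayForm (Λ : Set L.CotΓ) (α : E → E [⋀^Fin 2]→ₗ[ℝ] ℝ) : Prop :=
  ∀ x : E, L.cov x ∈ Λ → ∀ u v w z : E,
    wedge₂ symplectic symplectic u v w z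
      = wedge₂ (fun a b => α x ![a, b]) (wedge₁ (L.dF₁ x) (L.dF₂ x)) u v w z

/-- `ψ : V → Λ` is a smooth local parametrization of `Λ`, written in canonical coordinates. -/
structure IsLocalParam (Λ : Set L.CotΓ) (V : Set (ℝ × ℝ)) (ψ : ℝ × ℝ → E) : Prop where
  isOpen : IsOpen V
  smooth : ContDiffOn ℝ ∞ ψ V
  immersion : ∀ t ∈ V, Function.Injective (fderiv ℝ ψ t)
  injOn : InjOn (fun t => L.cov (ψ t)) V
  mapsTo : MapsTo (fun t => L.cov (ψ t)) V Λ

/-- The Leray measure `|λ|` of `Λ`.  In any local parametrization `ψ : V → Λ` it is the image of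
`|λ(∂₁ψ, ∂₂ψ)| dt`, where `λ` is the Leray form; these local measures agree on overlaps, and their
least upper bound is the measure on `Λ` that they define together. -/
noncomputable def lerayMeasure (Λ : Set L.CotΓ) : Measure L.CotΓ :=
  sSup {m | ∃ (α : E → E [⋀^Fin 2]→ₗ[ℝ] ℝ) (V : Set (ℝ × ℝ)) (ψ : ℝ × ℝ → E),
    L.IsLerayForm Λ α ∧ L.IsLocalParam Λ V ψ ∧
    m = Measure.map (fun t => L.cov (ψ t))
      ((volume.restrict V).withDensity fun t =>
        ENNReal.ofReal |α (ψ t) ![fderiv ℝ ψ t (1, 0), fderiv ℝ ψ t (0, 1)]|)}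

/-- The Radon transform: the mean value of `(π_Γ^* K) μ` on `Λ` with respect to the Leray form. -/
noncomputable def radon (K : C(L.Γ, ℝ)) (μ : L.CotΓ → ℝ) (Λ : Set L.CotΓ) : ℝ :=
  ((L.lerayMeasure Λ).real Λ)⁻¹ * ∫ ξ in Λ, K (L.πΓ ξ) * μ ξ ∂(L.lerayMeasure Λ)

end LiouvilleTable

/-! The problem separates in the angles. If `t² - 𝓘₁ t + 𝓘₂` has roots `κ₁`, `κ₂`, then `p₁² = (φ₁ -
κ₁)(φ₁ - κ₂)` and `p₂² = (φ₂ - κ₁)(κ₂ - φ₂)` (`sq_momenta`). A level set is thus locally a product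
of two plane curves, and its Leray form is, up to sign, `(φ₁ - φ₂) / (2 |p₁ p₂|) dθ₁ dθ₂`
(`IsParam.abs_leray`). On a level set either density `μ` is a constant times a fixed positive
function `w` of the angles. The symmetries of `K`, `φ₁`, `φ₂` fold everything onto a quarter period
in each angle, where `x = φ₁(θ₁)` and `y = φ₂(θ₂)` serve as coordinates with `0 ≤ y ≤ ν₁ ≤ x ≤ ν₀`.
One torus in each level set then gives, with `s = κ₁ ∈ (ν₃, 0)` and `c = κ₂ ∈ (0, ν₀)`, `c ≠ ν₁`, `∫
K w (x - y) / (√((x - s)(x - c)) √((y - s)(c - y))) dθ = 0`, the integrand being supported on `y < c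
< x`. The cases (A) and (B) are `c < ν₁` and `c > ν₁`; both are needed for `c` to fill the interval
from `y` to `x`.

This two-parameter transform is inverted in three moves. Abel integral: integrating against `dc / (c
- t)` replaces `1 / √((x - c)(c - y))` by `π / √((x - t)(y - t))` (`kernel_integral`). Hence `K w (x
- y)` is orthogonal to `G_s G_t` for all `s, t ∈ (ν₃, 0)`, where `G_s = 1 / √((x - s)(y - s))`
(`abel_average`). Legendre expansion: in `ξ = 1 / (x + δ)`, `η = 1 / (y + δ)`, after a shift of the
parameter by `δ`, `G_s` is up to a common factor the generating function of homogenized Legendre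
polynomials `P_n(ξ, η)`. So a positive multiple of `K` is orthogonal to all products `P_n P_m`
(`integral_leg_mul_leg`). The three-term recurrence spreads this to all polynomials in `ξ + η` and
`ξ η` (`eq_zero_on_adjoin`). Density: since `ξ ≤ 1 / (ν₁ + δ) ≤ η`, the symmetric functions `ξ + η`,
`ξ η` separate points. By Stone–Weierstrass `K` itself is a legitimate test function, and the
integral of `K²` times a weight positive almost everywhere vanishes.

The geometric half identifies the objects of the statement with these integrals: suitable parts of
level sets are Liouville tori (`IsParam.isLiouvilleTorus`), and the Leray measure, a supremum over
all local parametrizations, is already given by one chart of angles (`TorusChart.lerayMeasure_eq`).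
-/

namespace LegendreMoment

/-! ### Binomial series and homogenized Legendre polynomials -/

/-- The coefficients of the binomial series of `(1 - z)^(-1/2)`. -/
noncomputable def coef (k : ℕ) : ℝ := (Nat.centralBinom k : ℝ) / 4 ^ k

theorem coef_zero : coef 0 = 1 := by simp [coef]

theorem coef_succ (k : ℕ) : ((k : ℝ) + 1) * coef (k + 1) = ((k : ℝ) + 1 / 2) * coef k := by
  have h : ((k : ℝ) + 1) * Nat.centralBinom (k + 1) = 2 * (2 * k + 1) * Nat.centralBinom k := by
    exact_mod_cast Nat.succ_mul_centralBinom_succ k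
  rw [coef, coef, pow_succ]
  field_simp
  linear_combination 2 * h

theorem coef_nonneg (k : ℕ) : 0 ≤ coef k := by unfold coef; positivity

theorem coef_le_one (k : ℕ) : coef k ≤ 1 := by
  induction k with
  | zero => simp [coef_zero]
  | succ k ih =>
    have h := coef_succ k
    have hk : (0 : ℝ) ≤ k := Nat.cast_nonneg k
    nlinarith [coef_nonneg k, coef_nonneg (k + 1)]

theorem ring_choose_neg_half (k : ℕ) : Ring.choose (-(1 / 2) : ℝ) k = (-1) ^ k * coef k := by
  induction k with
  | zero => simp [coef_zero]
  | succ k ih =>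
    have h1 := Ring.choose_eq_smul (a := (-(1 / 2) : ℝ)) (n := k)
    have h2 := Ring.choose_eq_smul (a := (-(1 / 2) : ℝ)) (n := k + 1)
    have h3 : Ring.choose (-(1 / 2) : ℝ) (k + 1)
        = Ring.choose (-(1 / 2) : ℝ) k * (-(1 / 2) - k) / (k + 1) := by
      rw [h1, h2, descPochhammer_succ_right]
      simp only [Polynomial.smeval_mul, Polynomial.smeval_sub, Polynomial.smeval_X,
        Polynomial.smeval_natCast, Nat.factorial_succ, smul_eq_mul, pow_one, pow_zero,
        nsmul_eq_mul, mul_one]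
      push_cast
      have : (k.factorial : ℝ) ≠ 0 := by positivity
      field_simp
    have h4 := coef_succ k
    have hk : (k : ℝ) + 1 ≠ 0 := by positivity
    rw [h3, ih, div_eq_iff hk, pow_succ]
    linear_combination (-1) ^ k * h4

theorem hasSum_coef {z : ℝ} (hz : |z| < 1) :
    HasSum (fun k => coef k * z ^ k) (1 / √(1 - z)) := by
  have h := (Real.one_add_rpow_hasFPowerSeriesOnBall_zero (a := (-(1 / 2) : ℝ))).hasSum
    (y := -z) (by
      simp only [Metric.mem_eball, edist_zero_right]
      rw [← ofReal_norm, norm_neg, Real.norm_eq_abs]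
      exact ENNReal.ofReal_lt_one.2 hz)
  have hz' : 0 ≤ 1 - z := by linarith [(abs_lt.1 hz).2]
  have e : (1 + (0 + -z)) ^ (-(1 / 2) : ℝ) = 1 / √(1 - z) := by
    rw [zero_add, ← sub_eq_add_neg, Real.rpow_neg hz', Real.sqrt_eq_rpow, one_div, one_div]
  rw [e] at h
  suffices e' : (fun k => coef k * z ^ k)
      = fun n => (binomialSeries ℝ (-(1 / 2) : ℝ) n) fun _ => -z by
    rw [e']; exact h
  funext k
  rw [binomialSeries_apply, ring_choose_neg_half, List.ofFn_const, List.prod_replicate,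
    smul_eq_mul]
  rw [neg_pow z]
  have : ((-1 : ℝ) ^ k) * (-1) ^ k = 1 := by rw [← mul_pow]; simp
  linear_combination (-(coef k * z ^ k)) * this

/-- The homogeneous symmetric polynomials with generating function
`1 / √((1 - s ξ) (1 - s η))`, that is, homogenized Legendre polynomials. -/
noncomputable def leg (ξ η : ℝ) (n : ℕ) : ℝ :=
  ∑ ij ∈ Finset.HasAntidiagonal.antidiagonal n, (coef ij.1 * ξ ^ ij.1) * (coef ij.2 * η ^ ij.2)

theorem abs_leg_le {ξ η B : ℝ} (hξ : 0 ≤ ξ) (hξB : ξ ≤ B) (hη : 0 ≤ η) (hηB : η ≤ B) (n : ℕ) :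
    |leg ξ η n| ≤ (n + 1) * B ^ n := by
  have hB : 0 ≤ B := hξ.trans hξB
  have key : ∀ {x : ℝ} (i : ℕ), 0 ≤ x → x ≤ B → |coef i * x ^ i| ≤ B ^ i := by
    intro x i h0 h1
    rw [abs_of_nonneg (mul_nonneg (coef_nonneg i) (pow_nonneg h0 i))]
    calc coef i * x ^ i ≤ 1 * B ^ i :=
          mul_le_mul (coef_le_one i) (pow_le_pow_left₀ h0 h1 i) (pow_nonneg h0 i) zero_le_one
      _ = B ^ i := one_mul _
  calc |leg ξ η n| ≤ ∑ ij ∈ Finset.HasAntidiagonal.antidiagonal n, B ^ n := by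
        refine (Finset.abs_sum_le_sum_abs _ _).trans (Finset.sum_le_sum fun ij hij => ?_)
        rw [abs_mul, ← Finset.HasAntidiagonal.mem_antidiagonal.1 hij, pow_add]
        exact mul_le_mul (key _ hξ hξB) (key _ hη hηB) (abs_nonneg _) (pow_nonneg hB _)
    _ = (n + 1) * B ^ n := by simp

/-- The Cauchy product of the two binomial series in `s ξ` and `s η`; both converge absolutely
because `|s| B < 1`. -/
theorem hasSum_leg {ξ η B s : ℝ} (hξ : 0 ≤ ξ) (hξB : ξ ≤ B) (hη : 0 ≤ η) (hηB : η ≤ B)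
    (hs : |s| * B < 1) :
    HasSum (fun n => leg ξ η n * s ^ n) (1 / √((1 - s * ξ) * (1 - s * η))) := by
  have key : ∀ {x : ℝ}, 0 ≤ x → x ≤ B → |s * x| < 1 := by
    intro x h0 h1
    rw [abs_mul, abs_of_nonneg h0]
    exact (mul_le_mul_of_nonneg_left h1 (abs_nonneg s)).trans_lt hs
  have sm : ∀ {x : ℝ}, 0 ≤ x → x ≤ B → Summable fun k => ‖coef k * (s * x) ^ k‖ := by
    intro x h0 h1
    refine Summable.of_nonneg_of_le (fun _ => norm_nonneg _) (fun k => ?_)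
      (summable_geometric_of_lt_one (abs_nonneg _) (key h0 h1))
    rw [norm_mul, norm_pow, Real.norm_eq_abs, Real.norm_eq_abs, abs_of_nonneg (coef_nonneg k)]
    exact mul_le_of_le_one_left (by positivity) (coef_le_one k)
  have h1 := (abs_lt.1 (key hξ hξB)).2
  have h := tsum_mul_tsum_eq_tsum_sum_antidiagonal_of_summable_norm (sm hξ hξB) (sm hη hηB)
  have h' := (summable_norm_sum_mul_antidiagonal_of_summable_norm (sm hξ hξB) (sm hη hηB)).of_norm
  rw [(hasSum_coef (key hξ hξB)).tsum_eq, (hasSum_coef (key hη hηB)).tsum_eq] at h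
  rw [Real.sqrt_mul (by linarith), ← one_div_mul_one_div, h]
  suffices e' : (fun n => leg ξ η n * s ^ n) = fun n =>
      ∑ kl ∈ Finset.HasAntidiagonal.antidiagonal n,
        coef kl.1 * (s * ξ) ^ kl.1 * (coef kl.2 * (s * η) ^ kl.2) by
    rw [e']; exact h'.hasSum
  funext n
  rw [leg, Finset.sum_mul]
  refine Finset.sum_congr rfl fun ij hij => ?_
  rw [← Finset.HasAntidiagonal.mem_antidiagonal.1 hij, pow_add, mul_pow, mul_pow]
  ring

theorem leg_zero (ξ η : ℝ) : leg ξ η 0 = 1 := by simp [leg, coef_zero]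

/-- The formal binomial series. -/
noncomputable def coefSeries (ξ : ℝ) : PowerSeries ℝ := PowerSeries.mk fun k => coef k * ξ ^ k

open PowerSeries in
theorem coefSeries_ode (ξ : ℝ) :
    (1 - C ξ * X) * d⁄dX ℝ (coefSeries ξ) = C (ξ / 2) * coefSeries ξ := by
  ext n
  have h := coef_succ n
  rw [sub_mul, one_mul, mul_assoc, map_sub, coeff_C_mul, coeff_C_mul]
  cases n with
  | zero =>
    simp [coeff_derivative, coefSeries] at h ⊢
    rw [h]; ring
  | succ n =>
    have h' := coef_succ n
    rw [coeff_succ_X_mul]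
    simp only [coeff_derivative, coefSeries, coeff_mk] at h ⊢
    push_cast at h ⊢
    linear_combination ξ ^ (n + 1 + 1) * h

open PowerSeries in
theorem coeff_leg (ξ η : ℝ) (n : ℕ) : coeff n (coefSeries ξ * coefSeries η) = leg ξ η n := by
  simp [coeff_mul, coefSeries, leg]

open PowerSeries in
-- Logarithmic differentiation of `((1 - ξ X)(1 - η X))^(-1/2)`, carried out on formal series so
-- that no convergence enters. Its coefficients involve only the symmetric functions `ξ + η` and `ξ
-- η`.
theorem leg_ode (ξ η : ℝ) :
    (1 - C (ξ + η) * X + C (ξ * η) * X * X) * d⁄dX ℝ (coefSeries ξ * coefSeries η)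
      = (C ((ξ + η) / 2) - C (ξ * η) * X) * (coefSeries ξ * coefSeries η) := by
  have h1 := coefSeries_ode ξ
  have h2 := coefSeries_ode η
  have c1 : (C ((ξ + η) / 2) : PowerSeries ℝ) = C (ξ / 2) + C (η / 2) := by
    rw [← map_add]; congr 1; ring
  have c3 : (C ξ : PowerSeries ℝ) = 2 * C (ξ / 2) := by
    rw [two_mul, ← map_add]; congr 1; ring
  have c4 : (C η : PowerSeries ℝ) = 2 * C (η / 2) := by
    rw [two_mul, ← map_add]; congr 1; ring
  rw [Derivation.leibniz, c1, map_add, map_mul]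
  simp only [smul_eq_mul]
  rw [c3] at h1 ⊢
  rw [c4] at h2 ⊢
  linear_combination (coefSeries η * (1 - 2 * C (η / 2) * X)) * h1
    + (coefSeries ξ * (1 - 2 * C (ξ / 2) * X)) * h2

theorem leg_one (ξ η : ℝ) : leg ξ η 1 = (ξ + η) / 2 := by
  have h := congrArg (PowerSeries.coeff 0) (leg_ode ξ η)
  simp only [add_mul, sub_mul, mul_assoc, map_add, map_sub, PowerSeries.coeff_C_mul, one_mul,
    PowerSeries.coeff_zero_X_mul, PowerSeries.coeff_derivative, coeff_leg] at h
  simpa [leg_zero] using h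

/-- The coefficient of `X ^ (n + 1)` in `leg_ode`: Legendre's recurrence, homogenized by `u = (ξ +
η) / 2` and `v = ξ η`. -/
theorem leg_succ_succ (ξ η : ℝ) (n : ℕ) :
    ((n : ℝ) + 2) * leg ξ η (n + 2)
      = (2 * n + 3) * ((ξ + η) / 2) * leg ξ η (n + 1) - (n + 1) * (ξ * η) * leg ξ η n := by
  have h := congrArg (PowerSeries.coeff (n + 1)) (leg_ode ξ η)
  simp only [add_mul, sub_mul, mul_assoc, map_add, map_sub, PowerSeries.coeff_C_mul, one_mul,
    PowerSeries.coeff_succ_X_mul, PowerSeries.coeff_derivative, coeff_leg] at h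
  cases n with
  | zero =>
    simp only [PowerSeries.coeff_zero_X_mul] at h
    push_cast at h ⊢
    linear_combination h
  | succ n =>
    simp only [PowerSeries.coeff_succ_X_mul, PowerSeries.coeff_derivative, coeff_leg] at h
    push_cast at h ⊢
    linear_combination h

/-! ### Vanishing on products of Legendre polynomials -/

/-- A linear functional which vanishes on the products `P n * P m` of a sequence with the
three-term recurrence of the Legendre polynomials vanishes on all polynomials in `u` and `v`. -/
theorem eq_zero_on_adjoin {A : Type*} [CommRing A] [Algebra ℝ A] (l : A →ₗ[ℝ] ℝ) (P : ℕ → A)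
    (u v : A) (h0 : P 0 = 1) (h1 : P 1 = u)
    (h2 : ∀ n : ℕ, ((n : ℝ) + 2) • P (n + 2)
      = (2 * (n : ℝ) + 3) • (u * P (n + 1)) - ((n : ℝ) + 1) • (v * P n))
    (hl : ∀ n m, l (P n * P m) = 0) :
    ∀ h ∈ Algebra.adjoin ℝ {u, v}, l h = 0 := by
  -- The crux: the set of `h` for which `l (h P_n P_m)` always vanishes is stable under
  -- multiplication by `u` and by `v`.
  have step : ∀ h : A, (∀ n m, l (h * (P n * P m)) = 0) →
      (∀ n m, l (h * v * (P n * P m)) = 0) ∧ ∀ n m, l (h * u * (P n * P m)) = 0 := by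
    intro h hh
    have hu0 : ∀ m, l (h * u * (P 0 * P m)) = 0 := by
      intro m
      have := hh 1 m
      rwa [h1, ← mul_assoc, ← one_mul (P m), ← h0, mul_assoc, ← mul_assoc] at this
    -- The recurrence times `h P_m`: the term with `P (n + 2)` is killed, which leaves a relation
    -- between the `u`-moment at `(n + 1, m)` and the `v`-moment at `(n, m)`.
    have hrec : ∀ n m : ℕ, (2 * (n : ℝ) + 3) * l (h * u * (P (n + 1) * P m))
        = ((n : ℝ) + 1) * l (h * v * (P n * P m)) := by
      intro n m
      have e := congrArg (fun a => l (h * (a * P m))) (h2 n)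
      simp only [sub_mul, smul_mul_assoc, mul_sub, mul_smul_comm, map_sub, map_smul, hh,
        smul_eq_mul, mul_zero] at e
      have a1 : h * (u * P (n + 1) * P m) = h * u * (P (n + 1) * P m) := by ring
      have a2 : h * (v * P n * P m) = h * v * (P n * P m) := by ring
      rw [a1, a2] at e
      linarith
    -- Both families of moments are symmetric in `(n, m)`. Reading `hrec` once in each index moves
    -- zeros from row `n` of the `v`-moments to row `n + 1`; the induction starts from `P 1 = u`.
    have symm : ∀ (w : A) n m, l (w * (P n * P m)) = l (w * (P m * P n)) := by
      intro w n m; rw [mul_comm (P n)]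
    have hv : ∀ n m, l (h * v * (P n * P m)) = 0 := by
      intro n
      induction n with
      | zero =>
        intro m
        have e := hrec m 0
        rw [symm, hu0, mul_zero, symm] at e
        have hm : ((m : ℝ) + 1) ≠ 0 := by positivity
        exact (mul_eq_zero.1 e.symm).resolve_left hm
      | succ n ih =>
        intro m
        have e1 := hrec n (m + 1)
        rw [ih, mul_zero] at e1
        have e1' : l (h * u * (P (n + 1) * P (m + 1))) = 0 :=
          (mul_eq_zero.1 e1).resolve_left (by positivity)
        have e2 := hrec m (n + 1)
        rw [symm, e1', mul_zero, symm] at e2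
        exact (mul_eq_zero.1 e2.symm).resolve_left (by positivity)
    refine ⟨hv, fun n m => ?_⟩
    cases n with
    | zero => exact hu0 m
    | succ n =>
      have e := hrec n m
      rw [hv, mul_zero] at e
      exact (mul_eq_zero.1 e).resolve_left (by positivity)
  let W : Submodule ℝ A :=
    { carrier := {h | ∀ n m, l (h * (P n * P m)) = 0}
      add_mem' := by
        intro a b ha hb n m
        rw [add_mul, map_add, ha, hb, add_zero]
      zero_mem' := by intro n m; simp
      smul_mem' := by
        intro c a ha n m
        rw [smul_mul_assoc, map_smul, ha, smul_zero] }
  have key : ∀ h ∈ Algebra.adjoin ℝ {u, v}, ∀ w ∈ W, w * h ∈ W := by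
    intro h hh
    induction hh using Algebra.adjoin_induction with
    | mem x hx =>
      intro w hw
      rcases hx with rfl | hx
      · exact (step w hw).2
      · rw [mem_singleton_iff.1 hx]; exact (step w hw).1
    | algebraMap r =>
      intro w hw
      rw [mul_comm, ← Algebra.smul_def]
      exact W.smul_mem r hw
    | add x y _ _ hx hy =>
      intro w hw
      rw [mul_add]
      exact W.add_mem (hx w hw) (hy w hw)
    | mul x y _ _ hx hy =>
      intro w hw
      rw [← mul_assoc]
      exact hy _ (hx w hw)
  intro h hh
  have h1W : (1 : A) ∈ W := fun n m => by rw [one_mul]; exact hl n m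
  have := key h hh 1 h1W 0 0
  rwa [one_mul, h0, mul_one, mul_one] at this

/-- A convergent power series which vanishes near zero has zero coefficients. -/
theorem coeff_eq_zero_of_hasSum {c : ℕ → ℝ} {δ : ℝ} (hδ : 0 < δ)
    (h : ∀ s, |s| < δ → HasSum (fun n => c n * s ^ n) 0) (n : ℕ) : c n = 0 := by
  have hp : HasFPowerSeriesAt (0 : ℝ → ℝ) (FormalMultilinearSeries.ofScalars ℝ c) 0 := by
    rw [hasFPowerSeriesAt_iff]
    filter_upwards [Metric.ball_mem_nhds (0 : ℝ) hδ] with s hs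
    rw [mem_ball_zero_iff, Real.norm_eq_abs] at hs
    simpa [mul_comm] using h s hs
  have h0 := hp.eq_zero
  have := congrArg (fun p => FormalMultilinearSeries.coeff p n) h0
  rw [FormalMultilinearSeries.coeff_ofScalars] at this
  rw [this]
  simp [FormalMultilinearSeries.coeff]

end LegendreMoment

/-! ### The Abel integral in the second parameter -/

namespace LegendreMoment

/-- The argument of the arcsine is affine in `1 / (c - t)` and takes the values `-1` at `c = y` and
`1` at `c = x`. The substitution of `1 / (c - t)` for the variable turns the integrand into the
derivative of an arcsine. -/
theorem abel_hasDerivAt {t x y c : ℝ} (hty : t < y) (hyc : y < c) (hcx : c < x) :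
    HasDerivAt (fun c => (√((x - t) * (y - t)))⁻¹ *
        Real.arcsin (((x + y - 2 * t) * (c - t) - 2 * (x - t) * (y - t)) / ((x - y) * (c - t))))
      (1 / ((c - t) * (√(x - c) * √(c - y)))) c := by
  have hct : 0 < c - t := by linarith
  have hxy : 0 < x - y := by linarith
  have hxt : 0 < x - t := by linarith
  have hyt : 0 < y - t := by linarith
  have hxc : 0 < x - c := by linarith
  have hcy : 0 < c - y := by linarith
  set A := (x - t) * (y - t) with hA
  have hApos : 0 < A := mul_pos hxt hyt
  set L : ℝ → ℝ := fun c => ((x + y - 2 * t) * (c - t) - 2 * (x - t) * (y - t)) /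
    ((x - y) * (c - t)) with hL
  have hLd : HasDerivAt L (2 * A / ((x - y) * (c - t) ^ 2)) c := by
    have h1 : HasDerivAt (fun c : ℝ => c - t) 1 c := (hasDerivAt_id c).sub_const t
    have h2 := ((h1.const_mul (x + y - 2 * t)).sub_const (2 * (x - t) * (y - t))).div
      (h1.const_mul (x - y)) (by positivity)
    refine h2.congr_deriv ?_
    field_simp
    simp only [hA]
    ring
  have hsq : 1 - L c ^ 2 = 4 * A * ((x - c) * (c - y)) / ((x - y) ^ 2 * (c - t) ^ 2) := by
    simp only [hL, hA]
    field_simp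
    ring
  have hpos : 0 < 1 - L c ^ 2 := by rw [hsq]; positivity
  have hm1 : L c ≠ -1 := by intro h; rw [h] at hpos; norm_num at hpos
  have hp1 : L c ≠ 1 := by intro h; rw [h] at hpos; norm_num at hpos
  have hd := ((Real.hasDerivAt_arcsin hm1 hp1).comp c hLd).const_mul (√A)⁻¹
  refine hd.congr_deriv ?_
  have hs : √(1 - L c ^ 2) = 2 * √A * (√(x - c) * √(c - y)) / ((x - y) * (c - t)) := by
    rw [hsq, Real.sqrt_div (by positivity), Real.sqrt_mul (by positivity),
      Real.sqrt_mul (by positivity), Real.sqrt_mul hxc.le, ← mul_pow,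
      Real.sqrt_sq (by positivity)]
    congr 3
    rw [show (4 : ℝ) = 2 ^ 2 by norm_num, Real.sqrt_sq (by norm_num)]
  rw [hs]
  have h1 : 0 < √A := Real.sqrt_pos.2 hApos
  have h2 : 0 < √(x - c) := Real.sqrt_pos.2 hxc
  have h3 : 0 < √(c - y) := Real.sqrt_pos.2 hcy
  have h4 : A = √A ^ 2 := (Real.sq_sqrt hApos.le).symm
  rw [h4, Real.sqrt_sq h1.le]
  field_simp

theorem abel_integral {t x y : ℝ} (hty : t < y) (hyx : y < x) :
    Integrable (fun c => 1 / ((c - t) * (√(x - c) * √(c - y)))) ∧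
    ∫ c, 1 / ((c - t) * (√(x - c) * √(c - y))) = Real.pi / √((x - t) * (y - t)) := by
  -- Outside `[y, x]` one of the radicands is negative, its root is `0` by convention and so is the
  -- quotient. The integral over the line is therefore an integral over `[y, x]`.
  have hsupp : Function.support (fun c => 1 / ((c - t) * (√(x - c) * √(c - y)))) ⊆ Ioc y x := by
    intro c hc
    by_contra h
    rw [Function.mem_support] at hc
    apply hc
    rw [mem_Ioc, not_and_or, not_lt, not_le] at h
    rcases h with h | h
    · rw [Real.sqrt_eq_zero_of_nonpos (x := c - y) (by linarith)]; simp
    · rw [Real.sqrt_eq_zero_of_nonpos (x := x - c) (by linarith)]; simp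
  have hcont : ContinuousOn (fun c => (√((x - t) * (y - t)))⁻¹ *
        Real.arcsin (((x + y - 2 * t) * (c - t) - 2 * (x - t) * (y - t)) / ((x - y) * (c - t))))
      (Icc y x) := by
    refine continuousOn_const.mul (Real.continuous_arcsin.comp_continuousOn ?_)
    refine ContinuousOn.div (by fun_prop) (by fun_prop) fun c hc => ?_
    exact (mul_pos (sub_pos.2 hyx) (sub_pos.2 (hty.trans_le hc.1))).ne'
  have hderiv := fun c (hc : c ∈ Ioo y x) => abel_hasDerivAt hty hc.1 hc.2
  -- The integrand blows up at both ends; it is integrable as the non-negative derivative of a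
  -- function continuous up to the ends.
  have hint := intervalIntegral.integrableOn_deriv_of_nonneg hcont hderiv (fun c hc => by
    have : 0 < c - t := by linarith [hc.1]
    positivity)
  refine ⟨(integrableOn_iff_integrable_of_support_subset hsupp).1 hint, ?_⟩
  rw [← setIntegral_eq_integral_of_forall_compl_eq_zero (s := Ioc y x) (fun c hc => by
      by_contra h; exact hc (hsupp h)),
    ← intervalIntegral.integral_of_le hyx.le,
    intervalIntegral.integral_eq_sub_of_hasDerivAt_of_le hyx.le hcont hderiv
      ((intervalIntegrable_iff_integrableOn_Ioc_of_le hyx.le).2 hint)]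
  have hxy : x - y ≠ 0 := (sub_pos.2 hyx).ne'
  have hxt : x - t ≠ 0 := by linarith
  have hyt : y - t ≠ 0 := by linarith
  have e1 : ((x + y - 2 * t) * (x - t) - 2 * (x - t) * (y - t)) / ((x - y) * (x - t)) = 1 := by
    field_simp; ring
  have e2 : ((x + y - 2 * t) * (y - t) - 2 * (x - t) * (y - t)) / ((x - y) * (y - t)) = -1 := by
    field_simp; ring
  rw [e1, e2, Real.arcsin_neg, Real.arcsin_one]
  ring

/-- The density of the Leray form in the angle variables. -/
noncomputable def kernel (s c x y : ℝ) : ℝ := (x - y) / (√((x - s) * (x - c)) * √((y - s) * (c - y)))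

theorem kernel_nonneg {s c x y : ℝ} (h : y ≤ x) : 0 ≤ kernel s c x y :=
  div_nonneg (sub_nonneg.2 h) (by positivity)

theorem kernel_eq {s c x y : ℝ} (hx : s < x) (hy : s < y) :
    kernel s c x y = (x - y) / √((x - s) * (y - s)) * (1 / (√(x - c) * √(c - y))) := by
  rw [kernel, Real.sqrt_mul (by linarith), Real.sqrt_mul (by linarith),
    Real.sqrt_mul (by linarith)]
  field_simp

/-- The kernel depends on `c` only through `1 / (√(x - c) √(c - y))`, so the Abel integral applies.
The outcome is symmetric in `s` and `t`, which is what makes the later double expansion possible. -/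
theorem kernel_integral {s t x y : ℝ} (hs : s < y) (ht : t < y) (hyx : y < x) :
    Integrable (fun c => (c - t)⁻¹ * kernel s c x y) ∧
    ∫ c, (c - t)⁻¹ * kernel s c x y
      = Real.pi * ((x - y) / (√((x - s) * (y - s)) * √((x - t) * (y - t)))) := by
  have e : (fun c => (c - t)⁻¹ * kernel s c x y) = fun c =>
      (x - y) / √((x - s) * (y - s)) * (1 / ((c - t) * (√(x - c) * √(c - y)))) := by
    funext c
    rw [kernel_eq (hs.trans hyx) hs]
    simp only [one_div, mul_inv]
    ring
  obtain ⟨h1, h2⟩ := abel_integral ht hyx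
  rw [e]
  refine ⟨h1.const_mul _, ?_⟩
  rw [integral_const_mul, h2]
  field_simp

/-- Here the conventions for roots of negative numbers and for division by zero extend the density
by zero off the allowed region. -/
theorem kernel_zero_of_notMem {s c x y : ℝ} (hx : s < x) (hy : s < y) (h : c ∉ Ioo y x) :
    kernel s c x y = 0 := by
  rw [kernel_eq hx hy]
  rw [mem_Ioo, not_and_or, not_lt, not_lt] at h
  rcases h with h | h
  · rw [Real.sqrt_eq_zero_of_nonpos (x := c - y) (by linarith)]; simp
  · rw [Real.sqrt_eq_zero_of_nonpos (x := x - c) (by linarith)]; simp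

/-! ### From the vanishing transform to vanishing moments -/

section inversion

variable {Ω : Type*} [MeasurableSpace Ω] {P : Measure Ω} [IsFiniteMeasure P] {x y g : Ω → ℝ}
  {a b m : ℝ}

/-- The hypothesis is integrated against `dc / (c - t)` and the order of integration is exchanged.
The assumption `H` is available only for almost every `c`, and only where the kernel is integrable;
Fubini's theorem tolerates the first and supplies the second. -/
theorem abel_average (hx : Measurable x) (hy : Measurable y) (hg : Measurable g) {Cg : ℝ}
    (hgb : ∀ z, |g z| ≤ Cg) (hy0 : ∀ z, 0 ≤ y z) (hyx : ∀ᵐ z ∂P, y z < x z) (hxb : ∀ z, x z ≤ b)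
    (H : ∀ s ∈ Ioo m 0, ∀ c ∈ Ioo 0 b, c ≠ a →
      Integrable (fun z => kernel s c (x z) (y z)) P →
      ∫ z, g z * kernel s c (x z) (y z) ∂P = 0) {s t : ℝ} (hs : s ∈ Ioo m 0) (ht : t ∈ Ioo m 0) :
    ∫ z, g z * ((x z - y z) / (√((x z - s) * (y z - s)) * √((x z - t) * (y z - t)))) ∂P = 0 := by
  have hs0 := hs.2
  have ht0 := ht.2
  set Φ : Ω × ℝ → ℝ := fun q => (q.2 - t)⁻¹ * kernel s q.2 (x q.1) (y q.1) with hΦ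
  have hΦm : Measurable Φ := by
    simp only [hΦ, kernel]
    fun_prop
  have hfib : ∀ᵐ z ∂P, Integrable (fun c => Φ (z, c)) ∧ ∫ c, Φ (z, c)
      = Real.pi * ((x z - y z) / (√((x z - s) * (y z - s)) * √((x z - t) * (y z - t)))) := by
    filter_upwards [hyx] with z hz
    exact kernel_integral (by linarith [hy0 z]) (by linarith [hy0 z]) hz
  have hΦn : ∀ᵐ z ∂P, ∀ c, 0 ≤ Φ (z, c) := by
    filter_upwards [hyx] with z hz c
    by_cases hc : c ∈ Ioo (y z) (x z)
    · have : 0 < c - t := by linarith [hy0 z, hc.1]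
      exact mul_nonneg (inv_nonneg.2 this.le) (kernel_nonneg hz.le)
    · simp only [hΦ]
      rw [kernel_zero_of_notMem (by linarith [hy0 z]) (by linarith [hy0 z]) hc, mul_zero]
  -- From `x, y ≥ 0` and `s, t < 0` the two roots are at least `-s` and `-t`.
  have hbound : ∀ᵐ z ∂P,
      |(x z - y z) / (√((x z - s) * (y z - s)) * √((x z - t) * (y z - t)))| ≤ b / (s * t) := by
    filter_upwards [hyx] with z hz
    have h1 : -s ≤ √((x z - s) * (y z - s)) :=
      Real.le_sqrt_of_sq_le (by nlinarith [hy0 z])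
    have h2 : -t ≤ √((x z - t) * (y z - t)) :=
      Real.le_sqrt_of_sq_le (by nlinarith [hy0 z])
    rw [abs_of_nonneg (div_nonneg (by linarith) (by positivity))]
    have h3 : s * t ≤ √((x z - s) * (y z - s)) * √((x z - t) * (y z - t)) := by nlinarith
    have h4 : 0 < s * t := by nlinarith
    have h5 := hy0 z
    have h6 := hxb z
    exact div_le_div₀ (by linarith) (by linarith) h4 h3
  -- Tonelli: `Φ` is non-negative almost everywhere, its integrals over `c` are bounded, and `P` is
  -- finite.
  have hint : Integrable Φ (P.prod volume) := by
    rw [integrable_prod_iff hΦm.aestronglyMeasurable]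
    refine ⟨hfib.mono fun z h => h.1, ?_⟩
    have e : (fun z => ∫ c, ‖Φ (z, c)‖) =ᵐ[P] fun z =>
        Real.pi * ((x z - y z) / (√((x z - s) * (y z - s)) * √((x z - t) * (y z - t)))) := by
      filter_upwards [hfib, hΦn] with z h1 h2
      rw [← h1.2]
      exact integral_congr_ae (.of_forall fun c => Real.norm_of_nonneg (h2 c))
    rw [integrable_congr e]
    refine Integrable.const_mul ?_ _
    refine Integrable.of_bound (Measurable.aestronglyMeasurable (by fun_prop)) (b / (s * t)) hbound
  have hgint : Integrable (fun q : Ω × ℝ => g q.1 * Φ q) (P.prod volume) := by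
    refine hint.bdd_mul (hg.comp measurable_fst).aestronglyMeasurable (c := Cg) (.of_forall fun q => hgb q.1)
  have hzero : ∀ᵐ c : ℝ, ∫ z, g z * Φ (z, c) ∂P = 0 := by
    have hne : ∀ᵐ c : ℝ, c ≠ a := by simp [ae_iff]
    have hne0 : ∀ᵐ c : ℝ, c ≠ 0 := by simp [ae_iff]
    have hneb : ∀ᵐ c : ℝ, c ≠ b := by simp [ae_iff]
    filter_upwards [hint.prod_left_ae, hne, hne0, hneb] with c hc hca hc0 hcb
    by_cases hcI : c ∈ Ioo 0 b
    · have hct : c - t ≠ 0 := by linarith [hcI.1]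
      have h1 : Integrable (fun z => kernel s c (x z) (y z)) P := by
        have := hc.const_mul (c - t)
        refine this.congr (.of_forall fun z => ?_)
        simp only [hΦ]
        field_simp
      have h2 := H s hs c hcI hca h1
      have e : (fun z => g z * Φ (z, c))
          = fun z => (c - t)⁻¹ * (g z * kernel s c (x z) (y z)) := by
        funext z; simp only [hΦ]; ring
      rw [e, integral_const_mul, h2, mul_zero]
    -- For `c` outside `(0, b)` no hypothesis is available, but none is needed: `(y, x) ⊆ (0, b)`,
    -- so the kernel vanishes.
    · have : ∀ z, Φ (z, c) = 0 ∨ ¬ y z < x z := by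
        intro z
        by_cases hz : y z < x z
        · left
          simp only [hΦ]
          rw [kernel_zero_of_notMem (by linarith [hy0 z]) (by linarith [hy0 z]), mul_zero]
          intro h
          exact hcI ⟨(hy0 z).trans_lt h.1, h.2.trans_le (hxb z)⟩
        · exact Or.inr hz
      refine integral_eq_zero_of_ae ?_
      filter_upwards [hyx] with z hz
      rw [(this z).resolve_right (not_not.2 hz)]
      simp
  have hswap := integral_integral_swap (f := fun z c => g z * Φ (z, c)) hgint
  rw [integral_congr_ae hzero, integral_zero] at hswap
  have e : ∫ z, (∫ c, g z * Φ (z, c)) ∂P = Real.pi * ∫ z, g z * ((x z - y z) /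
      (√((x z - s) * (y z - s)) * √((x z - t) * (y z - t)))) ∂P := by
    rw [← integral_const_mul]
    refine integral_congr_ae ?_
    filter_upwards [hfib] with z h
    rw [integral_const_mul, h.2]
    ring
  rw [e] at hswap
  exact (mul_eq_zero.1 hswap).resolve_left Real.pi_ne_zero

/-- If a bounded density is orthogonal to all products of two generating functions, it is
orthogonal to the products of their coefficients. -/
theorem integral_leg_mul_leg {ξ η M : Ω → ℝ} (hξ : Measurable ξ) (hη : Measurable η)
    (hM : Measurable M) {CM δ : ℝ} (hδ : 0 < δ) (hMb : ∀ z, |M z| ≤ CM)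
    (hξ0 : ∀ z, 0 ≤ ξ z) (hξb : ∀ z, ξ z ≤ δ⁻¹) (hη0 : ∀ z, 0 ≤ η z) (hηb : ∀ z, η z ≤ δ⁻¹)
    (H : ∀ s t, |s| < δ → |t| < δ → ∫ z, M z * (1 / √((1 - s * ξ z) * (1 - s * η z)) *
      (1 / √((1 - t * ξ z) * (1 - t * η z)))) ∂P = 0) (n k : ℕ) :
    ∫ z, M z * (leg (ξ z) (η z) n * leg (ξ z) (η z) k) ∂P = 0 := by
  have hlegm : ∀ n, Measurable fun z => leg (ξ z) (η z) n := by
    intro n; unfold leg; fun_prop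
  -- One parameter at a time: for a bounded weight `W` the integral against the generating function
  -- is a power series in `s`, by termwise integration. It vanishes for `|s| < δ`, hence so do its
  -- coefficients.
  have main : ∀ W : Ω → ℝ, Measurable W → ∀ CW, (∀ z, |W z| ≤ CW) →
      (∀ s, |s| < δ → ∫ z, W z * (1 / √((1 - s * ξ z) * (1 - s * η z))) ∂P = 0) →
      ∀ n, ∫ z, W z * leg (ξ z) (η z) n ∂P = 0 := by
    intro W hW CW hCW HW
    refine coeff_eq_zero_of_hasSum hδ fun s hs => ?_
    have hsδ : |s| * δ⁻¹ < 1 := by rwa [← div_eq_mul_inv, div_lt_one hδ]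
    have hb : ∀ n z, ‖W z * (leg (ξ z) (η z) n * s ^ n)‖ ≤ CW * ((n + 1) * (|s| * δ⁻¹) ^ n) := by
      intro n z
      rw [norm_mul, Real.norm_eq_abs, Real.norm_eq_abs, abs_mul, abs_pow, mul_pow]
      refine mul_le_mul (hCW z) ?_ (by positivity) ((abs_nonneg _).trans (hCW z))
      have := abs_leg_le (hξ0 z) (hξb z) (hη0 z) (hηb z) n
      calc _ ≤ ((n + 1) * δ⁻¹ ^ n) * |s| ^ n := mul_le_mul_of_nonneg_right this (by positivity)
        _ = _ := by ring
    have hi : ∀ n, Integrable (fun z => W z * (leg (ξ z) (η z) n * s ^ n)) P := fun n =>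
      Integrable.of_bound ((hW.mul ((hlegm n).mul_const _)).aestronglyMeasurable) _
        (.of_forall (hb n))
    have hsum : Summable fun n : ℕ => CW * (((n : ℝ) + 1) * (|s| * δ⁻¹) ^ n) := by
      refine Summable.mul_left _ ?_
      have hn : ‖|s| * δ⁻¹‖ < 1 := by rwa [Real.norm_of_nonneg (by positivity)]
      have h1 := summable_pow_mul_geometric_of_norm_lt_one 1 hn
      have h2 := summable_geometric_of_norm_lt_one hn
      refine (h1.add h2).congr fun n => ?_
      simp only [pow_one]
      ring
    have hF : Summable fun n => ∫ z, ‖W z * (leg (ξ z) (η z) n * s ^ n)‖ ∂P := by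
      refine Summable.of_nonneg_of_le (fun n => integral_nonneg fun z => norm_nonneg _)
        (fun n => ?_) (hsum.mul_left (P.real univ))
      calc _ ≤ ∫ _, CW * (((n : ℝ) + 1) * (|s| * δ⁻¹) ^ n) ∂P :=
            integral_mono (hi n).norm (integrable_const _) (hb n)
        _ = _ := by simp
    have h := hasSum_integral_of_summable_integral_norm hi hF
    have e : ∫ z, ∑' n, W z * (leg (ξ z) (η z) n * s ^ n) ∂P = 0 := by
      rw [← HW s hs]
      refine integral_congr_ae (.of_forall fun z => ?_)
      simp only
      rw [tsum_mul_left, (hasSum_leg (hξ0 z) (hξb z) (hη0 z) (hηb z) hsδ).tsum_eq]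
    rw [e] at h
    suffices e' : (fun n => (∫ z, W z * leg (ξ z) (η z) n ∂P) * s ^ n)
        = fun n => ∫ z, W z * (leg (ξ z) (η z) n * s ^ n) ∂P by
      rw [e']; exact h
    funext n
    rw [← integral_mul_const]
    refine integral_congr_ae (.of_forall fun z => ?_)
    simp only
    ring
  have hfac : ∀ t, |t| < δ → ∀ z,
      |1 / √((1 - t * ξ z) * (1 - t * η z))| ≤ 1 / (1 - |t| * δ⁻¹) := by
    intro t ht z
    have htδ : 0 < 1 - |t| * δ⁻¹ := by
      have : |t| * δ⁻¹ < 1 := by rwa [← div_eq_mul_inv, div_lt_one hδ]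
      linarith
    have key : ∀ {r : ℝ}, 0 ≤ r → r ≤ δ⁻¹ → 1 - |t| * δ⁻¹ ≤ 1 - t * r := by
      intro r h0 h1
      have : t * r ≤ |t| * δ⁻¹ :=
        (mul_le_mul_of_nonneg_right (le_abs_self t) h0).trans
          (mul_le_mul_of_nonneg_left h1 (abs_nonneg t))
      linarith
    rw [abs_of_nonneg (by positivity)]
    refine one_div_le_one_div_of_le htδ (Real.le_sqrt_of_sq_le ?_)
    rw [sq]
    exact mul_le_mul (key (hξ0 z) (hξb z)) (key (hη0 z) (hηb z)) htδ.le
      (htδ.le.trans (key (hξ0 z) (hξb z)))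
  have hlegb : ∀ z, |leg (ξ z) (η z) n| ≤ (n + 1) * δ⁻¹ ^ n := fun z =>
    abs_leg_le (hξ0 z) (hξb z) (hη0 z) (hηb z) n
  -- First expansion, in `s`, with the generating function in `t` absorbed into the weight. The
  -- second one, in `t`, then has the weight `M * leg n`.
  have step : ∀ t, |t| < δ →
      ∫ z, M z * (1 / √((1 - t * ξ z) * (1 - t * η z))) * leg (ξ z) (η z) n ∂P = 0 := by
    intro t ht
    refine main (fun z => M z * (1 / √((1 - t * ξ z) * (1 - t * η z)))) (by fun_prop)
      (CM * (1 / (1 - |t| * δ⁻¹))) (fun z => ?_) (fun s hs => ?_) n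
    · rw [abs_mul]
      exact mul_le_mul (hMb z) (hfac t ht z) (abs_nonneg _) ((abs_nonneg _).trans (hMb z))
    · rw [← H s t hs ht]
      refine integral_congr_ae (.of_forall fun z => ?_)
      simp only
      ring
  have := main (fun z => M z * leg (ξ z) (η z) n) (hM.mul (hlegm n))
    (CM * ((n + 1) * δ⁻¹ ^ n)) (fun z => by
      rw [abs_mul]
      exact mul_le_mul (hMb z) (hlegb z) (abs_nonneg _) ((abs_nonneg _).trans (hMb z)))
    (fun t ht => by
      rw [← step t ht]
      refine integral_congr_ae (.of_forall fun z => ?_)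
      simp only
      ring) k
  rw [← this]
  refine integral_congr_ae (.of_forall fun z => ?_)
  simp only
  ring

end inversion
end LegendreMoment

/-! ### Stone–Weierstrass and injectivity in the angle variables -/

namespace LegendreMoment

section compact

variable {Ω : Type*} [TopologicalSpace Ω] [CompactSpace Ω] [MeasurableSpace Ω] [BorelSpace Ω]
  {P : Measure Ω} [IsFiniteMeasure P]

/-- The functional `f ↦ ∫ M f` is continuous for the uniform norm and vanishes on the algebra
generated by `(ξ + η) / 2` and `ξ η`. This algebra is dense, because an unordered pair split by the
threshold `c` determines the ordered pair. -/
theorem integral_mul_eq_zero_of_leg (ξ η M : C(Ω, ℝ)) (c : ℝ)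
    (hξ : ∀ z, ξ z ≤ c) (hη : ∀ z, c ≤ η z) (hsep : ∀ p q, ξ p = ξ q → η p = η q → p = q)
    (H : ∀ n k, ∫ z, M z * (leg (ξ z) (η z) n * leg (ξ z) (η z) k) ∂P = 0) (h : C(Ω, ℝ)) :
    ∫ z, M z * h z ∂P = 0 := by
  have hint : ∀ f : C(Ω, ℝ), Integrable (fun z => M z * f z) P := fun f =>
    (M.continuous.mul f.continuous).integrable_of_hasCompactSupport
      (HasCompactSupport.of_compactSpace _)
  let l₀ : C(Ω, ℝ) →ₗ[ℝ] ℝ :=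
    { toFun := fun f => ∫ z, M z * f z ∂P
      map_add' := fun f g => by
        rw [← integral_add (hint f) (hint g)]
        simp only [ContinuousMap.add_apply, mul_add]
      map_smul' := fun r f => by
        simp only [ContinuousMap.smul_apply, smul_eq_mul, RingHom.id_apply]
        rw [← integral_const_mul]
        refine integral_congr_ae (.of_forall fun z => ?_)
        simp only
        ring }
  have hbd : ∀ f, ‖l₀ f‖ ≤ (‖M‖ * P.real univ) * ‖f‖ := by
    intro f
    calc ‖l₀ f‖ ≤ (‖M‖ * ‖f‖) * P.real univ := by
          refine norm_integral_le_of_norm_le_const (.of_forall fun z => ?_)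
          rw [norm_mul]
          exact mul_le_mul (M.norm_coe_le_norm z) (f.norm_coe_le_norm z) (norm_nonneg _)
            (norm_nonneg _)
      _ = _ := by ring
  have hcont : Continuous l₀ := (l₀.mkContinuous _ hbd).continuous
  let Q : ℕ → C(Ω, ℝ) := fun n => ⟨fun z => leg (ξ z) (η z) n, by unfold leg; fun_prop⟩
  let u : C(Ω, ℝ) := (1 / 2 : ℝ) • (ξ + η)
  let v : C(Ω, ℝ) := ξ * η
  have hzero := eq_zero_on_adjoin l₀ Q u v
    (by ext z; simp [Q, leg_zero])
    (by ext z; simp only [Q, u, ContinuousMap.coe_mk, leg_one, ContinuousMap.smul_apply,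
          ContinuousMap.add_apply, smul_eq_mul]; ring)
    (by
      intro n
      ext z
      have := leg_succ_succ (ξ z) (η z) n
      simp only [Q, u, v, ContinuousMap.smul_apply, ContinuousMap.sub_apply,
        ContinuousMap.mul_apply, ContinuousMap.add_apply, ContinuousMap.coe_mk, smul_eq_mul]
      linear_combination this)
    (fun n k => H n k)
  have hdense : (Algebra.adjoin ℝ {u, v}).topologicalClosure = ⊤ := by
    apply ContinuousMap.subalgebra_topologicalClosure_eq_top_of_separatesPoints
    intro p q hpq
    by_contra hcon
    have hall : ∀ f ∈ Algebra.adjoin ℝ {u, v}, f p = f q := by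
      intro f hf
      by_contra hne
      exact hcon ⟨f, ⟨f, hf, rfl⟩, hne⟩
    have hu := hall u (Algebra.subset_adjoin (by simp))
    have hv := hall v (Algebra.subset_adjoin (by simp))
    simp only [u, v, ContinuousMap.smul_apply, ContinuousMap.add_apply, smul_eq_mul,
      ContinuousMap.mul_apply] at hu hv
    -- `ξ p` is a root of the quadratic polynomial with roots `ξ q` and `η q`. If it equals `η q`,
    -- the threshold forces all four values to be `c`.
    have h1 : (ξ p - ξ q) * (ξ p - η q) = 0 := by linear_combination (2 * ξ p) * hu - hv
    have hξe : ξ p = ξ q := by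
      rcases mul_eq_zero.1 h1 with h | h
      · linarith
      · linarith [hξ p, hξ q, hη p, hη q]
    exact hpq (hsep p q hξe (by linarith))
  have hmem : h ∈ ((Algebra.adjoin ℝ {u, v}).topologicalClosure : Set C(Ω, ℝ)) := by
    rw [hdense]; trivial
  rw [Subalgebra.topologicalClosure_coe] at hmem
  have hclosed : IsClosed {f : C(Ω, ℝ) | l₀ f = 0} := isClosed_eq hcont continuous_const
  exact closure_minimal (fun f hf => hzero f hf) hclosed hmem

/-- Injectivity of the Radon transform in the angle variables. -/
theorem ae_eq_zero_of_kernel_integral (x y k w : C(Ω, ℝ)) {a b m : ℝ} (hm : m < 0)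
    (hy0 : ∀ z, 0 ≤ y z) (hya : ∀ z, y z ≤ a) (hax : ∀ z, a ≤ x z) (hxb : ∀ z, x z ≤ b)
    (hyx : ∀ᵐ z ∂P, y z < x z) (hw : ∀ z, 0 < w z)
    (hsep : ∀ p q, x p = x q → y p = y q → p = q)
    (H : ∀ s ∈ Ioo m 0, ∀ c ∈ Ioo 0 b, c ≠ a →
      Integrable (fun z => kernel s c (x z) (y z)) P →
      ∫ z, (k z * w z) * kernel s c (x z) (y z) ∂P = 0) :
    ∀ᵐ z ∂P, k z = 0 := by
  -- The midpoint `-δ` of `(m, 0)` becomes the centre of expansion: for `|s| < δ` the parameter `s -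
  -- δ` ranges over exactly `(m, 0)`.
  set δ : ℝ := -m / 2 with hδ
  have hδ0 : 0 < δ := by rw [hδ]; linarith
  have hX : ∀ z, 0 < x z + δ := fun z => by linarith [hy0 z, hya z, hax z]
  have hY : ∀ z, 0 < y z + δ := fun z => by linarith [hy0 z]
  have ha : 0 < a + δ ∨ IsEmpty Ω := by
    rcases isEmpty_or_nonempty Ω with h | ⟨⟨z⟩⟩
    · exact Or.inr h
    · exact Or.inl (by linarith [hY z, hya z])
  rcases ha with ha | hemp
  swap
  · exact .of_forall fun z => (hemp.false z).elim
  let ξ : C(Ω, ℝ) := ⟨fun z => (x z + δ)⁻¹, by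
    exact (x.continuous.add continuous_const).inv₀ fun z => (hX z).ne'⟩
  let η : C(Ω, ℝ) := ⟨fun z => (y z + δ)⁻¹, by
    exact (y.continuous.add continuous_const).inv₀ fun z => (hY z).ne'⟩
  have hξe : ∀ z, ξ z = (x z + δ)⁻¹ := fun z => rfl
  have hηe : ∀ z, η z = (y z + δ)⁻¹ := fun z => rfl
  have hξ0 : ∀ z, 0 < ξ z := fun z => inv_pos.2 (hX z)
  have hη0 : ∀ z, 0 < η z := fun z => inv_pos.2 (hY z)
  let M : C(Ω, ℝ) := k * w * (x - y) * ξ * η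
  have hM : ∀ z, M z = k z * w z * (x z - y z) * ξ z * η z := fun z => rfl
  have hav := fun s hs t ht => abel_average (P := P) x.continuous.measurable
    y.continuous.measurable (k * w).continuous.measurable (fun z => (k * w).norm_coe_le_norm z)
    hy0 hyx hxb (H) (s := s) (t := t) hs ht
  have hleg := integral_leg_mul_leg (P := P) (ξ := ξ) (η := η) (M := M) ξ.continuous.measurable
    η.continuous.measurable M.continuous.measurable hδ0 (fun z => M.norm_coe_le_norm z)
    (fun z => (hξ0 z).le)
    (fun z => inv_anti₀ hδ0 (by linarith [hy0 z, hya z, hax z]))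
    (fun z => (hη0 z).le) (fun z => inv_anti₀ hδ0 (by linarith [hy0 z]))
    (by
      intro s t hs ht
      have hs' := abs_lt.1 hs
      have ht' := abs_lt.1 ht
      rw [← hav (s - δ) ⟨by rw [hδ] at hs' ⊢; linarith, by linarith⟩ (t - δ)
        ⟨by rw [hδ] at ht' ⊢; linarith, by linarith⟩]
      refine integral_congr_ae (.of_forall fun z => ?_)
      -- `x - (r - δ) = (x + δ)(1 - r ξ)`, and likewise for `y`. The two factors `√((x + δ)(y +
      -- δ))`, one from `s` and one from `t`, account for `ξ η` in `M`.
      have key : ∀ r : ℝ, √((x z - (r - δ)) * (y z - (r - δ)))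
          = √((x z + δ) * (y z + δ)) * √((1 - r * ξ z) * (1 - r * η z)) := by
        intro r
        rw [← Real.sqrt_mul (mul_pos (hX z) (hY z)).le]
        congr 1
        rw [hξe, hηe]
        have h1 := (hX z).ne'
        have h2 := (hY z).ne'
        field_simp
        ring
      have hsq : √((x z + δ) * (y z + δ)) ^ 2 = (x z + δ) * (y z + δ) :=
        Real.sq_sqrt (mul_pos (hX z) (hY z)).le
      have h1 : ξ z * η z = (√((x z + δ) * (y z + δ)) ^ 2)⁻¹ := by
        rw [hsq, hξe, hηe, mul_inv]
      simp only [ContinuousMap.mul_apply]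
      rw [key, key, hM]
      calc _ = k z * w z * (x z - y z) * (ξ z * η z) * (1 / √((1 - s * ξ z) * (1 - s * η z)) *
              (1 / √((1 - t * ξ z) * (1 - t * η z)))) := by ring
        _ = _ := by
          rw [h1]
          simp only [div_eq_mul_inv, mul_inv, one_mul, sq]
          ring)
  have h0 := integral_mul_eq_zero_of_leg (P := P) ξ η M (a + δ)⁻¹
    (fun z => inv_anti₀ ha (by linarith [hax z]))
    (fun z => inv_anti₀ (hY z) (by linarith [hya z]))
    (fun p q h1 h2 => hsep p q (by
      rw [hξe, hξe, inv_inj] at h1; linarith) (by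
      rw [hηe, hηe, inv_inj] at h2; linarith))
    hleg k
  -- With `k` itself as test function the integrand is `k²` times a non-negative weight, which is
  -- positive where `y < x`.
  have hnn : ∀ z, 0 ≤ M z * k z := fun z => by
    have : 0 ≤ x z - y z := by linarith [hya z, hax z]
    have h2 : M z * k z = (k z) ^ 2 * (w z * (x z - y z) * ξ z * η z) := by rw [hM]; ring
    rw [h2]
    exact mul_nonneg (sq_nonneg _) (mul_nonneg (mul_nonneg (mul_nonneg (hw z).le this)
      (hξ0 z).le) (hη0 z).le)
  rw [integral_eq_zero_iff_of_nonneg hnn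
    ((M.continuous.mul k.continuous).integrable_of_hasCompactSupport
      (HasCompactSupport.of_compactSpace _))] at h0
  filter_upwards [h0, hyx] with z hz hlt
  simp only [Pi.zero_apply, hM] at hz
  have h1 := hw z
  have h2 := hξ0 z
  have h3 := hη0 z
  have h4 : 0 < x z - y z := by linarith
  by_contra hk
  exact absurd hz (by positivity)

end compact
end LegendreMoment

/-! ### Even periodic profiles -/

/-- The common properties of the functions `φ₁`, `φ₂` of a table of classical type. -/
structure IsProfile (φ : ℝ → ℝ) (T : ℝ) : Prop where
  pos : 0 < T
  smooth : ContDiff ℝ ∞ φ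
  even : ∀ t, φ (-t) = φ t
  symm : ∀ t, φ (T / 2 - t) = φ t
  deriv_pos : ∀ t ∈ Ioo 0 (T / 4), 0 < deriv φ t

namespace IsProfile

variable {φ : ℝ → ℝ} {T : ℝ} (h : IsProfile φ T)

include h

theorem add_half (t : ℝ) : φ (t + T / 2) = φ t := by
  rw [← h.even t, ← h.symm (-t)]; congr 1; ring

theorem periodic : Function.Periodic φ (T / 2) := h.add_half

theorem strictMonoOn : StrictMonoOn φ (Icc 0 (T / 4)) :=
  strictMonoOn_of_deriv_pos (convex_Icc _ _) h.smooth.continuous.continuousOn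
    (by rw [interior_Icc]; exact h.deriv_pos)

theorem exists_fold (t : ℝ) : ∃ r ∈ Icc 0 (T / 4), ∃ k : ℤ, t = r + k * (T / 2) ∨
    t = -r + k * (T / 2) := by
  have hT := h.pos
  set k := round (t / (T / 2)) with hk
  have h1 := abs_sub_round (t / (T / 2))
  rw [← hk] at h1
  have h2 : |t - k * (T / 2)| ≤ T / 4 := by
    have e : t - k * (T / 2) = (t / (T / 2) - k) * (T / 2) := by field_simp
    rw [e, abs_mul, abs_of_pos (by linarith : 0 < T / 2)]
    nlinarith
  refine ⟨|t - k * (T / 2)|, ⟨abs_nonneg _, h2⟩, k, ?_⟩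
  rcases abs_choice (t - k * (T / 2)) with e | e <;> rw [e]
  · left; ring
  · right; ring

theorem add_int_mul (r : ℝ) (k : ℤ) : φ (r + k * (T / 2)) = φ r :=
  h.periodic.int_mul k r

theorem mem_Icc (t : ℝ) : φ t ∈ Icc (φ 0) (φ (T / 4)) := by
  obtain ⟨r, hr, k, e⟩ := h.exists_fold t
  have h4 : (0 : ℝ) ≤ T / 4 := by linarith [h.pos]
  have : φ t = φ r := by
    rcases e with rfl | rfl
    · exact h.add_int_mul r k
    · rw [h.add_int_mul, h.even]
  rw [this]
  exact ⟨h.strictMonoOn.monotoneOn ⟨le_rfl, h4⟩ hr hr.1,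
    h.strictMonoOn.monotoneOn hr ⟨h4, le_rfl⟩ hr.2⟩

theorem deriv_neg' (t : ℝ) : deriv φ (-t) = -deriv φ t := by
  have e : (fun t => φ (-t)) = φ := funext h.even
  have := deriv_comp_neg φ t
  rw [e] at this
  linarith

theorem deriv_add_int_mul (r : ℝ) (k : ℤ) : deriv φ (r + k * (T / 2)) = deriv φ r := by
  have e : (fun t => φ (t + k * (T / 2))) = φ := funext fun t => h.add_int_mul t k
  have := deriv_comp_add_const (f := φ) (k * (T / 2)) r
  rw [e] at this
  exact this.symm

/-- Modulo the symmetries a critical point can only be `0` or `T / 4`, where `φ` takes its extreme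
values; every value strictly in between is regular. -/
theorem deriv_ne_zero {t : ℝ} (h0 : φ 0 < φ t) (h1 : φ t < φ (T / 4)) : deriv φ t ≠ 0 := by
  obtain ⟨r, hr, k, e⟩ := h.exists_fold t
  have hr0 : φ r = φ t := by
    rcases e with rfl | rfl
    · exact (h.add_int_mul r k).symm
    · rw [h.add_int_mul, h.even]
  have hr' : r ∈ Ioo 0 (T / 4) := by
    refine ⟨lt_of_le_of_ne hr.1 ?_, lt_of_le_of_ne hr.2 ?_⟩
    · rintro rfl; linarith
    · rintro rfl; linarith
  have := h.deriv_pos r hr'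
  rcases e with rfl | rfl
  · rw [h.deriv_add_int_mul]; exact this.ne'
  · rw [h.deriv_add_int_mul, h.deriv_neg']; linarith

theorem exists_eq {c : ℝ} (h0 : φ 0 < c) (h1 : c < φ (T / 4)) : ∃ r ∈ Ioo 0 (T / 4), φ r = c := by
  have h4 : (0 : ℝ) ≤ T / 4 := by linarith [h.pos]
  obtain ⟨r, hr, e⟩ := intermediate_value_Ioo h4 h.smooth.continuous.continuousOn ⟨h0, h1⟩
  exact ⟨r, hr, e⟩

theorem abs_mono {s t : ℝ} (hs : |s| ≤ T / 4) (ht : |t| ≤ T / 4) : φ s ≤ φ t ↔ |s| ≤ |t| := by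
  have key : ∀ u, φ |u| = φ u := fun u => by
    rcases abs_choice u with e | e <;> rw [e]
    exact h.even u
  rw [← key s, ← key t]
  exact h.strictMonoOn.le_iff_le ⟨abs_nonneg _, hs⟩ ⟨abs_nonneg _, ht⟩

/-- On this interval `φ` is increasing in `|t|`. The interval is the range of a librating angle, and
its connectedness gives that of the torus; the superlevel version serves the other case. -/
theorem ordConnected_sublevel (c : ℝ) :
    OrdConnected {t | t ∈ Icc (-(T / 4)) (T / 4) ∧ φ t ≤ c} := by
  refine ⟨fun s hs t ht u hu => ⟨⟨hs.1.1.trans hu.1, hu.2.trans ht.1.2⟩, ?_⟩⟩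
  have hu' : |u| ≤ T / 4 := abs_le.2 ⟨hs.1.1.trans hu.1, hu.2.trans ht.1.2⟩
  rcases le_total 0 u with h0 | h0
  · refine le_trans ((h.abs_mono hu' (abs_le.2 ht.1)).2 ?_) ht.2
    rw [abs_of_nonneg h0]
    exact hu.2.trans (le_abs_self t)
  · refine le_trans ((h.abs_mono hu' (abs_le.2 hs.1)).2 ?_) hs.2
    rw [abs_of_nonpos h0]
    exact (neg_le_neg hu.1).trans (neg_le_abs s)

theorem ordConnected_superlevel (c : ℝ) :
    OrdConnected {t | t ∈ Icc 0 (T / 2) ∧ c ≤ φ t} := by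
  have hT := h.pos
  refine ⟨fun s hs t ht u hu => ⟨⟨hs.1.1.trans hu.1, hu.2.trans ht.1.2⟩, ?_⟩⟩
  have hu' : u ∈ Icc 0 (T / 2) := ⟨hs.1.1.trans hu.1, hu.2.trans ht.1.2⟩
  rcases le_total u (T / 4) with h0 | h0
  · refine hs.2.trans (h.strictMonoOn.monotoneOn ⟨hs.1.1, hu.1.trans h0⟩ ⟨hu'.1, h0⟩ hu.1)
  · refine ht.2.trans ?_
    rw [← h.symm t, ← h.symm u]
    refine h.strictMonoOn.monotoneOn ⟨?_, ?_⟩ ⟨?_, ?_⟩ ?_ <;>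
    linarith [hu.2, ht.1.2, hu'.2]

end IsProfile

/-! ### Extreme values of the functions of a table -/

namespace LiouvilleTable

variable (L : LiouvilleTable)

theorem IsClassical.profile₁ {L : LiouvilleTable} (hL : L.IsClassical) : IsProfile L.φ₁ L.ω₁ :=
  ⟨L.ω₁_pos, L.smooth₁, L.even₁, hL.symm₁, hL.deriv₁⟩

theorem IsClassical.profile₂ {L : LiouvilleTable} (hL : L.IsClassical) : IsProfile L.φ₂ L.ω₂ :=
  ⟨L.ω₂_pos, L.smooth₂, L.even₂, L.symm₂, hL.deriv₂⟩

theorem φ₁_zero : L.φ₁ 0 = L.ν₁ := (L.φ₁_eq_min 0).2 ⟨0, by simp⟩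
theorem φ₂_zero : L.φ₂ 0 = 0 := (L.φ₂_eq_min 0).2 ⟨0, by simp⟩
theorem φ₂_quarter : L.φ₂ (L.ω₂ / 4) = L.ν₁ := (L.φ₂_eq_max _).2 ⟨0, by simp⟩

theorem IsClassical.φ₁_quarter {L : LiouvilleTable} (hL : L.IsClassical) :
    L.φ₁ (L.ω₁ / 4) = L.ν₀ := by
  have : IsGreatest (range L.φ₁) (L.φ₁ (L.ω₁ / 4)) := by
    refine ⟨⟨_, rfl⟩, ?_⟩
    rintro _ ⟨t, rfl⟩
    exact (hL.profile₁.mem_Icc t).2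
  exact this.csSup_eq.symm

theorem ν₁_le (t : ℝ) : L.ν₁ ≤ L.φ₁ t := L.min₁.2 ⟨t, rfl⟩
theorem le_ν₁ (t : ℝ) : L.φ₂ t ≤ L.ν₁ := L.max₂.2 ⟨t, rfl⟩

theorem ν₃_neg : L.ν₃ < 0 := by
  have hN := L.N_pos
  have hm : L.N ∈ Icc (-L.N) L.N := ⟨by linarith, le_rfl⟩
  refine lt_of_le_of_ne (L.nonpos₃ _ hm) fun h => ?_
  exact hN.ne' ((L.φ₃_eq_max _ hm).1 h)

/-! ### Formulas for the integrals -/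

theorem ν₁_le_f₁ (a : L.T₁) : L.ν₁ ≤ L.f₁ a := by
  induction a using QuotientAddGroup.induction_on with
  | H t => exact L.ν₁_le t

theorem f₂_le_ν₁ (a : L.T₂) : L.f₂ a ≤ L.ν₁ := by
  induction a using QuotientAddGroup.induction_on with
  | H t => exact L.le_ν₁ t

theorem f₂_nonneg (a : L.T₂) : 0 ≤ L.f₂ a := by
  induction a using QuotientAddGroup.induction_on with
  | H t => exact L.nonneg₂ t

theorem continuous_f₁ : Continuous L.f₁ := L.smooth₁.continuous.quotient_lift _
theorem continuous_f₂ : Continuous L.f₂ := L.smooth₂.continuous.quotient_lift _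

theorem coe₁_eq_iff (s t : ℝ) : (s : L.T₁) = t ↔ ∃ k : ℤ, t = s + k * L.ω₁ := by
  rw [QuotientAddGroup.eq, AddSubgroup.mem_zmultiples_iff]
  constructor <;> rintro ⟨k, hk⟩ <;> refine ⟨k, ?_⟩
  · rw [zsmul_eq_mul] at hk; linarith
  · rw [zsmul_eq_mul]; linarith

theorem coe₂_eq_iff (s t : ℝ) : (s : L.T₂) = t ↔ ∃ k : ℤ, t = s + k * L.ω₂ := by
  rw [QuotientAddGroup.eq, AddSubgroup.mem_zmultiples_iff]
  constructor <;> rintro ⟨k, hk⟩ <;> refine ⟨k, ?_⟩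
  · rw [zsmul_eq_mul] at hk; linarith
  · rw [zsmul_eq_mul]; linarith

/-- The branch points are the points where `φ₁ = φ₂`. -/
theorem branch_iff (a : L.T₁) (b : L.T₂) : (-a = a ∧ L.half₂ - b = b) ↔ L.f₁ a = L.f₂ b := by
  induction a using QuotientAddGroup.induction_on with
  | H s =>
  induction b using QuotientAddGroup.induction_on with
  | H t =>
  have e1 : -((s : ℝ) : L.T₁) = s ↔ L.φ₁ s = L.ν₁ := by
    rw [← AddCircle.coe_neg, coe₁_eq_iff, L.φ₁_eq_min]
    constructor <;> rintro ⟨k, hk⟩ <;> exact ⟨k, by linarith⟩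
  have e2 : L.half₂ - ((t : ℝ) : L.T₂) = t ↔ L.φ₂ t = L.ν₁ := by
    rw [half₂, ← AddCircle.coe_sub, coe₂_eq_iff, L.φ₂_eq_max]
    constructor <;> rintro ⟨k, hk⟩ <;> exact ⟨k, by linarith⟩
  refine (and_congr e1 e2).trans ?_
  change _ ↔ L.φ₁ s = L.φ₂ t
  have h1 := L.ν₁_le s
  have h2 := L.le_ν₁ t
  constructor
  · rintro ⟨h3, h4⟩; rw [h3, h4]
  · intro h; constructor <;> linarith

theorem mk_mem_coball (ξ : L.CotTorus) : (Quotient.mk L.cotSetoid ξ ∈ L.coball) ↔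
    L.f₂ ξ.2.1 < L.f₁ ξ.1 ∧ L.normSqT ξ < 1 := by
  have hlt : ∀ a b, ¬ (-a = a ∧ L.half₂ - b = b) ↔ L.f₂ b < L.f₁ a := fun a b => by
    rw [branch_iff]
    have := L.ν₁_le_f₁ a
    have := L.f₂_le_ν₁ b
    constructor
    · intro h; exact lt_of_le_of_ne (by linarith) (Ne.symm h)
    · intro h; exact h.ne'
  rw [← hlt]
  constructor
  · rintro ⟨η, ⟨h1, h2⟩, he⟩
    rcases Quotient.exact he with rfl | rfl
    · exact ⟨h1, h2⟩
    · refine ⟨?_, by rwa [normSqT_ι]⟩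
      rw [hlt] at h1 ⊢
      simpa [ι, f₁_neg, f₂_half_sub] using h1
  · rintro h
    exact ⟨ξ, h, rfl⟩

theorem f₃_base (ξ : L.CotTorus) : L.f₃ (L.base ξ).2.2 = L.ν₃ := rfl

theorem g₃_base (ξ : L.CotTorus) :
    L.g₃ (L.base ξ) = (L.f₁ ξ.1 - L.ν₃) * (L.f₂ ξ.2.1 - L.ν₃) := rfl

theorem g₃_base_pos (ξ : L.CotTorus) : 0 < L.g₃ (L.base ξ) := by
  rw [g₃_base]
  have h1 := L.ν₁_le_f₁ ξ.1
  have h2 := L.f₂_nonneg ξ.2.1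
  have h3 := L.ν₃_neg
  have h4 := L.ν₁_pos
  exact mul_pos (by linarith) (by linarith)

theorem normSqT_eq (ξ : L.CotTorus) : L.normSqT ξ =
    ξ.2.2.1 ^ 2 / ((L.f₁ ξ.1 - L.f₂ ξ.2.1) * (L.f₁ ξ.1 - L.ν₃))
      + ξ.2.2.2 ^ 2 / ((L.f₁ ξ.1 - L.f₂ ξ.2.1) * (L.f₂ ξ.2.1 - L.ν₃)) := by
  rw [normSqT, H]
  simp [g₁, g₂, base, f₃, ν₃]

theorem p₃T_sq {ξ : L.CotTorus} (h : L.normSqT ξ ≤ 1) :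
    L.p₃T ξ ^ 2 = L.g₃ (L.base ξ) * (1 - L.normSqT ξ) := by
  rw [p₃T, neg_sq, mul_pow, Real.sq_sqrt (L.g₃_base_pos ξ).le, Real.sq_sqrt (by linarith)]

/-- Eliminating `p₃²` by the unit norm condition removes `ν₃` and the square root altogether, so the
integral becomes rational in the momenta and in `φ₁`, `φ₂`. -/
theorem F₁T_eq {ξ : L.CotTorus} (hlt : L.f₂ ξ.2.1 < L.f₁ ξ.1) (h : L.normSqT ξ ≤ 1) :
    L.F₁T ξ = L.f₁ ξ.1 + L.f₂ ξ.2.1 - (ξ.2.2.1 ^ 2 + ξ.2.2.2 ^ 2) / (L.f₁ ξ.1 - L.f₂ ξ.2.1) := by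
  have h1 : L.f₁ ξ.1 - L.f₂ ξ.2.1 ≠ 0 := by linarith
  have h2 : L.f₁ ξ.1 - L.ν₃ ≠ 0 := by linarith [L.ν₃_neg, L.ν₁_pos, L.ν₁_le_f₁ ξ.1]
  have h3 : L.f₂ ξ.2.1 - L.ν₃ ≠ 0 := by linarith [L.ν₃_neg, L.f₂_nonneg ξ.2.1]
  have hg : L.g₃ (L.base ξ) ≠ 0 := (L.g₃_base_pos ξ).ne'
  rw [F₁T, I₁, L.p₃T_sq h, div_mul_eq_mul_div _ (L.g₃ _), mul_left_comm,
    mul_div_cancel_left₀ _ hg, normSqT_eq, f₃_base]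
  simp only [g₁, g₂, f₃_base]
  simp only [base]
  field_simp
  ring

theorem F₂T_eq {ξ : L.CotTorus} (hlt : L.f₂ ξ.2.1 < L.f₁ ξ.1) (h : L.normSqT ξ ≤ 1) :
    L.F₂T ξ = L.f₁ ξ.1 * L.f₂ ξ.2.1
      - (L.f₂ ξ.2.1 * ξ.2.2.1 ^ 2 + L.f₁ ξ.1 * ξ.2.2.2 ^ 2) / (L.f₁ ξ.1 - L.f₂ ξ.2.1) := by
  have h1 : L.f₁ ξ.1 - L.f₂ ξ.2.1 ≠ 0 := by linarith
  have h2 : L.f₁ ξ.1 - L.ν₃ ≠ 0 := by linarith [L.ν₃_neg, L.ν₁_pos, L.ν₁_le_f₁ ξ.1]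
  have h3 : L.f₂ ξ.2.1 - L.ν₃ ≠ 0 := by linarith [L.ν₃_neg, L.f₂_nonneg ξ.2.1]
  have hg : L.g₃ (L.base ξ) ≠ 0 := (L.g₃_base_pos ξ).ne'
  rw [F₂T, I₂, L.p₃T_sq h, div_mul_eq_mul_div _ (L.g₃ _), mul_left_comm,
    mul_div_cancel_left₀ _ hg, normSqT_eq, f₃_base]
  simp only [g₁, g₂, f₃_base]
  simp only [base]
  field_simp
  ring

/-- Separation of variables: the formulas for the integrals are linear in `p₁²`, `p₂²`, and
inverting them gives `p₁² = χ(φ₁)`, `p₂² = -χ(φ₂)` with `χ(t) = t² - 𝓘₁ t + 𝓘₂`. -/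
theorem sq_momenta {ξ : L.CotTorus} (hlt : L.f₂ ξ.2.1 < L.f₁ ξ.1) (h : L.normSqT ξ ≤ 1) :
    ξ.2.2.1 ^ 2 = L.f₁ ξ.1 ^ 2 - L.F₁T ξ * L.f₁ ξ.1 + L.F₂T ξ ∧
    ξ.2.2.2 ^ 2 = -L.f₂ ξ.2.1 ^ 2 + L.F₁T ξ * L.f₂ ξ.2.1 - L.F₂T ξ := by
  have h1 : L.f₁ ξ.1 - L.f₂ ξ.2.1 ≠ 0 := by linarith
  rw [L.F₁T_eq hlt h, L.F₂T_eq hlt h]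
  constructor <;> field_simp <;> ring

/-! ### Level sets in separated form -/

/-- The parameters `(κ₁, κ₂)` of the tori. -/
structure IsParam (κ₁ κ₂ : ℝ) : Prop where
  lo : L.ν₃ < κ₁
  neg : κ₁ < 0
  pos : 0 < κ₂
  hi : κ₂ < L.ν₀
  ne : κ₂ ≠ L.ν₁

/-- The level set of `(𝓘₁, 𝓘₂)` with the roots `κ₁`, `κ₂`. -/
def level (κ₁ κ₂ : ℝ) : Set L.CotΓ :=
  {η | η ∈ L.coball ∧ L.F₁ η = κ₁ + κ₂ ∧ L.F₂ η = κ₁ * κ₂}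

variable {L} {κ₁ κ₂ : ℝ}

/-- The numerator is constant on a level set. This yields the coball condition, and it makes
`⟨π⁺(ξ), n_g⟩ = √(1 - |ξ|²)` a constant times a function of the angles. -/
theorem one_sub_normSqT (ξ : L.CotTorus) (hlt : L.f₂ ξ.2.1 < L.f₁ ξ.1)
    (h1 : ξ.2.2.1 ^ 2 = (L.f₁ ξ.1 - κ₁) * (L.f₁ ξ.1 - κ₂))
    (h2 : ξ.2.2.2 ^ 2 = (L.f₂ ξ.2.1 - κ₁) * (κ₂ - L.f₂ ξ.2.1)) :
    1 - L.normSqT ξ = (κ₁ - L.ν₃) * (κ₂ - L.ν₃) / L.g₃ (L.base ξ) := by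
  have h0 : L.f₁ ξ.1 - L.f₂ ξ.2.1 ≠ 0 := by linarith
  have h3 : L.f₁ ξ.1 - L.ν₃ ≠ 0 := by linarith [L.ν₃_neg, L.ν₁_pos, L.ν₁_le_f₁ ξ.1]
  have h4 : L.f₂ ξ.2.1 - L.ν₃ ≠ 0 := by linarith [L.ν₃_neg, L.f₂_nonneg ξ.2.1]
  rw [normSqT_eq, g₃_base, h1, h2]
  field_simp
  ring

/-- At a branch point both profiles equal `ν₁`; since `κ₂ ≠ ν₁`, one of the two squared momenta
would be negative. Level sets therefore stay away from the branch points by themselves. -/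
theorem IsParam.f_lt (hκ : L.IsParam κ₁ κ₂) (ξ : L.CotTorus)
    (h1 : ξ.2.2.1 ^ 2 = (L.f₁ ξ.1 - κ₁) * (L.f₁ ξ.1 - κ₂))
    (h2 : ξ.2.2.2 ^ 2 = (L.f₂ ξ.2.1 - κ₁) * (κ₂ - L.f₂ ξ.2.1)) : L.f₂ ξ.2.1 < L.f₁ ξ.1 := by
  have ha := L.ν₁_le_f₁ ξ.1
  have hb := L.f₂_le_ν₁ ξ.2.1
  have hb0 := L.f₂_nonneg ξ.2.1
  refine lt_of_le_of_ne (hb.trans ha) fun he => ?_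
  have e1 : L.f₁ ξ.1 = L.ν₁ := by linarith
  have e2 : L.f₂ ξ.2.1 = L.ν₁ := by linarith
  rw [e1] at h1
  rw [e2] at h2
  have hpos : 0 < L.ν₁ - κ₁ := by linarith [L.ν₁_pos, hκ.neg]
  rcases lt_or_gt_of_ne hκ.ne with h | h
  · have : (L.ν₁ - κ₁) * (κ₂ - L.ν₁) < 0 := mul_neg_of_pos_of_neg hpos (by linarith)
    linarith [sq_nonneg ξ.2.2.2]
  · have : (L.ν₁ - κ₁) * (L.ν₁ - κ₂) < 0 := mul_neg_of_pos_of_neg hpos (by linarith)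
    linarith [sq_nonneg ξ.2.2.1]

theorem IsParam.mk_mem_level (hκ : L.IsParam κ₁ κ₂) (ξ : L.CotTorus) :
    Quotient.mk L.cotSetoid ξ ∈ L.level κ₁ κ₂ ↔
      ξ.2.2.1 ^ 2 = (L.f₁ ξ.1 - κ₁) * (L.f₁ ξ.1 - κ₂) ∧
      ξ.2.2.2 ^ 2 = (L.f₂ ξ.2.1 - κ₁) * (κ₂ - L.f₂ ξ.2.1) := by
  constructor
  · rintro ⟨hc, hF1, hF2⟩
    obtain ⟨hlt, hn⟩ := (L.mk_mem_coball ξ).1 hc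
    obtain ⟨h1, h2⟩ := L.sq_momenta hlt hn.le
    change L.F₁T ξ = _ at hF1
    change L.F₂T ξ = _ at hF2
    rw [h1, h2, hF1, hF2]
    constructor <;> ring
  · rintro ⟨h1, h2⟩
    have hlt := hκ.f_lt ξ h1 h2
    have hn : L.normSqT ξ < 1 := by
      have := one_sub_normSqT ξ hlt h1 h2
      have h3 : 0 < (κ₁ - L.ν₃) * (κ₂ - L.ν₃) / L.g₃ (L.base ξ) :=
        div_pos (mul_pos (by linarith [hκ.lo]) (by linarith [hκ.pos, L.ν₃_neg])) (L.g₃_base_pos ξ)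
      linarith
    have h0 : L.f₁ ξ.1 - L.f₂ ξ.2.1 ≠ 0 := by linarith
    refine ⟨(L.mk_mem_coball ξ).2 ⟨hlt, hn⟩, ?_, ?_⟩
    · change L.F₁T ξ = _
      rw [L.F₁T_eq hlt hn.le, h1, h2]
      field_simp
      ring
    · change L.F₂T ξ = _
      rw [L.F₂T_eq hlt hn.le, h1, h2]
      field_simp
      ring

theorem level_subset (hκ : L.IsParam κ₁ κ₂) : L.level κ₁ κ₂ ⊆ L.U₁ ∪ L.U₂ := by
  rintro ξ ⟨h1, h2, h3⟩
  rcases lt_or_gt_of_ne hκ.ne with h | h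
  · exact Or.inl ⟨h1, κ₁, κ₂, h2, h3, hκ.lo, hκ.neg, hκ.pos, h⟩
  · exact Or.inr ⟨h1, κ₁, κ₂, h2, h3, hκ.lo, hκ.neg, h, hκ.hi⟩

end LiouvilleTable

/-! ### Differentials of the integrals and their independence -/

namespace LiouvilleTable

variable (L : LiouvilleTable)

/-- The square of the momentum `p₁` on the level set, as a function of `θ₁`. -/
def Q₁ (κ₁ κ₂ t : ℝ) : ℝ := (L.φ₁ t - κ₁) * (L.φ₁ t - κ₂)

/-- The square of the momentum `p₂` on the level set, as a function of `θ₂`. -/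
def Q₂ (κ₁ κ₂ t : ℝ) : ℝ := (L.φ₂ t - κ₁) * (κ₂ - L.φ₂ t)

theorem contDiff_Q₁ (κ₁ κ₂ : ℝ) : ContDiff ℝ ∞ (L.Q₁ κ₁ κ₂) :=
  (L.smooth₁.sub contDiff_const).mul (L.smooth₁.sub contDiff_const)

theorem contDiff_Q₂ (κ₁ κ₂ : ℝ) : ContDiff ℝ ∞ (L.Q₂ κ₁ κ₂) :=
  (L.smooth₂.sub contDiff_const).mul (contDiff_const.sub L.smooth₂)

theorem continuous_cov : Continuous L.cov := by
  refine continuous_quotient_mk'.comp ?_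
  refine Continuous.prodMk ?_ (Continuous.prodMk ?_ (by fun_prop))
  · exact (AddCircle.continuous_mk' _).comp continuous_fst
  · exact (AddCircle.continuous_mk' _).comp (by fun_prop)

theorem cov_mem_coball (x : E) : L.cov x ∈ L.coball ↔ L.φ₂ x.2.1 < L.φ₁ x.1 ∧
    x.2.2.1 ^ 2 / ((L.φ₁ x.1 - L.φ₂ x.2.1) * (L.φ₁ x.1 - L.ν₃))
      + x.2.2.2 ^ 2 / ((L.φ₁ x.1 - L.φ₂ x.2.1) * (L.φ₂ x.2.1 - L.ν₃)) < 1 := by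
  rw [cov, mk_mem_coball, normSqT_eq]
  rfl

theorem isOpen_cov_preimage_coball : IsOpen (L.cov ⁻¹' L.coball) := by
  rw [isOpen_iff_mem_nhds]
  intro x hx
  obtain ⟨h1, h2⟩ := (L.cov_mem_coball x).1 hx
  have c1 : Continuous fun y : E => L.φ₁ y.1 := L.smooth₁.continuous.comp continuous_fst
  have c2 : Continuous fun y : E => L.φ₂ y.2.1 := L.smooth₂.continuous.comp (by fun_prop)
  have e1 : L.φ₁ x.1 - L.φ₂ x.2.1 ≠ 0 := by linarith
  have e2 : L.φ₁ x.1 - L.ν₃ ≠ 0 := by linarith [L.ν₃_neg, L.ν₁_pos, L.ν₁_le x.1]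
  have e3 : L.φ₂ x.2.1 - L.ν₃ ≠ 0 := by linarith [L.ν₃_neg, L.nonneg₂ x.2.1]
  have c3 : ContinuousAt (fun x : E =>
      x.2.2.1 ^ 2 / ((L.φ₁ x.1 - L.φ₂ x.2.1) * (L.φ₁ x.1 - L.ν₃))
      + x.2.2.2 ^ 2 / ((L.φ₁ x.1 - L.φ₂ x.2.1) * (L.φ₂ x.2.1 - L.ν₃))) x := by
    refine ContinuousAt.add (ContinuousAt.div ?_ ?_ (mul_ne_zero e1 e2))
      (ContinuousAt.div ?_ ?_ (mul_ne_zero e1 e3)) <;>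
    exact Continuous.continuousAt (by fun_prop)
  filter_upwards [(isOpen_lt c2 c1).mem_nhds h1, c3.eventually_lt_const h2] with y hy1 hy2
  exact (L.cov_mem_coball y).2 ⟨hy1, hy2⟩

theorem differentiableAt_F {x : E} (hx : L.cov x ∈ L.coball) :
    DifferentiableAt ℝ (fun y => L.F₁ (L.cov y)) x ∧
    DifferentiableAt ℝ (fun y => L.F₂ (L.cov y)) x := by
  have hnear : ∀ᶠ y in 𝓝 x, L.cov y ∈ L.coball := L.isOpen_cov_preimage_coball.mem_nhds hx
  have e1 : L.φ₁ x.1 - L.φ₂ x.2.1 ≠ 0 := by linarith [((L.cov_mem_coball x).1 hx).1]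
  have d1 : Differentiable ℝ fun y : E => L.φ₁ y.1 :=
    (L.smooth₁.differentiable (by simp)).comp (by fun_prop)
  have d2 : Differentiable ℝ fun y : E => L.φ₂ y.2.1 :=
    (L.smooth₂.differentiable (by simp)).comp (by fun_prop)
  have d3 : DifferentiableAt ℝ (fun y : E => L.φ₁ y.1 - L.φ₂ y.2.1) x := (d1 x).fun_sub (d2 x)
  constructor
  · have e : (fun y => L.F₁ (L.cov y)) =ᶠ[𝓝 x] fun y : E => L.φ₁ y.1 + L.φ₂ y.2.1
        - (y.2.2.1 ^ 2 + y.2.2.2 ^ 2) / (L.φ₁ y.1 - L.φ₂ y.2.1) := by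
      filter_upwards [hnear] with y hy
      obtain ⟨h1, h2⟩ := (L.mk_mem_coball _).1 hy
      exact L.F₁T_eq h1 h2.le
    refine DifferentiableAt.congr_of_eventuallyEq ?_ e
    simp only [div_eq_mul_inv]
    exact ((d1 x).add (d2 x)).sub (DifferentiableAt.mul (by fun_prop) (d3.inv e1))
  · have e : (fun y => L.F₂ (L.cov y)) =ᶠ[𝓝 x] fun y : E => L.φ₁ y.1 * L.φ₂ y.2.1
        - (L.φ₂ y.2.1 * y.2.2.1 ^ 2 + L.φ₁ y.1 * y.2.2.2 ^ 2) / (L.φ₁ y.1 - L.φ₂ y.2.1) := by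
      filter_upwards [hnear] with y hy
      obtain ⟨h1, h2⟩ := (L.mk_mem_coball _).1 hy
      exact L.F₂T_eq h1 h2.le
    refine DifferentiableAt.congr_of_eventuallyEq ?_ e
    simp only [div_eq_mul_inv]
    exact ((d1 x).mul (d2 x)).sub (DifferentiableAt.mul (by fun_prop) (d3.inv e1))

variable {L} {κ₁ κ₂ : ℝ}

theorem IsParam.cov_mem_level (hκ : L.IsParam κ₁ κ₂) (x : E) : L.cov x ∈ L.level κ₁ κ₂ ↔
    x.2.2.1 ^ 2 = L.Q₁ κ₁ κ₂ x.1 ∧ x.2.2.2 ^ 2 = L.Q₂ κ₁ κ₂ x.2.1 :=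
  hκ.mk_mem_level _

theorem hasDerivAt_Q₁ (t : ℝ) :
    deriv (L.Q₁ κ₁ κ₂) t = (2 * L.φ₁ t - (κ₁ + κ₂)) * deriv L.φ₁ t := by
  have h := ((L.smooth₁.differentiable (by simp)) t).hasDerivAt
  exact (((h.sub_const κ₁).mul (h.sub_const κ₂)).congr_deriv (by ring)).deriv

theorem hasDerivAt_Q₂ (t : ℝ) :
    deriv (L.Q₂ κ₁ κ₂) t = (κ₁ + κ₂ - 2 * L.φ₂ t) * deriv L.φ₂ t := by
  have h := ((L.smooth₂.differentiable (by simp)) t).hasDerivAt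
  exact (((h.sub_const κ₁).mul (h.const_sub κ₂)).congr_deriv (by ring)).deriv

/-- The differentials of `𝓘₁`, `𝓘₂` on a level set. -/
theorem dF_eq {x : E} (hx : L.cov x ∈ L.level κ₁ κ₂) (w : E) :
    2 * x.2.2.1 * w.2.2.1 - deriv (L.Q₁ κ₁ κ₂) x.1 * w.1
      = L.dF₂ x w - L.φ₁ x.1 * L.dF₁ x w ∧
    2 * x.2.2.2 * w.2.2.2 - deriv (L.Q₂ κ₁ κ₂) x.2.1 * w.2.1
      = L.φ₂ x.2.1 * L.dF₁ x w - L.dF₂ x w := by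
  have hnear : ∀ᶠ y in 𝓝 x, L.cov y ∈ L.coball := L.isOpen_cov_preimage_coball.mem_nhds hx.1
  obtain ⟨hF1, hF2⟩ := L.differentiableAt_F hx.1
  have h1 := hF1.hasFDerivAt
  have h2 := hF2.hasFDerivAt
  have eF1 : L.F₁ (L.cov x) = κ₁ + κ₂ := hx.2.1
  have a1 : HasFDerivAt (fun y : E => L.φ₁ y.1)
      (deriv L.φ₁ x.1 • ContinuousLinearMap.fst ℝ ℝ (ℝ × ℝ × ℝ)) x :=
    ((L.smooth₁.differentiable (by simp)) x.1).hasDerivAt.comp_hasFDerivAt x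
      (hasFDerivAt_fst (p := x))
  have b2 : HasFDerivAt (fun y : E => y.2.1) ((ContinuousLinearMap.fst ℝ ℝ (ℝ × ℝ)).comp
      (ContinuousLinearMap.snd ℝ ℝ (ℝ × ℝ × ℝ))) x :=
    ((ContinuousLinearMap.fst ℝ ℝ (ℝ × ℝ)).comp
      (ContinuousLinearMap.snd ℝ ℝ (ℝ × ℝ × ℝ))).hasFDerivAt
  have a2 := ((L.smooth₂.differentiable (by simp)) x.2.1).hasDerivAt.comp_hasFDerivAt x b2
  have c1 : HasFDerivAt (fun y : E => y.2.2.1) ((ContinuousLinearMap.fst ℝ ℝ ℝ).comp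
      ((ContinuousLinearMap.snd ℝ ℝ (ℝ × ℝ)).comp (ContinuousLinearMap.snd ℝ ℝ (ℝ × ℝ × ℝ)))) x :=
    ((ContinuousLinearMap.fst ℝ ℝ ℝ).comp
      ((ContinuousLinearMap.snd ℝ ℝ (ℝ × ℝ)).comp
        (ContinuousLinearMap.snd ℝ ℝ (ℝ × ℝ × ℝ)))).hasFDerivAt
  have c2 : HasFDerivAt (fun y : E => y.2.2.2) ((ContinuousLinearMap.snd ℝ ℝ ℝ).comp
      ((ContinuousLinearMap.snd ℝ ℝ (ℝ × ℝ)).comp (ContinuousLinearMap.snd ℝ ℝ (ℝ × ℝ × ℝ)))) x :=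
    ((ContinuousLinearMap.snd ℝ ℝ ℝ).comp
      ((ContinuousLinearMap.snd ℝ ℝ (ℝ × ℝ)).comp
        (ContinuousLinearMap.snd ℝ ℝ (ℝ × ℝ × ℝ)))).hasFDerivAt
  constructor
  -- Differentiating the separated identity, instead of the formulas for the integrals, isolates the
  -- combination of differentials that involves one degree of freedom only.
  · have e : (fun y : E => y.2.2.1 ^ 2) =ᶠ[𝓝 x] fun y : E =>
        L.φ₁ y.1 ^ 2 - L.F₁ (L.cov y) * L.φ₁ y.1 + L.F₂ (L.cov y) := by
      filter_upwards [hnear] with y hy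
      obtain ⟨g1, g2⟩ := (L.mk_mem_coball _).1 hy
      exact (L.sq_momenta g1 g2.le).1
    have hd := (c1.pow 2).unique
      ((((a1.pow 2).sub (h1.mul a1)).add h2).congr_of_eventuallyEq e)
    have := congrArg (fun l => l w) hd
    simp at this
    rw [hasDerivAt_Q₁]
    rw [eF1] at this
    simp only [dF₁, dF₂]
    linear_combination this
  · have e : (fun y : E => y.2.2.2 ^ 2) =ᶠ[𝓝 x] fun y : E =>
        -L.φ₂ y.2.1 ^ 2 + L.F₁ (L.cov y) * L.φ₂ y.2.1 - L.F₂ (L.cov y) := by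
      filter_upwards [hnear] with y hy
      obtain ⟨g1, g2⟩ := (L.mk_mem_coball _).1 hy
      exact (L.sq_momenta g1 g2.le).2
    have hd := (c2.pow 2).unique
      ((((a2.pow 2).neg.add (h1.mul a2)).sub h2).congr_of_eventuallyEq e)
    have := congrArg (fun l => l w) hd
    simp at this
    rw [hasDerivAt_Q₂]
    rw [eF1] at this
    simp only [dF₁, dF₂]
    linear_combination this

/-- At a zero, `φ₁ = κ₂` lies strictly between `ν₁` and `ν₀`, hence is a regular value, and the
other factor of the derivative is `κ₂ - κ₁ ≠ 0`. Thus the curve `p₁² = Q₁` is smooth at its turning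
points. -/
theorem IsParam.deriv_Q₁_ne_zero (hκ : L.IsParam κ₁ κ₂) (hL : L.IsClassical) {t : ℝ}
    (h : L.Q₁ κ₁ κ₂ t = 0) : deriv (L.Q₁ κ₁ κ₂) t ≠ 0 := by
  have h1 : L.φ₁ t - κ₁ ≠ 0 := by linarith [L.ν₁_le t, L.ν₁_pos, hκ.neg]
  have h2 : L.φ₁ t = κ₂ := by linarith [(mul_eq_zero.1 h).resolve_left h1]
  rw [hasDerivAt_Q₁]
  refine mul_ne_zero (by rw [h2] at h1 ⊢; intro h; apply h1; linarith)
    (hL.profile₁.deriv_ne_zero ?_ ?_)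
  · rw [φ₁_zero, h2]
    exact lt_of_le_of_ne (h2 ▸ L.ν₁_le t) hκ.ne.symm
  · rw [hL.φ₁_quarter, h2]; exact hκ.hi

theorem IsParam.deriv_Q₂_ne_zero (hκ : L.IsParam κ₁ κ₂) (hL : L.IsClassical) {t : ℝ}
    (h : L.Q₂ κ₁ κ₂ t = 0) : deriv (L.Q₂ κ₁ κ₂) t ≠ 0 := by
  have h1 : L.φ₂ t - κ₁ ≠ 0 := by linarith [L.nonneg₂ t, hκ.neg]
  have h2 : L.φ₂ t = κ₂ := by linarith [(mul_eq_zero.1 h).resolve_left h1]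
  rw [hasDerivAt_Q₂]
  refine mul_ne_zero (by rw [h2] at h1 ⊢; intro h; apply h1; linarith)
    (hL.profile₂.deriv_ne_zero ?_ ?_)
  · rw [φ₂_zero, h2]; exact hκ.pos
  · rw [φ₂_quarter, h2]
    exact lt_of_le_of_ne (h2 ▸ L.le_ν₁ t) hκ.ne

theorem cov_lt {x : E} (hx : L.cov x ∈ L.level κ₁ κ₂) : L.φ₂ x.2.1 < L.φ₁ x.1 :=
  ((L.cov_mem_coball x).1 hx.1).1

/-- The two integrals are independent on the level sets. -/
theorem IsParam.exists_wedge_ne_zero (hκ : L.IsParam κ₁ κ₂) (hL : L.IsClassical) {x : E}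
    (hx : L.cov x ∈ L.level κ₁ κ₂) : ∃ u v : E, wedge₁ (L.dF₁ x) (L.dF₂ x) u v ≠ 0 := by
  obtain ⟨h1, h2⟩ := (hκ.cov_mem_level x).1 hx
  have hu : ∃ a b : ℝ, 2 * x.2.2.1 * b - deriv (L.Q₁ κ₁ κ₂) x.1 * a ≠ 0 := by
    by_cases hp : x.2.2.1 = 0
    · refine ⟨1, 0, ?_⟩
      have := hκ.deriv_Q₁_ne_zero hL (t := x.1) (by rw [← h1, hp]; norm_num)
      simpa [hp] using this
    · exact ⟨0, 1, by simpa using hp⟩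
  have hv : ∃ a b : ℝ, 2 * x.2.2.2 * b - deriv (L.Q₂ κ₁ κ₂) x.2.1 * a ≠ 0 := by
    by_cases hp : x.2.2.2 = 0
    · refine ⟨1, 0, ?_⟩
      have := hκ.deriv_Q₂_ne_zero hL (t := x.2.1) (by rw [← h2, hp]; norm_num)
      simpa [hp] using this
    · exact ⟨0, 1, by simpa using hp⟩
  obtain ⟨a, b, hab⟩ := hu
  obtain ⟨c, d, hcd⟩ := hv
  -- One vector per degree of freedom, each transversal to its own curve; on them the combinations
  -- in `dF_eq` become diagonal.
  refine ⟨(a, 0, b, 0), (0, c, 0, d), ?_⟩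
  obtain ⟨e1, e2⟩ := dF_eq hx (a, 0, b, 0)
  obtain ⟨e3, e4⟩ := dF_eq hx (0, c, 0, d)
  simp only [mul_zero, sub_zero] at e1 e2 e3 e4
  intro h0
  simp only [wedge₁] at h0
  apply mul_ne_zero hab hcd
  have e3' : L.dF₂ x (0, c, 0, d) = L.φ₁ x.1 * L.dF₁ x (0, c, 0, d) := by linarith
  have e2' : L.dF₂ x (a, 0, b, 0) = L.φ₂ x.2.1 * L.dF₁ x (a, 0, b, 0) := by linarith
  have hlt := cov_lt hx
  rw [e1, e4, e3', e2']
  rw [e3', e2'] at h0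
  have h5 : (L.φ₁ x.1 - L.φ₂ x.2.1) * (L.dF₁ x (a, 0, b, 0) * L.dF₁ x (0, c, 0, d)) = 0 := by
    linear_combination h0
  linear_combination (L.φ₁ x.1 - L.φ₂ x.2.1) * h5

end LiouvilleTable

/-! ### The Leray form -/

namespace LiouvilleTable

variable {L : LiouvilleTable} {κ₁ κ₂ : ℝ}

/-- The wedge product of two linear forms, as an alternating map. -/
def wedgeForm (a b : E →ₗ[ℝ] ℝ) : E [⋀^Fin 2]→ₗ[ℝ] ℝ :=
  (Matrix.detRowAlternating (n := Fin 2) (R := ℝ)).compLinearMap (LinearMap.pi ![a, b])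

theorem wedgeForm_apply (a b : E →ₗ[ℝ] ℝ) (u v : E) :
    wedgeForm a b ![u, v] = a u * b v - a v * b u := by
  have h : wedgeForm a b ![u, v] = Matrix.det !![a u, b u; a v, b v] := by
    rw [wedgeForm, AlternatingMap.compLinearMap_apply]
    change Matrix.det _ = _
    congr 1
    ext i j
    fin_cases i <;> fin_cases j <;> rfl
  rw [h, Matrix.det_fin_two_of]
  ring

/-- The forms `β₁ = 2 p₁ dp₁ - Q₁' dθ₁` and `β₂ = 2 p₂ dp₂ - Q₂' dθ₂` are nowhere zero on the level
set, so each can be completed to `γᵢ ∧ βᵢ = dpᵢ ∧ dθᵢ`. Then `ω ∧ ω = -2 γ₁ ∧ γ₂ ∧ β₁ ∧ β₂`, and by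
`dF_eq` `β₁ ∧ β₂ = (φ₁ - φ₂) d𝓘₁ ∧ d𝓘₂`. -/
theorem IsParam.exists_leray (hκ : L.IsParam κ₁ κ₂) (hL : L.IsClassical) {x : E}
    (hx : L.cov x ∈ L.level κ₁ κ₂) : ∃ α : E [⋀^Fin 2]→ₗ[ℝ] ℝ, ∀ u v w z : E,
    wedge₂ symplectic symplectic u v w z
      = wedge₂ (fun a b => α ![a, b]) (wedge₁ (L.dF₁ x) (L.dF₂ x)) u v w z := by
  obtain ⟨h1, h2⟩ := (hκ.cov_mem_level x).1 hx
  set c₁ := 2 * x.2.2.1 with hc₁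
  set d₁ := -deriv (L.Q₁ κ₁ κ₂) x.1 with hd₁
  set c₂ := 2 * x.2.2.2 with hc₂
  set d₂ := -deriv (L.Q₂ κ₁ κ₂) x.2.1 with hd₂
  have hn₁ : c₁ ^ 2 + d₁ ^ 2 ≠ 0 := by
    intro h0
    have e1 : c₁ = 0 := by nlinarith [sq_nonneg c₁, sq_nonneg d₁]
    have e2 : d₁ = 0 := by nlinarith [sq_nonneg c₁, sq_nonneg d₁]
    have e3 : x.2.2.1 = 0 := by linarith
    exact hκ.deriv_Q₁_ne_zero hL (t := x.1) (by rw [← h1, e3]; norm_num) (by linarith)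
  have hn₂ : c₂ ^ 2 + d₂ ^ 2 ≠ 0 := by
    intro h0
    have e1 : c₂ = 0 := by nlinarith [sq_nonneg c₂, sq_nonneg d₂]
    have e2 : d₂ = 0 := by nlinarith [sq_nonneg c₂, sq_nonneg d₂]
    have e3 : x.2.2.2 = 0 := by linarith
    exact hκ.deriv_Q₂_ne_zero hL (t := x.2.1) (by rw [← h2, e3]; norm_num) (by linarith)
  let θ₁ : E →ₗ[ℝ] ℝ := LinearMap.fst ℝ ℝ (ℝ × ℝ × ℝ)
  let θ₂ : E →ₗ[ℝ] ℝ := (LinearMap.fst ℝ ℝ (ℝ × ℝ)).comp (LinearMap.snd ℝ ℝ (ℝ × ℝ × ℝ))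
  let r₁ : E →ₗ[ℝ] ℝ := (LinearMap.fst ℝ ℝ ℝ).comp
    ((LinearMap.snd ℝ ℝ (ℝ × ℝ)).comp (LinearMap.snd ℝ ℝ (ℝ × ℝ × ℝ)))
  let r₂ : E →ₗ[ℝ] ℝ := (LinearMap.snd ℝ ℝ ℝ).comp
    ((LinearMap.snd ℝ ℝ (ℝ × ℝ)).comp (LinearMap.snd ℝ ℝ (ℝ × ℝ × ℝ)))
  let γ₁ : E →ₗ[ℝ] ℝ := (d₁ / (c₁ ^ 2 + d₁ ^ 2)) • r₁ - (c₁ / (c₁ ^ 2 + d₁ ^ 2)) • θ₁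
  let γ₂ : E →ₗ[ℝ] ℝ := (d₂ / (c₂ ^ 2 + d₂ ^ 2)) • r₂ - (c₂ / (c₂ ^ 2 + d₂ ^ 2)) • θ₂
  have e₁ : ∀ w : E, γ₁ w = (d₁ / (c₁ ^ 2 + d₁ ^ 2)) * w.2.2.1 - (c₁ / (c₁ ^ 2 + d₁ ^ 2)) * w.1 :=
    fun w => rfl
  have e₂ : ∀ w : E, γ₂ w = (d₂ / (c₂ ^ 2 + d₂ ^ 2)) * w.2.2.2
      - (c₂ / (c₂ ^ 2 + d₂ ^ 2)) * w.2.1 := fun w => rfl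
  set D := L.φ₁ x.1 - L.φ₂ x.2.1 with hD
  have hs : ∀ u v : E, symplectic u v =
      (γ₁ u * (L.dF₂ x v - L.φ₁ x.1 * L.dF₁ x v) - γ₁ v * (L.dF₂ x u - L.φ₁ x.1 * L.dF₁ x u))
      + (γ₂ u * (L.φ₂ x.2.1 * L.dF₁ x v - L.dF₂ x v)
        - γ₂ v * (L.φ₂ x.2.1 * L.dF₁ x u - L.dF₂ x u)) := by
    intro u v
    rw [← (dF_eq hx u).1, ← (dF_eq hx u).2, ← (dF_eq hx v).1, ← (dF_eq hx v).2, e₁, e₁, e₂, e₂]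
    rw [symplectic, ← hc₁, ← hc₂]
    rw [show deriv (L.Q₁ κ₁ κ₂) x.1 = -d₁ by rw [hd₁, neg_neg],
      show deriv (L.Q₂ κ₁ κ₂) x.2.1 = -d₂ by rw [hd₂, neg_neg]]
    field_simp
    ring
  refine ⟨(-2 * D) • wedgeForm γ₁ γ₂, fun u v w z => ?_⟩
  simp only [wedge₂, hs, AlternatingMap.smul_apply, wedgeForm_apply, wedge₁, smul_eq_mul, hD]
  ring

theorem IsParam.exists_isLerayForm (hκ : L.IsParam κ₁ κ₂) (hL : L.IsClassical) {Λ : Set L.CotΓ}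
    (hΛ : Λ ⊆ L.level κ₁ κ₂) : ∃ α, L.IsLerayForm Λ α := by
  classical
  refine ⟨fun x => if hx : L.cov x ∈ L.level κ₁ κ₂ then (hκ.exists_leray hL hx).choose else 0,
    fun x hx => ?_⟩
  simp only [dif_pos (hΛ hx)]
  exact (hκ.exists_leray hL (hΛ hx)).choose_spec

theorem kernel_eq_abs {x : E} (hκ : L.IsParam κ₁ κ₂) (hx : L.cov x ∈ L.level κ₁ κ₂) :
    LegendreMoment.kernel κ₁ κ₂ (L.φ₁ x.1) (L.φ₂ x.2.1)
      = (L.φ₁ x.1 - L.φ₂ x.2.1) / (|x.2.2.1| * |x.2.2.2|) := by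
  obtain ⟨h1, h2⟩ := (hκ.cov_mem_level x).1 hx
  rw [LegendreMoment.kernel, ← Real.sqrt_sq_eq_abs, ← Real.sqrt_sq_eq_abs, h1, h2]
  rfl

/-- The defining identity is evaluated on two tangent vectors together with `∂/∂p₁`, `∂/∂p₂`. The
differentials kill the tangent vectors, so a single term of the wedge product survives. -/
theorem IsParam.abs_leray (hκ : L.IsParam κ₁ κ₂) {Λ : Set L.CotΓ}
    (hΛ : Λ ⊆ L.level κ₁ κ₂) {α : E → E [⋀^Fin 2]→ₗ[ℝ] ℝ} (hα : L.IsLerayForm Λ α) {x : E}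
    (hx : L.cov x ∈ Λ) (hp₁ : x.2.2.1 ≠ 0) (hp₂ : x.2.2.2 ≠ 0) {u v : E}
    (hu₁ : L.dF₁ x u = 0) (hu₂ : L.dF₂ x u = 0) (hv₁ : L.dF₁ x v = 0) (hv₂ : L.dF₂ x v = 0) :
    |α x ![u, v]| = LegendreMoment.kernel κ₁ κ₂ (L.φ₁ x.1) (L.φ₂ x.2.1) / 2
      * |u.1 * v.2.1 - u.2.1 * v.1| := by
  have hlt := cov_lt (hΛ hx)
  have h := hα x hx u v (0, 0, 1, 0) (0, 0, 0, 1)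
  obtain ⟨e1, e2⟩ := dF_eq (hΛ hx) (0, 0, 1, 0)
  obtain ⟨e3, e4⟩ := dF_eq (hΛ hx) (0, 0, 0, 1)
  simp only [mul_zero, mul_one, sub_zero] at e1 e2 e3 e4
  simp only [wedge₂, symplectic, wedge₁, hu₁, hu₂, hv₁, hv₂] at h
  set D := L.φ₁ x.1 - L.φ₂ x.2.1 with hD
  have hD0 : 0 < D := by rw [hD]; linarith
  set a := L.dF₁ x (0, 0, 1, 0)
  set b := L.dF₁ x (0, 0, 0, 1)
  set c := L.dF₂ x (0, 0, 1, 0)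
  set d := L.dF₂ x (0, 0, 0, 1)
  have k1 : D * (a * d - b * c) = 4 * (x.2.2.1 * x.2.2.2) := by
    have : (4 : ℝ) * (x.2.2.1 * x.2.2.2) = (2 * x.2.2.1) * (2 * x.2.2.2) := by ring
    rw [this, e1, e4, hD]
    have ec : c = L.φ₂ x.2.1 * a := by linarith
    have ed : d = L.φ₁ x.1 * b := by linarith
    rw [ec, ed]
    ring
  have k2 : α x ![u, v] * (a * d - b * c) = -2 * (u.1 * v.2.1 - u.2.1 * v.1) := by
    linear_combination -h
  have k3 : α x ![u, v] * (x.2.2.1 * x.2.2.2) = -(D / 2 * (u.1 * v.2.1 - u.2.1 * v.1)) := by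
    linear_combination (D / 4) * k2 - (α x ![u, v] / 4) * k1
  have k4 := congrArg abs k3
  rw [abs_mul, abs_neg, abs_mul, abs_mul, abs_of_pos (by linarith : 0 < D / 2)] at k4
  rw [kernel_eq_abs hκ (hΛ hx), ← hD]
  have hp₁' := abs_pos.2 hp₁
  have hp₂' := abs_pos.2 hp₂
  field_simp
  linarith

/-! ### Local parametrizations and null sets -/

section param

variable {Λ : Set L.CotΓ} {V : Set (ℝ × ℝ)} {ψ : ℝ × ℝ → E}

theorem IsLocalParam.hasFDerivAt (hψ : L.IsLocalParam Λ V ψ) {t : ℝ × ℝ} (ht : t ∈ V) :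
    HasFDerivAt ψ (fderiv ℝ ψ t) t :=
  ((hψ.smooth.contDiffAt (hψ.isOpen.mem_nhds ht)).differentiableAt (by simp)).hasFDerivAt

theorem IsLocalParam.dF_eq_zero (hψ : L.IsLocalParam Λ V ψ) (hΛ : Λ ⊆ L.level κ₁ κ₂)
    {t : ℝ × ℝ} (ht : t ∈ V) (e : ℝ × ℝ) :
    L.dF₁ (ψ t) (fderiv ℝ ψ t e) = 0 ∧ L.dF₂ (ψ t) (fderiv ℝ ψ t e) = 0 := by
  obtain ⟨h1, h2⟩ := L.differentiableAt_F (hΛ (hψ.mapsTo ht)).1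
  have hd := hψ.hasFDerivAt ht
  have hV := hψ.isOpen.mem_nhds ht
  constructor
  · have c : HasFDerivAt (fun s => L.F₁ (L.cov (ψ s))) ((L.dF₁ (ψ t)).comp (fderiv ℝ ψ t)) t :=
      h1.hasFDerivAt.comp t hd
    have e' : (fun s => L.F₁ (L.cov (ψ s))) =ᶠ[𝓝 t] fun _ => κ₁ + κ₂ := by
      filter_upwards [hV] with s hs using (hΛ (hψ.mapsTo hs)).2.1
    have := c.unique ((hasFDerivAt_const _ _).congr_of_eventuallyEq e')
    simpa using congrArg (fun l => l e) this
  · have c : HasFDerivAt (fun s => L.F₂ (L.cov (ψ s))) ((L.dF₂ (ψ t)).comp (fderiv ℝ ψ t)) t :=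
      h2.hasFDerivAt.comp t hd
    have e' : (fun s => L.F₂ (L.cov (ψ s))) =ᶠ[𝓝 t] fun _ => κ₁ * κ₂ := by
      filter_upwards [hV] with s hs using (hΛ (hψ.mapsTo hs)).2.2
    have := c.unique ((hasFDerivAt_const _ _).congr_of_eventuallyEq e')
    simpa using congrArg (fun l => l e) this

theorem IsLocalParam.tangent (hψ : L.IsLocalParam Λ V ψ) (hΛ : Λ ⊆ L.level κ₁ κ₂)
    {t : ℝ × ℝ} (ht : t ∈ V) (e : ℝ × ℝ) :
    2 * (ψ t).2.2.1 * (fderiv ℝ ψ t e).2.2.1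
      = deriv (L.Q₁ κ₁ κ₂) (ψ t).1 * (fderiv ℝ ψ t e).1 ∧
    2 * (ψ t).2.2.2 * (fderiv ℝ ψ t e).2.2.2
      = deriv (L.Q₂ κ₁ κ₂) (ψ t).2.1 * (fderiv ℝ ψ t e).2.1 := by
  obtain ⟨h1, h2⟩ := hψ.dF_eq_zero hΛ ht e
  obtain ⟨h3, h4⟩ := dF_eq (hΛ (hψ.mapsTo ht)) (fderiv ℝ ψ t e)
  rw [h1, h2] at h3 h4
  constructor <;> linarith

/-- Two linear forms which together are injective on the plane are non-zero. -/
theorem ne_zero_of_injective_pair {f g : ℝ × ℝ →ₗ[ℝ] ℝ} (h : ∀ e, f e = 0 → g e = 0 → e = 0) :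
    (∃ e, f e ≠ 0) ∧ ∃ e, g e ≠ 0 := by
  have key : ∀ {f g : ℝ × ℝ →ₗ[ℝ] ℝ}, (∀ e, f e = 0 → g e = 0 → e = 0) → ∃ e, f e ≠ 0 := by
    intro f g h
    by_contra! hf
    have hinj : Function.Injective g := by
      rw [← LinearMap.ker_eq_bot, LinearMap.ker_eq_bot']
      exact fun e he => h e (hf e) he
    have := LinearMap.finrank_le_finrank_of_injective hinj
    simp at this
  exact ⟨key h, key fun e h1 h2 => h e h2 h1⟩

/-- A coordinate on the first factor of the torus, and one on the second. -/
theorem IsLocalParam.coord_ne_zero (hκ : L.IsParam κ₁ κ₂) (hL : L.IsClassical)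
    (hψ : L.IsLocalParam Λ V ψ) (hΛ : Λ ⊆ L.level κ₁ κ₂) {t : ℝ × ℝ} (ht : t ∈ V) :
    ((ψ t).2.2.1 ≠ 0 → ∃ e, (fderiv ℝ ψ t e).1 ≠ 0) ∧
    ((ψ t).2.2.1 = 0 → ∃ e, (fderiv ℝ ψ t e).2.2.1 ≠ 0) ∧
    ((ψ t).2.2.2 ≠ 0 → ∃ e, (fderiv ℝ ψ t e).2.1 ≠ 0) ∧
    ((ψ t).2.2.2 = 0 → ∃ e, (fderiv ℝ ψ t e).2.2.2 ≠ 0) := by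
  obtain ⟨hl1, hl2⟩ := (hκ.cov_mem_level (ψ t)).1 (hΛ (hψ.mapsTo ht))
  set A : ℝ × ℝ →ₗ[ℝ] E := (fderiv ℝ ψ t).toLinearMap with hA
  have hAe : ∀ e, fderiv ℝ ψ t e = A e := fun e => rfl
  have hinj : ∀ e, A e = 0 → e = 0 := fun e he => by
    apply hψ.immersion t ht; rw [hAe, he, map_zero]
  have htan := fun e => hψ.tangent hΛ ht e
  simp only [hAe] at htan ⊢
  let θ₁ : E →ₗ[ℝ] ℝ := LinearMap.fst ℝ ℝ (ℝ × ℝ × ℝ)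
  let θ₂ : E →ₗ[ℝ] ℝ := (LinearMap.fst ℝ ℝ (ℝ × ℝ)).comp (LinearMap.snd ℝ ℝ (ℝ × ℝ × ℝ))
  let r₁ : E →ₗ[ℝ] ℝ := (LinearMap.fst ℝ ℝ ℝ).comp
    ((LinearMap.snd ℝ ℝ (ℝ × ℝ)).comp (LinearMap.snd ℝ ℝ (ℝ × ℝ × ℝ)))
  let r₂ : E →ₗ[ℝ] ℝ := (LinearMap.snd ℝ ℝ ℝ).comp
    ((LinearMap.snd ℝ ℝ (ℝ × ℝ)).comp (LinearMap.snd ℝ ℝ (ℝ × ℝ × ℝ)))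
  -- By the tangency relation `2 p dp = Q' dθ`, the angle is a coordinate on the curve where `p ≠
  -- 0`, and the momentum is one where `p = 0`, as `Q' ≠ 0` there.
  have a1 : (ψ t).2.2.1 ≠ 0 → ∀ e, (A e).1 = 0 → (A e).2.2.1 = 0 := by
    intro hp e he
    have := (htan e).1
    rw [he, mul_zero] at this
    exact (mul_eq_zero.1 this).resolve_left (by simpa using hp)
  have a2 : (ψ t).2.2.1 = 0 → ∀ e, (A e).1 = 0 := by
    intro hp e
    have := (htan e).1
    rw [hp, mul_zero, zero_mul] at this
    exact (mul_eq_zero.1 this.symm).resolve_left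
      (hκ.deriv_Q₁_ne_zero hL (by rw [← hl1, hp]; norm_num))
  have b1 : (ψ t).2.2.2 ≠ 0 → ∀ e, (A e).2.1 = 0 → (A e).2.2.2 = 0 := by
    intro hp e he
    have := (htan e).2
    rw [he, mul_zero] at this
    exact (mul_eq_zero.1 this).resolve_left (by simpa using hp)
  have b2 : (ψ t).2.2.2 = 0 → ∀ e, (A e).2.1 = 0 := by
    intro hp e
    have := (htan e).2
    rw [hp, mul_zero, zero_mul] at this
    exact (mul_eq_zero.1 this.symm).resolve_left
      (hκ.deriv_Q₂_ne_zero hL (by rw [← hl2, hp]; norm_num))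
  have hzero : ∀ e, (A e).1 = 0 → (A e).2.1 = 0 → (A e).2.2.1 = 0 → (A e).2.2.2 = 0 → e = 0 :=
    fun e h1 h2 h3 h4 => hinj e (Prod.ext h1 (Prod.ext h2 (Prod.ext h3 h4)))
  have C : ∀ (f g : E →ₗ[ℝ] ℝ), (∀ e, f (A e) = 0 → (A e).1 = 0 ∧ (A e).2.2.1 = 0) →
      (∀ e, g (A e) = 0 → (A e).2.1 = 0 ∧ (A e).2.2.2 = 0) →
      (∃ e, f (A e) ≠ 0) ∧ ∃ e, g (A e) ≠ 0 := by
    intro f g hf hg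
    exact ne_zero_of_injective_pair (f := f.comp A) (g := g.comp A) fun e h1 h2 =>
      hzero e (hf e h1).1 (hg e h2).1 (hf e h1).2 (hg e h2).2
  have f1 : (ψ t).2.2.1 ≠ 0 → ∀ e, θ₁ (A e) = 0 → (A e).1 = 0 ∧ (A e).2.2.1 = 0 :=
    fun hp e he => ⟨he, a1 hp e he⟩
  have f2 : (ψ t).2.2.1 = 0 → ∀ e, r₁ (A e) = 0 → (A e).1 = 0 ∧ (A e).2.2.1 = 0 :=
    fun hp e he => ⟨a2 hp e, he⟩
  have g1 : (ψ t).2.2.2 ≠ 0 → ∀ e, θ₂ (A e) = 0 → (A e).2.1 = 0 ∧ (A e).2.2.2 = 0 :=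
    fun hp e he => ⟨he, b1 hp e he⟩
  have g2 : (ψ t).2.2.2 = 0 → ∀ e, r₂ (A e) = 0 → (A e).2.1 = 0 ∧ (A e).2.2.2 = 0 :=
    fun hp e he => ⟨b2 hp e, he⟩
  refine ⟨fun hp => ?_, fun hp => ?_, fun hp => ?_, fun hp => ?_⟩
  · by_cases hp' : (ψ t).2.2.2 = 0
    · exact (C θ₁ r₂ (f1 hp) (g2 hp')).1
    · exact (C θ₁ θ₂ (f1 hp) (g1 hp')).1
  · by_cases hp' : (ψ t).2.2.2 = 0
    · exact (C r₁ r₂ (f2 hp) (g2 hp')).1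
    · exact (C r₁ θ₂ (f2 hp) (g1 hp')).1
  · by_cases hp' : (ψ t).2.2.1 = 0
    · exact (C r₁ θ₂ (f2 hp') (g1 hp)).2
    · exact (C θ₁ θ₂ (f1 hp') (g1 hp)).2
  · by_cases hp' : (ψ t).2.2.1 = 0
    · exact (C r₁ r₂ (f2 hp') (g2 hp)).2
    · exact (C θ₁ r₂ (f1 hp') (g2 hp)).2

/-- A level set of a function without critical points on it is a null set. -/
theorem volume_level_eq_zero {h : ℝ × ℝ → ℝ} {S : Set (ℝ × ℝ)} {c : ℝ} (hS : MeasurableSet S)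
    (hc : ∀ t ∈ S, h t = c) (hd : ∀ t ∈ S, ∃ h' : ℝ × ℝ →L[ℝ] ℝ, HasFDerivAt h h' t ∧ ∃ e, h' e ≠ 0) :
    volume S = 0 := by
  classical
  choose! h' hh' e he using hd
  -- Since `h` is constant on `S`, it is approximated there by the zero map with error `0`, so its
  -- derivative vanishes at almost every point of `S`. The extra zero component only makes it a
  -- self-map of the plane.
  have happ : ApproximatesLinearOn (fun t => (h t, (0 : ℝ))) (0 : ℝ × ℝ →L[ℝ] ℝ × ℝ) S 0 := by
    intro s hs t ht
    simp [hc s hs, hc t ht]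
  have hder : ∀ t ∈ S, HasFDerivWithinAt (fun t => (h t, (0 : ℝ)))
      ((h' t).prod (0 : ℝ × ℝ →L[ℝ] ℝ)) S t := fun t ht =>
    ((hh' t ht).prodMk (hasFDerivAt_const (0 : ℝ) t)).hasFDerivWithinAt
  have hae := happ.norm_fderiv_sub_le volume hS _ hder
  rw [ae_restrict_iff' hS] at hae
  have hnot : ∀ᵐ t : ℝ × ℝ, t ∉ S := by
    filter_upwards [hae] with t ht hts
    have h0 : ‖(h' t).prod (0 : ℝ × ℝ →L[ℝ] ℝ) - 0‖₊ = 0 := le_antisymm (ht hts) bot_le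
    rw [sub_zero, nnnorm_eq_zero] at h0
    have := congrArg (fun l => (l (e t)).1) h0
    exact he t hts (by simpa using this)
  rw [ae_iff] at hnot
  simpa using hnot

end param

end LiouvilleTable

/-! ### Angle charts and the Leray measure -/

namespace LiouvilleTable

variable (L : LiouvilleTable)

/-- The affine maps of the covering space of the cotangent bundle of the torus. -/
def deck (σ a b : ℝ) (x : E) : E := (σ * x.1 + a, σ * x.2.1 + b, σ * x.2.2.1, σ * x.2.2.2)

/-- The affine map `deck σ a b` is a deck transformation of `cov`. -/
structure IsDeck (σ a b : ℝ) : Prop where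
  sign : σ = 1 ∨ σ = -1
  cov_eq : ∀ x, L.cov (deck σ a b x) = L.cov x
  φ₁_eq : ∀ t, L.φ₁ (σ * t + a) = L.φ₁ t
  φ₂_eq : ∀ t, L.φ₂ (σ * t + b) = L.φ₂ t

/-- The lift of the angles `v` to the level set, with the signs `s₁`, `s₂` of the momenta. -/
noncomputable def graph (κ₁ κ₂ : ℝ) (s₁ s₂ : ℝ → ℝ) (v : ℝ × ℝ) : E :=
  (v.1, v.2, s₁ v.1 * √(L.Q₁ κ₁ κ₂ v.1), s₂ v.2 * √(L.Q₂ κ₁ κ₂ v.2))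

/-- A parametrization of the torus `Λ` by angles which covers `Λ` up to a null set. -/
structure TorusChart (κ₁ κ₂ : ℝ) (Λ : Set L.CotΓ) where
  I₁ : Set ℝ
  I₂ : Set ℝ
  s₁ : ℝ → ℝ
  s₂ : ℝ → ℝ
  -- The seams of the angle intervals, which the open domain of the chart may miss.
  exc₁ : Set ℝ
  exc₂ : Set ℝ
  subset_level : Λ ⊆ L.level κ₁ κ₂
  isOpen₁ : IsOpen I₁
  isOpen₂ : IsOpen I₂
  sign₁ : ∀ t ∈ I₁, s₁ t = 1 ∨ s₁ t = -1
  sign₂ : ∀ t ∈ I₂, s₂ t = 1 ∨ s₂ t = -1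
  const₁ : ∀ t ∈ I₁, ∀ᶠ r in 𝓝 t, s₁ r = s₁ t
  const₂ : ∀ t ∈ I₂, ∀ᶠ r in 𝓝 t, s₂ r = s₂ t
  pos₁ : ∀ t ∈ I₁, 0 < L.Q₁ κ₁ κ₂ t
  pos₂ : ∀ t ∈ I₂, 0 < L.Q₂ κ₁ κ₂ t
  mapsTo : MapsTo (fun v => L.cov (L.graph κ₁ κ₂ s₁ s₂ v)) (I₁ ×ˢ I₂) Λ
  injOn : InjOn (fun v => L.cov (L.graph κ₁ κ₂ s₁ s₂ v)) (I₁ ×ˢ I₂)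
  countable₁ : exc₁.Countable
  countable₂ : exc₂.Countable
  cover : ∀ x, L.cov x ∈ Λ → x.2.2.1 ≠ 0 → x.2.2.2 ≠ 0 → x.1 ∉ exc₁ → x.2.1 ∉ exc₂ →
    ∃ σ a b, L.IsDeck σ a b ∧ (σ * x.1 + a, σ * x.2.1 + b) ∈ I₁ ×ˢ I₂ ∧
      deck σ a b x = L.graph κ₁ κ₂ s₁ s₂ (σ * x.1 + a, σ * x.2.1 + b)

theorem measurable_cov : Measurable L.cov := by
  refine (measurable_quotient_mk'' (s := L.cotSetoid)).comp ?_
  have h1 : Measurable fun t : ℝ => (t : L.T₁) := (AddCircle.continuous_mk' _).measurable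
  have h2 : Measurable fun t : ℝ => (t : L.T₂) := (AddCircle.continuous_mk' _).measurable
  exact (h1.comp measurable_fst).prodMk ((h2.comp (by fun_prop)).prodMk (by fun_prop))

variable {L} {κ₁ κ₂ : ℝ} {Λ : Set L.CotΓ}

theorem det_eq (A : ℝ × ℝ →L[ℝ] ℝ × ℝ) :
    A.det = (A (1, 0)).1 * (A (0, 1)).2 - (A (1, 0)).2 * (A (0, 1)).1 := by
  rw [ContinuousLinearMap.det, ← LinearMap.det_toMatrix (Module.Basis.finTwoProd ℝ),
    Matrix.det_fin_two]
  simp [LinearMap.toMatrix_apply]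
  ring

namespace TorusChart

variable (c : L.TorusChart κ₁ κ₂ Λ)

/-- The parametrization of a chart. -/
noncomputable def ψ : ℝ × ℝ → E := L.graph κ₁ κ₂ c.s₁ c.s₂

/-- The domain of a chart. -/
def V : Set (ℝ × ℝ) := c.I₁ ×ˢ c.I₂

theorem isOpen_V : IsOpen c.V := c.isOpen₁.prod c.isOpen₂

theorem contDiffAt_ψ {v : ℝ × ℝ} (hv : v ∈ c.V) : ContDiffAt ℝ ∞ c.ψ v := by
  have h1 : ContDiffAt ℝ ∞ (fun w : ℝ × ℝ => c.s₁ w.1 * √(L.Q₁ κ₁ κ₂ w.1)) v := by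
    have : ContDiffAt ℝ ∞ (fun w : ℝ × ℝ => c.s₁ v.1 * √(L.Q₁ κ₁ κ₂ w.1)) v :=
      contDiffAt_const.mul (((L.contDiff_Q₁ κ₁ κ₂).contDiffAt.comp v contDiffAt_fst).sqrt
        (c.pos₁ _ hv.1).ne')
    refine this.congr_of_eventuallyEq ?_
    filter_upwards [(continuous_fst.tendsto v).eventually (c.const₁ _ hv.1)] with w hw
    rw [hw]
  have h2 : ContDiffAt ℝ ∞ (fun w : ℝ × ℝ => c.s₂ w.2 * √(L.Q₂ κ₁ κ₂ w.2)) v := by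
    have : ContDiffAt ℝ ∞ (fun w : ℝ × ℝ => c.s₂ v.2 * √(L.Q₂ κ₁ κ₂ w.2)) v :=
      contDiffAt_const.mul (((L.contDiff_Q₂ κ₁ κ₂).contDiffAt.comp v contDiffAt_snd).sqrt
        (c.pos₂ _ hv.2).ne')
    refine this.congr_of_eventuallyEq ?_
    filter_upwards [(continuous_snd.tendsto v).eventually (c.const₂ _ hv.2)] with w hw
    rw [hw]
  exact contDiffAt_fst.prodMk (contDiffAt_snd.prodMk (h1.prodMk h2))

theorem fderiv_ψ {v : ℝ × ℝ} (hv : v ∈ c.V) (e : ℝ × ℝ) :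
    (fderiv ℝ c.ψ v e).1 = e.1 ∧ (fderiv ℝ c.ψ v e).2.1 = e.2 := by
  have hd := ((c.contDiffAt_ψ hv).differentiableAt (by simp)).hasFDerivAt
  constructor
  · have h1 : HasFDerivAt (fun w => (c.ψ w).1) ((ContinuousLinearMap.fst ℝ ℝ (ℝ × ℝ × ℝ)).comp
        (fderiv ℝ c.ψ v)) v := (ContinuousLinearMap.fst ℝ ℝ (ℝ × ℝ × ℝ)).hasFDerivAt.comp v hd
    have h2 : HasFDerivAt (fun w => (c.ψ w).1) (ContinuousLinearMap.fst ℝ ℝ ℝ) v :=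
      (ContinuousLinearMap.fst ℝ ℝ ℝ).hasFDerivAt
    exact congrArg (fun l => l e) (h1.unique h2)
  · have h1 : HasFDerivAt (fun w => (c.ψ w).2.1) (((ContinuousLinearMap.fst ℝ ℝ (ℝ × ℝ)).comp
        (ContinuousLinearMap.snd ℝ ℝ (ℝ × ℝ × ℝ))).comp (fderiv ℝ c.ψ v)) v :=
      ((ContinuousLinearMap.fst ℝ ℝ (ℝ × ℝ)).comp
        (ContinuousLinearMap.snd ℝ ℝ (ℝ × ℝ × ℝ))).hasFDerivAt.comp v hd
    have h2 : HasFDerivAt (fun w => (c.ψ w).2.1) (ContinuousLinearMap.snd ℝ ℝ ℝ) v :=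
      (ContinuousLinearMap.snd ℝ ℝ ℝ).hasFDerivAt
    exact congrArg (fun l => l e) (h1.unique h2)

theorem isLocalParam : L.IsLocalParam Λ c.V c.ψ where
  isOpen := c.isOpen_V
  smooth := fun _ hv => (c.contDiffAt_ψ hv).contDiffWithinAt
  immersion := by
    intro v hv
    rw [injective_iff_map_eq_zero]
    intro e he
    obtain ⟨h1, h2⟩ := c.fderiv_ψ hv e
    rw [he] at h1 h2
    exact Prod.ext h1.symm h2.symm
  injOn := c.injOn
  mapsTo := c.mapsTo

theorem mom_ne_zero {v : ℝ × ℝ} (hv : v ∈ c.V) : (c.ψ v).2.2.1 ≠ 0 ∧ (c.ψ v).2.2.2 ≠ 0 := by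
  constructor
  · refine mul_ne_zero ?_ (Real.sqrt_pos.2 (c.pos₁ _ hv.1)).ne'
    rcases c.sign₁ _ hv.1 with h | h <;> rw [h] <;> norm_num
  · refine mul_ne_zero ?_ (Real.sqrt_pos.2 (c.pos₂ _ hv.2)).ne'
    rcases c.sign₂ _ hv.2 with h | h <;> rw [h] <;> norm_num

/-- The density of the Leray form in the angles. -/
noncomputable def density (L : LiouvilleTable) (κ₁ κ₂ : ℝ) (v : ℝ × ℝ) : ℝ :=
  LegendreMoment.kernel κ₁ κ₂ (L.φ₁ v.1) (L.φ₂ v.2) / 2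

theorem measurable_density : Measurable (density L κ₁ κ₂) := by
  have h1 : Measurable L.φ₁ := L.smooth₁.continuous.measurable
  have h2 : Measurable L.φ₂ := L.smooth₂.continuous.measurable
  unfold density LegendreMoment.kernel
  fun_prop

theorem density_nonneg (v : ℝ × ℝ) : 0 ≤ density L κ₁ κ₂ v :=
  div_nonneg (LegendreMoment.kernel_nonneg ((L.le_ν₁ _).trans (L.ν₁_le _))) zero_le_two

/-- The measure which the chart induces on `Λ`. -/
noncomputable def measure : Measure L.CotΓ :=
  Measure.map (fun v => L.cov (c.ψ v))
    ((volume.restrict c.V).withDensity fun v => ENNReal.ofReal (density L κ₁ κ₂ v))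

theorem measure_le (hκ : L.IsParam κ₁ κ₂) (hL : L.IsClassical) :
    c.measure ≤ L.lerayMeasure Λ := by
  refine le_sSup ?_
  obtain ⟨α, hα⟩ := hκ.exists_isLerayForm hL c.subset_level
  refine ⟨α, c.V, c.ψ, hα, c.isLocalParam, ?_⟩
  rw [measure]
  congr 1
  refine withDensity_congr_ae ?_
  rw [Filter.EventuallyEq, ae_restrict_iff' c.isOpen_V.measurableSet]
  refine .of_forall fun v hv => ?_
  obtain ⟨h1, h2⟩ := c.isLocalParam.dF_eq_zero c.subset_level hv (1, 0)
  obtain ⟨h3, h4⟩ := c.isLocalParam.dF_eq_zero c.subset_level hv (0, 1)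
  have hm : L.cov (c.ψ v) ∈ Λ := c.mapsTo hv
  rw [hκ.abs_leray c.subset_level hα hm (c.mom_ne_zero hv).1 (c.mom_ne_zero hv).2
    h1 h2 h3 h4, (c.fderiv_ψ hv _).1, (c.fderiv_ψ hv _).2, (c.fderiv_ψ hv _).1,
    (c.fderiv_ψ hv _).2]
  simp only [density]
  congr 1
  norm_num
  rfl

open Classical in
/-- The angles of a point of `Λ` in the domain of the chart. -/
noncomputable def angles (ξ : L.CotΓ) : ℝ × ℝ :=
  if h : ∃ v ∈ c.V, L.cov (c.ψ v) = ξ then h.choose else 0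

theorem angles_eq {ξ : L.CotΓ} {v : ℝ × ℝ} (hv : v ∈ c.V) (h : L.cov (c.ψ v) = ξ) :
    c.angles ξ = v := by
  have hex : ∃ v ∈ c.V, L.cov (c.ψ v) = ξ := ⟨v, hv, h⟩
  rw [angles, dif_pos hex]
  exact c.injOn hex.choose_spec.1 hv (hex.choose_spec.2.trans h.symm)

/-- The points outside the exceptional null set. -/
def generic : Set E := {x | x.2.2.1 ≠ 0 ∧ x.2.2.2 ≠ 0 ∧ x.1 ∉ c.exc₁ ∧ x.2.1 ∉ c.exc₂}

theorem measurableSet_generic : MeasurableSet c.generic := by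
  have h1 : MeasurableSet {x : E | x.2.2.1 = 0} :=
    measurableSet_eq_fun (by fun_prop) measurable_const
  have h2 : MeasurableSet {x : E | x.2.2.2 = 0} :=
    measurableSet_eq_fun (by fun_prop) measurable_const
  have h3 : MeasurableSet {x : E | x.1 ∈ c.exc₁} :=
    c.countable₁.measurableSet.preimage measurable_fst
  have h4 : MeasurableSet {x : E | x.2.1 ∈ c.exc₂} :=
    c.countable₂.measurableSet.preimage (f := fun x : E => x.2.1) (by fun_prop)
  exact h1.compl.inter (h2.compl.inter (h3.compl.inter h4.compl))

variable {V : Set (ℝ × ℝ)} {ψ : ℝ × ℝ → E}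

/-- Near a generic point the passage from any parametrization to the angles of the chart is a single
deck transformation followed by projection to the angles. The density is invariant under it, and its
sign drops out of the Jacobian as `σ² = 1`. -/
theorem exists_fderiv_angles (hκ : L.IsParam κ₁ κ₂) (hψ : L.IsLocalParam Λ V ψ) {t : ℝ × ℝ}
    (ht : t ∈ V) (hg : ψ t ∈ c.generic) :
    c.angles (L.cov (ψ t)) ∈ c.V ∧ L.cov (c.ψ (c.angles (L.cov (ψ t)))) = L.cov (ψ t) ∧
    density L κ₁ κ₂ (c.angles (L.cov (ψ t))) = density L κ₁ κ₂ ((ψ t).1, (ψ t).2.1) ∧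
    ∃ T' : ℝ × ℝ →L[ℝ] ℝ × ℝ, HasFDerivAt (fun s => c.angles (L.cov (ψ s))) T' t ∧
      T'.det = (fderiv ℝ ψ t (1, 0)).1 * (fderiv ℝ ψ t (0, 1)).2.1
        - (fderiv ℝ ψ t (1, 0)).2.1 * (fderiv ℝ ψ t (0, 1)).1 := by
  obtain ⟨σ, a, b, hd, hv, he⟩ := c.cover (ψ t) (hψ.mapsTo ht) hg.1 hg.2.1 hg.2.2.1 hg.2.2.2
  have hσ : σ * σ = 1 := by rcases hd.sign with h | h <;> rw [h] <;> norm_num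
  set T : ℝ × ℝ → ℝ × ℝ := fun s => (σ * (ψ s).1 + a, σ * (ψ s).2.1 + b) with hT
  have hTt : T t ∈ c.V := hv
  have hcov : L.cov (c.ψ (T t)) = L.cov (ψ t) := by
    rw [← hd.cov_eq (ψ t), he]; rfl
  have hang : c.angles (L.cov (ψ t)) = T t := c.angles_eq hTt hcov
  have hfd := hψ.hasFDerivAt ht
  have hd1 : HasFDerivAt (fun s => (ψ s).1)
      ((ContinuousLinearMap.fst ℝ ℝ (ℝ × ℝ × ℝ)).comp (fderiv ℝ ψ t)) t :=
    (ContinuousLinearMap.fst ℝ ℝ (ℝ × ℝ × ℝ)).hasFDerivAt.comp t hfd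
  have hd2 : HasFDerivAt (fun s => (ψ s).2.1) (((ContinuousLinearMap.fst ℝ ℝ (ℝ × ℝ)).comp
      (ContinuousLinearMap.snd ℝ ℝ (ℝ × ℝ × ℝ))).comp (fderiv ℝ ψ t)) t :=
    ((ContinuousLinearMap.fst ℝ ℝ (ℝ × ℝ)).comp
      (ContinuousLinearMap.snd ℝ ℝ (ℝ × ℝ × ℝ))).hasFDerivAt.comp t hfd
  have hTd := ((hd1.const_mul σ).add_const a).prodMk ((hd2.const_mul σ).add_const b)
  have hψc : ContinuousAt ψ t := hfd.continuousAt
  have hTc : ContinuousAt T t := hTd.continuousAt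
  have hp1 : (deck σ a b (ψ t)).2.2.1 = c.s₁ (T t).1 * √(L.Q₁ κ₁ κ₂ (T t).1) := by rw [he]; rfl
  have hp2 : (deck σ a b (ψ t)).2.2.2 = c.s₂ (T t).2 * √(L.Q₂ κ₁ κ₂ (T t).2) := by rw [he]; rfl
  have hs1 : c.s₁ (T t).1 * c.s₁ (T t).1 = 1 := by
    rcases c.sign₁ _ hv.1 with h | h <;> rw [h] <;> norm_num
  have hs2 : c.s₂ (T t).2 * c.s₂ (T t).2 = 1 := by
    rcases c.sign₂ _ hv.2 with h | h <;> rw [h] <;> norm_num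
  have hpos1 : 0 < c.s₁ (T t).1 * (σ * (ψ t).2.2.1) := by
    change σ * (ψ t).2.2.1 = _ at hp1
    rw [hp1, ← mul_assoc, hs1, one_mul]
    exact Real.sqrt_pos.2 (c.pos₁ _ hv.1)
  have hpos2 : 0 < c.s₂ (T t).2 * (σ * (ψ t).2.2.2) := by
    change σ * (ψ t).2.2.2 = _ at hp2
    rw [hp2, ← mul_assoc, hs2, one_mul]
    exact Real.sqrt_pos.2 (c.pos₂ _ hv.2)
  have cp1 : ContinuousAt (fun s => c.s₁ (T t).1 * (σ * (ψ s).2.2.1)) t :=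
    continuousAt_const.mul (continuousAt_const.mul (hψc.snd.snd.fst))
  have cp2 : ContinuousAt (fun s => c.s₂ (T t).2 * (σ * (ψ s).2.2.2)) t :=
    continuousAt_const.mul (continuousAt_const.mul (hψc.snd.snd.snd))
  -- The deck transformation found at `t` works nearby: the angles stay in the open domain, the
  -- signs of the momenta persist by continuity, and the level set fixes their absolute values.
  have hloc : (fun s => c.angles (L.cov (ψ s))) =ᶠ[𝓝 t] T := by
    filter_upwards [hψ.isOpen.mem_nhds ht, hTc.preimage_mem_nhds (c.isOpen_V.mem_nhds hTt),
      cp1.eventually_const_lt hpos1, cp2.eventually_const_lt hpos2,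
      (hTc.fst.tendsto).eventually (c.const₁ _ hv.1),
      (hTc.snd.tendsto).eventually (c.const₂ _ hv.2)] with s hsV hsT h1 h2 h3 h4
    refine c.angles_eq hsT ?_
    have hlev := c.subset_level (hψ.mapsTo hsV)
    simp only at hlev
    rw [← hd.cov_eq (ψ s)] at hlev
    obtain ⟨e1, e2⟩ := (hκ.cov_mem_level _).1 hlev
    rw [← hd.cov_eq (ψ s)]
    congr 1
    have key : ∀ {s p q : ℝ}, s * s = 1 → 0 < s * p → p ^ 2 = q → s * √q = p := by
      intro s p q h1 h2 h3
      have : √q = s * p := by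
        rw [← h3, ← Real.sqrt_sq h2.le]; congr 1; linear_combination (-p ^ 2) * h1
      rw [this, ← mul_assoc, h1, one_mul]
    refine Prod.ext rfl (Prod.ext rfl (Prod.ext ?_ ?_))
    · change c.s₁ (T s).1 * √(L.Q₁ κ₁ κ₂ (T s).1) = σ * (ψ s).2.2.1
      rw [h3]
      exact key hs1 h1 e1
    · change c.s₂ (T s).2 * √(L.Q₂ κ₁ κ₂ (T s).2) = σ * (ψ s).2.2.2
      rw [h4]
      exact key hs2 h2 e2
  rw [hang]
  refine ⟨hTt, hcov, ?_, _, hTd.congr_of_eventuallyEq hloc, ?_⟩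
  · simp only [density, hT]
    rw [hd.φ₁_eq, hd.φ₂_eq]
  · rw [det_eq]
    simp
    linear_combination ((fderiv ℝ ψ t (1, 0)).1 * (fderiv ℝ ψ t (0, 1)).2.1
        - (fderiv ℝ ψ t (1, 0)).2.1 * (fderiv ℝ ψ t (0, 1)).1) * hσ

theorem measurable_extend (hψ : L.IsLocalParam Λ V ψ) :
    ∃ ψ' : ℝ × ℝ → E, Measurable ψ' ∧ EqOn ψ' ψ V := by
  classical
  exact ⟨V.piecewise ψ 0, hψ.smooth.continuousOn.measurable_piecewise continuousOn_const
    hψ.isOpen.measurableSet, fun t ht => piecewise_eq_of_mem _ _ _ ht⟩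

theorem measurableSet_inter_preimage (hψ : L.IsLocalParam Λ V ψ) {B : Set E}
    (hB : MeasurableSet B) : MeasurableSet (V ∩ ψ ⁻¹' B) := by
  obtain ⟨ψ', hm, he⟩ := measurable_extend hψ
  have : V ∩ ψ ⁻¹' B = V ∩ ψ' ⁻¹' B := by
    ext t
    simp only [mem_inter_iff, mem_preimage]
    exact and_congr_right fun ht => by rw [he ht]
  rw [this]
  exact hψ.isOpen.measurableSet.inter (hB.preimage hm)

/-- The non-generic set is a countable union of level sets of `p₁`, `p₂`, `θ₁`, `θ₂`, each taken
where the function in question has non-zero differential. -/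
theorem volume_not_generic (hκ : L.IsParam κ₁ κ₂) (hL : L.IsClassical)
    (hψ : L.IsLocalParam Λ V ψ) : volume (V \ ψ ⁻¹' c.generic) = 0 := by
  have hcoord := fun t ht => hψ.coord_ne_zero hκ hL c.subset_level (t := t) ht
  have n1 : volume (V ∩ ψ ⁻¹' {x | x.2.2.1 = 0}) = 0 := by
    refine volume_level_eq_zero (h := fun t => (ψ t).2.2.1) (c := 0)
      (measurableSet_inter_preimage hψ (measurableSet_eq_fun (by fun_prop) measurable_const))
      (fun t ht => ht.2) fun t ht => ⟨_, ((ContinuousLinearMap.fst ℝ ℝ ℝ).comp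
        ((ContinuousLinearMap.snd ℝ ℝ (ℝ × ℝ)).comp
        (ContinuousLinearMap.snd ℝ ℝ (ℝ × ℝ × ℝ)))).hasFDerivAt.comp t (hψ.hasFDerivAt ht.1), ?_⟩
    exact (hcoord t ht.1).2.1 ht.2
  have n2 : volume (V ∩ ψ ⁻¹' {x | x.2.2.2 = 0}) = 0 := by
    refine volume_level_eq_zero (h := fun t => (ψ t).2.2.2) (c := 0)
      (measurableSet_inter_preimage hψ (measurableSet_eq_fun (by fun_prop) measurable_const))
      (fun t ht => ht.2) fun t ht => ⟨_, ((ContinuousLinearMap.snd ℝ ℝ ℝ).comp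
        ((ContinuousLinearMap.snd ℝ ℝ (ℝ × ℝ)).comp
        (ContinuousLinearMap.snd ℝ ℝ (ℝ × ℝ × ℝ)))).hasFDerivAt.comp t (hψ.hasFDerivAt ht.1), ?_⟩
    exact (hcoord t ht.1).2.2.2 ht.2
  -- Points with `p₁ = 0` are excluded because `θ₁` is critical there; they are already covered by
  -- `n1`.
  have n3 : ∀ r, volume (V ∩ ψ ⁻¹' {x | x.2.2.1 ≠ 0 ∧ x.1 = r}) = 0 := by
    intro r
    refine volume_level_eq_zero (h := fun t => (ψ t).1) (c := r)
      (measurableSet_inter_preimage hψ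
        ((measurableSet_eq_fun (f := fun x : E => x.2.2.1) (by fun_prop) measurable_const).compl.inter
          (measurableSet_eq_fun (by fun_prop) measurable_const)))
      (fun t ht => ht.2.2) fun t ht => ⟨_, (ContinuousLinearMap.fst ℝ ℝ
        (ℝ × ℝ × ℝ)).hasFDerivAt.comp t (hψ.hasFDerivAt ht.1), ?_⟩
    exact (hcoord t ht.1).1 ht.2.1
  have n4 : ∀ r, volume (V ∩ ψ ⁻¹' {x | x.2.2.2 ≠ 0 ∧ x.2.1 = r}) = 0 := by
    intro r
    refine volume_level_eq_zero (h := fun t => (ψ t).2.1) (c := r)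
      (measurableSet_inter_preimage hψ
        ((measurableSet_eq_fun (f := fun x : E => x.2.2.2) (by fun_prop) measurable_const).compl.inter
          (measurableSet_eq_fun (by fun_prop) measurable_const)))
      (fun t ht => ht.2.2) fun t ht => ⟨_, ((ContinuousLinearMap.fst ℝ ℝ (ℝ × ℝ)).comp
        (ContinuousLinearMap.snd ℝ ℝ (ℝ × ℝ × ℝ))).hasFDerivAt.comp t (hψ.hasFDerivAt ht.1), ?_⟩
    exact (hcoord t ht.1).2.2.1 ht.2.1
  have hsub : V \ ψ ⁻¹' c.generic ⊆
      ((V ∩ ψ ⁻¹' {x | x.2.2.1 = 0}) ∪ (V ∩ ψ ⁻¹' {x | x.2.2.2 = 0})) ∪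
      ((⋃ r ∈ c.exc₁, V ∩ ψ ⁻¹' {x | x.2.2.1 ≠ 0 ∧ x.1 = r}) ∪
        ⋃ r ∈ c.exc₂, V ∩ ψ ⁻¹' {x | x.2.2.2 ≠ 0 ∧ x.2.1 = r}) := by
    rintro t ⟨htV, ht⟩
    by_cases h1 : (ψ t).2.2.1 = 0
    · exact Or.inl (Or.inl ⟨htV, h1⟩)
    by_cases h2 : (ψ t).2.2.2 = 0
    · exact Or.inl (Or.inr ⟨htV, h2⟩)
    by_cases h3 : (ψ t).1 ∈ c.exc₁
    · exact Or.inr (Or.inl (mem_iUnion₂.2 ⟨_, h3, htV, h1, rfl⟩))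
    by_cases h4 : (ψ t).2.1 ∈ c.exc₂
    · exact Or.inr (Or.inr (mem_iUnion₂.2 ⟨_, h4, htV, h2, rfl⟩))
    exact absurd ⟨h1, h2, h3, h4⟩ ht
  refine measure_mono_null hsub (measure_union_null (measure_union_null n1 n2)
    (measure_union_null ?_ ?_))
  · exact (measure_biUnion_null_iff c.countable₁).2 fun r _ => n3 r
  · exact (measure_biUnion_null_iff c.countable₂).2 fun r _ => n4 r

theorem aemeasurable_cov (hψ : L.IsLocalParam Λ V ψ) (d : ℝ × ℝ → ENNReal) :
    AEMeasurable (fun t => L.cov (ψ t)) ((volume.restrict V).withDensity d) :=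
  (L.measurable_cov.comp_aemeasurable
    (hψ.smooth.continuousOn.aemeasurable hψ.isOpen.measurableSet)).mono_ac
    (withDensity_absolutelyContinuous _ _)

theorem map_apply (hψ : L.IsLocalParam Λ V ψ) (d : ℝ × ℝ → ENNReal) {A : Set L.CotΓ}
    (hA : MeasurableSet A) :
    Measure.map (fun t => L.cov (ψ t)) ((volume.restrict V).withDensity d) A
      = ∫⁻ t in (fun t => L.cov (ψ t)) ⁻¹' A ∩ V, d t := by
  rw [Measure.map_apply_of_aemeasurable (aemeasurable_cov hψ d) hA, withDensity_apply',
    Measure.restrict_restrict' hψ.isOpen.measurableSet]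

/-- The Leray measure is the measure which the chart induces. -/
theorem lerayMeasure_eq (hκ : L.IsParam κ₁ κ₂) (hL : L.IsClassical) :
    L.lerayMeasure Λ = c.measure := by
  -- The chart is one of the competitors, so only the upper bound is at stake. Up to a null set
  -- every other competitor is carried injectively into the domain of the chart, with matching
  -- densities by the change of variables formula.
  refine le_antisymm (sSup_le ?_) (c.measure_le hκ hL)
  rintro _ ⟨α, V, ψ, hα, hψ, rfl⟩
  refine Measure.le_iff.2 fun A hA => ?_
  rw [measure, map_apply hψ _ hA, map_apply c.isLocalParam _ hA]
  set S := V ∩ ψ ⁻¹' (c.generic ∩ L.cov ⁻¹' A) with hS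
  have hSm : MeasurableSet S := measurableSet_inter_preimage hψ
    (c.measurableSet_generic.inter (hA.preimage L.measurable_cov))
  have hprop := fun t (ht : t ∈ S) => c.exists_fderiv_angles hκ hψ ht.1 ht.2.1
  have hae : ((fun t => L.cov (ψ t)) ⁻¹' A ∩ V : Set (ℝ × ℝ)) =ᵐ[volume] S := by
    have hnull := c.volume_not_generic hκ hL hψ
    have h0 : ∀ᵐ t : ℝ × ℝ, t ∉ V \ ψ ⁻¹' c.generic := measure_eq_zero_iff_ae_notMem.1 hnull
    filter_upwards [h0] with t ht
    refine propext ⟨fun h => ⟨h.2, ?_, h.1⟩, fun h => ⟨h.2.2, h.1⟩⟩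
    by_contra hg
    exact ht ⟨h.2, hg⟩
  rw [setLIntegral_congr hae]
  choose! T' hT' hdet using fun t (ht : t ∈ S) => (hprop t ht).2.2.2
  have hinj : InjOn (fun t => c.angles (L.cov (ψ t))) S := by
    intro s hs t ht hst
    refine hψ.injOn hs.1 ht.1 ?_
    simp only at hst ⊢
    rw [← (hprop s hs).2.1, ← (hprop t ht).2.1, hst]
  calc ∫⁻ t in S, ENNReal.ofReal |α (ψ t) ![fderiv ℝ ψ t (1, 0), fderiv ℝ ψ t (0, 1)]|
      = ∫⁻ t in S, ENNReal.ofReal |(T' t).det|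
          * ENNReal.ofReal (density L κ₁ κ₂ (c.angles (L.cov (ψ t)))) := by
        refine setLIntegral_congr_fun hSm fun t ht => ?_
        obtain ⟨h1, h2⟩ := hψ.dF_eq_zero c.subset_level ht.1 (1, 0)
        obtain ⟨h3, h4⟩ := hψ.dF_eq_zero c.subset_level ht.1 (0, 1)
        rw [← ENNReal.ofReal_mul (abs_nonneg _), (hprop t ht).2.2.1, hdet t ht,
          hκ.abs_leray c.subset_level hα (hψ.mapsTo ht.1) ht.2.1.1 ht.2.1.2.1 h1 h2 h3 h4, mul_comm]
        rfl
    _ = ∫⁻ v in (fun t => c.angles (L.cov (ψ t))) '' S, ENNReal.ofReal (density L κ₁ κ₂ v) :=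
        (lintegral_image_eq_lintegral_abs_det_fderiv_mul volume hSm
          (fun t ht => (hT' t ht).hasFDerivWithinAt) hinj
          fun v => ENNReal.ofReal (density L κ₁ κ₂ v)).symm
    _ ≤ _ := by
        refine lintegral_mono_set ?_
        rintro _ ⟨t, ht, rfl⟩
        refine ⟨?_, (hprop t ht).1⟩
        change L.cov (c.ψ (c.angles (L.cov (ψ t)))) ∈ A
        rw [(hprop t ht).2.1]
        exact ht.2.2

end TorusChart
end LiouvilleTable

/-! ### Curves in the plane -/

theorem isCompact_graph {B : Set ℝ} (hB : IsCompact B) {q : ℝ → ℝ} (hq : Continuous q) :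
    IsCompact ((fun t => (t, q t)) '' B) := hB.image (by fun_prop)

theorem oval_eq_union {B : Set ℝ} {q : ℝ → ℝ} (hB : ∀ t ∈ B, 0 ≤ q t) :
    {z : ℝ × ℝ | z.1 ∈ B ∧ z.2 ^ 2 = q z.1}
      = (fun t => (t, √(q t))) '' B ∪ (fun t => (t, -√(q t))) '' B := by
  ext ⟨t, p⟩
  constructor
  · rintro ⟨h1, h2⟩
    simp only at h1 h2
    rcases le_total 0 p with hp | hp
    · exact Or.inl ⟨t, h1, by simp only; rw [← h2, Real.sqrt_sq hp]⟩
    · refine Or.inr ⟨t, h1, ?_⟩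
      simp only
      rw [← h2, ← neg_sq, Real.sqrt_sq (by linarith), neg_neg]
  · rintro (⟨s, hs, he⟩ | ⟨s, hs, he⟩) <;> simp only [Prod.mk.injEq] at he <;>
      obtain ⟨rfl, rfl⟩ := he
    · exact ⟨hs, Real.sq_sqrt (hB _ hs)⟩
    · exact ⟨hs, by simp only; rw [neg_sq, Real.sq_sqrt (hB _ hs)]⟩

theorem isCompact_oval {B : Set ℝ} (hBc : IsCompact B) {q : ℝ → ℝ} (hq : Continuous q)
    (hB : ∀ t ∈ B, 0 ≤ q t) : IsCompact {z : ℝ × ℝ | z.1 ∈ B ∧ z.2 ^ 2 = q z.1} := by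
  rw [oval_eq_union hB]
  exact (isCompact_graph hBc (hq.sqrt)).union (isCompact_graph hBc hq.sqrt.neg)

/-- The two branches `±√q` are connected and meet at the turning point `r`. -/
theorem isPreconnected_oval {B : Set ℝ} (hBc : IsPreconnected B) {q : ℝ → ℝ} (hq : Continuous q)
    (hB : ∀ t ∈ B, 0 ≤ q t) {r : ℝ} (hr : r ∈ B) (hr0 : q r = 0) :
    IsPreconnected {z : ℝ × ℝ | z.1 ∈ B ∧ z.2 ^ 2 = q z.1} := by
  rw [oval_eq_union hB]
  refine IsPreconnected.union (r, 0) ⟨r, hr, by simp [hr0]⟩ ⟨r, hr, by simp [hr0]⟩ ?_ ?_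
  · exact hBc.image _ (by fun_prop)
  · exact hBc.image _ (by fun_prop)

/-! ### The angle domain of a librating variable -/

/-- Two half periods, for the two signs of the momentum of a librating variable. -/
def libDomain (c T : ℝ) : Set ℝ := Ioo (c - T / 4) (c + T / 4) ∪ Ioo (c + 3 * T / 4) (c + 5 * T / 4)

/-- The sign of the momentum on `libDomain`. -/
noncomputable def libSign (c T t : ℝ) : ℝ := if t < c + T / 2 then 1 else -1

theorem libSign_eq (c T t : ℝ) : libSign c T t = 1 ∨ libSign c T t = -1 := by
  unfold libSign; split_ifs <;> simp

theorem libSign_left {c T t : ℝ} (hT : 0 < T) (h : t ∈ Ioo (c - T / 4) (c + T / 4)) :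
    libSign c T t = 1 := if_pos (by linarith [h.2])

theorem libSign_right {c T t : ℝ} (hT : 0 < T) (h : t ∈ Ioo (c + 3 * T / 4) (c + 5 * T / 4)) :
    libSign c T t = -1 := if_neg (by linarith [h.1])

theorem libSign_const {c T t : ℝ} (hT : 0 < T) (h : t ∈ libDomain c T) :
    ∀ᶠ r in 𝓝 t, libSign c T r = libSign c T t := by
  rcases h with h | h
  · filter_upwards [isOpen_Ioo.mem_nhds h] with r hr
    rw [libSign_left hT h, libSign_left hT hr]
  · filter_upwards [isOpen_Ioo.mem_nhds h] with r hr
    rw [libSign_right hT h, libSign_right hT hr]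

theorem int_eq_zero_of_abs_mul_lt {k : ℤ} {T : ℝ} (hT : 0 < T) (h : |k * T| < T) : k = 0 := by
  rw [abs_mul, abs_of_pos hT] at h
  have h1 : |(k : ℝ)| < 1 := by
    by_contra hcon
    push Not at hcon
    nlinarith
  have h2 : |k| < 1 := by exact_mod_cast h1
  exact Int.abs_lt_one_iff.1 h2

/-- The second interval of `libDomain` is the first one translated by a full period, so the
translate records the sign of the momentum. Points of one interval congruent modulo `T` coincide,
and points of different intervals carry opposite signs. -/
theorem libDomain_inj {c T s t a b : ℝ} {k : ℤ} (hT : 0 < T) (hs : s ∈ libDomain c T)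
    (ht : t ∈ libDomain c T) (hk : t = s + k * T) (ha : 0 < a) (hb : 0 < b)
    (he : libSign c T s * a = libSign c T t * b) : s = t := by
  suffices k = 0 by rw [hk, this]; simp
  refine int_eq_zero_of_abs_mul_lt hT ?_
  have e : k * T = t - s := by linarith
  rw [e, abs_lt]
  rcases hs with hs' | hs' <;> rcases ht with ht' | ht'
  · constructor <;> linarith [hs'.1, hs'.2, ht'.1, ht'.2]
  · rw [libSign_left hT hs', libSign_right hT ht'] at he; linarith
  · rw [libSign_right hT hs', libSign_left hT ht'] at he; linarith
  · constructor <;> linarith [hs'.1, hs'.2, ht'.1, ht'.2]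

theorem libDomain_cover {c T t p q : ℝ} (hT : 0 < T) (ht : t ∈ Ioo (c - T / 4) (c + T / 4))
    (hp : p ≠ 0) (hq : p ^ 2 = q) :
    ∃ l : ℤ, t + l * T ∈ libDomain c T ∧ p = libSign c T (t + l * T) * √q := by
  rcases lt_or_gt_of_ne hp with h | h
  · have hm : t + ((1 : ℤ) : ℝ) * T ∈ Ioo (c + 3 * T / 4) (c + 5 * T / 4) := by
      push_cast; constructor <;> linarith [ht.1, ht.2]
    refine ⟨1, Or.inr hm, ?_⟩
    rw [libSign_right hT hm, ← hq, ← neg_sq, Real.sqrt_sq (by linarith)]; ring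
  · have hm : t + ((0 : ℤ) : ℝ) * T ∈ Ioo (c - T / 4) (c + T / 4) := by simpa using ht
    refine ⟨0, Or.inl hm, ?_⟩
    rw [libSign_left hT hm, ← hq, Real.sqrt_sq h.le, one_mul]

theorem isOpen_libDomain (c T : ℝ) : IsOpen (libDomain c T) := isOpen_Ioo.union isOpen_Ioo

theorem exists_int_add_mem_Ico {T : ℝ} (hT : 0 < T) (a t : ℝ) :
    ∃ k : ℤ, t + k * T ∈ Ico a (a + T) := by
  refine ⟨-toIcoDiv hT a t, ?_⟩
  have h := toIcoMod_mem_Ico hT a t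
  rw [toIcoMod, zsmul_eq_mul] at h
  push_cast
  convert h using 1
  ring

/-! ### The covering of the cotangent bundle and its deck transformations -/

namespace LiouvilleTable

variable {L : LiouvilleTable} {κ₁ κ₂ : ℝ}

theorem cov_surjective : Function.Surjective L.cov := by
  intro ξ
  induction ξ using Quotient.inductionOn with
  | _ ξ =>
  obtain ⟨a, b, p⟩ := ξ
  induction a using QuotientAddGroup.induction_on with
  | H s =>
  induction b using QuotientAddGroup.induction_on with
  | H t => exact ⟨(s, t, p), rfl⟩

theorem cov_eq_cov {x y : E} (h : L.cov x = L.cov y) :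
    (∃ k l : ℤ, y = (x.1 + k * L.ω₁, x.2.1 + l * L.ω₂, x.2.2.1, x.2.2.2)) ∨
    ∃ k l : ℤ, y = (-x.1 + k * L.ω₁, L.ω₂ / 2 - x.2.1 + l * L.ω₂, -x.2.2.1, -x.2.2.2) := by
  rcases Quotient.exact h with h | h
  · left
    simp only [Prod.mk.injEq] at h
    obtain ⟨h1, h2, h3⟩ := h
    obtain ⟨k, hk⟩ := (L.coe₁_eq_iff _ _).1 h1.symm
    obtain ⟨l, hl⟩ := (L.coe₂_eq_iff _ _).1 h2.symm
    exact ⟨k, l, Prod.ext hk (Prod.ext hl (Prod.ext h3.1 h3.2))⟩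
  · right
    simp only [ι, Prod.mk.injEq] at h
    obtain ⟨h1, h2, h3⟩ := h
    rw [← AddCircle.coe_neg] at h1
    rw [half₂, ← AddCircle.coe_sub] at h2
    obtain ⟨k, hk⟩ := (L.coe₁_eq_iff _ _).1 h1.symm
    obtain ⟨l, hl⟩ := (L.coe₂_eq_iff _ _).1 h2.symm
    exact ⟨k, l, Prod.ext hk (Prod.ext hl (Prod.ext h3.1 h3.2))⟩

theorem isDeck_one (k l : ℤ) : L.IsDeck 1 (k * L.ω₁) (l * L.ω₂) where
  sign := Or.inl rfl
  cov_eq := by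
    intro x
    simp only [cov, deck, one_mul]
    congr 2
    · exact ((L.coe₁_eq_iff _ _).2 ⟨k, rfl⟩).symm
    · congr 1
      exact ((L.coe₂_eq_iff _ _).2 ⟨l, rfl⟩).symm
  φ₁_eq t := by rw [one_mul]; exact L.periodic₁.int_mul k t
  φ₂_eq t := by rw [one_mul]; exact L.periodic₂.int_mul l t

theorem isDeck_neg (k l : ℤ) : L.IsDeck (-1) (k * L.ω₁) (L.ω₂ / 2 + l * L.ω₂) where
  sign := Or.inr rfl
  cov_eq := by
    intro x
    refine Quotient.sound (Or.inr ?_)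
    simp only [ι, deck]
    refine Prod.ext ?_ (Prod.ext ?_ (Prod.ext ?_ ?_))
    · simp only
      rw [← AddCircle.coe_neg]
      exact (L.coe₁_eq_iff _ _).2 ⟨-k, by push_cast; ring⟩
    · simp only
      rw [half₂, ← AddCircle.coe_sub]
      exact (L.coe₂_eq_iff _ _).2 ⟨-l, by push_cast; ring⟩
    · simp
    · simp
  φ₁_eq t := by rw [L.periodic₁.int_mul k, neg_one_mul, L.even₁]
  φ₂_eq t := by
    rw [← add_assoc, L.periodic₂.int_mul l, neg_one_mul, add_comm, ← sub_eq_add_neg, L.symm₂]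

theorem IsDeck.add {σ a b : ℝ} (h : L.IsDeck σ a b) (k l : ℤ) :
    L.IsDeck σ (a + k * L.ω₁) (b + l * L.ω₂) where
  sign := h.sign
  cov_eq := by
    intro x
    rw [← h.cov_eq x, ← (isDeck_one k l).cov_eq (deck σ a b x)]
    simp only [deck, one_mul, add_assoc]
  φ₁_eq t := by rw [← add_assoc, L.periodic₁.int_mul k]; exact h.φ₁_eq t
  φ₂_eq t := by rw [← add_assoc, L.periodic₂.int_mul l]; exact h.φ₂_eq t

theorem IsDeck.mem_iff {σ a b : ℝ} (h : L.IsDeck σ a b) (x : E) (Λ : Set L.CotΓ) :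
    L.cov (deck σ a b x) ∈ Λ ↔ L.cov x ∈ Λ := by rw [h.cov_eq]

/-! ### Components of level sets -/

/-- A part of a level set which is cut out by a continuous function without zeros on the level set,
and which is the image of a connected compact set, is a Liouville torus. -/
theorem IsParam.isLiouvilleTorus (hκ : L.IsParam κ₁ κ₂) (hL : L.IsClassical) {s : L.CotΓ → ℝ}
    (hs : Continuous s) (hs0 : ∀ ξ ∈ L.level κ₁ κ₂, s ξ ≠ 0) {K : Set E} (hK : IsCompact K)
    (hKc : IsPreconnected K) (hKn : K.Nonempty)
    (hKΛ : L.cov '' K = {ξ | ξ ∈ L.level κ₁ κ₂ ∧ 0 < s ξ}) :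
    L.IsLiouvilleTorus {ξ | ξ ∈ L.level κ₁ κ₂ ∧ 0 < s ξ} := by
  set Λ := {ξ | ξ ∈ L.level κ₁ κ₂ ∧ 0 < s ξ} with hΛ
  have hΛn : Λ.Nonempty := by rw [← hKΛ]; exact hKn.image _
  obtain ⟨ξ, hξ⟩ := hΛn
  refine ⟨⟨κ₁ + κ₂, κ₁ * κ₂, ξ, hξ.1, ?_⟩, ?_, fun x hx => hκ.exists_wedge_ne_zero hL hx.1⟩
  · change Λ = connectedComponentIn (L.level κ₁ κ₂) ξ
    refine Subset.antisymm ?_ fun η hη => ?_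
    · refine IsPreconnected.subset_connectedComponentIn ?_ hξ fun η hη => hη.1
      rw [← hKΛ]
      exact hKc.image _ L.continuous_cov.continuousOn
    · have hlev := connectedComponentIn_subset (L.level κ₁ κ₂) ξ
      refine ⟨hlev hη, ?_⟩
      -- A connected subset of the level set cannot cross the zero set of `s`, so the component
      -- keeps the sign of `s` at `ξ`.
      have hsub : connectedComponentIn (L.level κ₁ κ₂) ξ ⊆ {ζ | 0 < s ζ} := by
        refine isPreconnected_connectedComponentIn.subset_left_of_subset_union
          (u := {ζ | 0 < s ζ}) (v := {ζ | s ζ < 0})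
          (isOpen_lt continuous_const hs) (isOpen_lt hs continuous_const) ?_ ?_
          ⟨ξ, mem_connectedComponentIn hξ.1, hξ.2⟩
        · rw [Set.disjoint_left]
          intro ζ h1 h2
          exact lt_asymm (show 0 < s ζ from h1) (show s ζ < 0 from h2)
        · intro ζ hζ
          rcases lt_or_gt_of_ne (hs0 ζ (hlev hζ)) with h | h
          · exact Or.inr h
          · exact Or.inl h
      exact hsub hη
  · rw [← hKΛ]
    exact hK.image L.continuous_cov

theorem IsParam.measurableSet (hκ : L.IsParam κ₁ κ₂) {s : L.CotΓ → ℝ} (hs : Continuous s) :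
    MeasurableSet {ξ | ξ ∈ L.level κ₁ κ₂ ∧ 0 < s ξ} := by
  rw [measurableSet_quotient]
  have hc1 : Continuous fun ξ : L.CotTorus => L.f₁ ξ.1 := L.continuous_f₁.comp continuous_fst
  have hc2 : Continuous fun ξ : L.CotTorus => L.f₂ ξ.2.1 := L.continuous_f₂.comp (by fun_prop)
  have h1 : IsClosed {ξ : L.CotTorus | ξ.2.2.1 ^ 2 = (L.f₁ ξ.1 - κ₁) * (L.f₁ ξ.1 - κ₂)} :=
    isClosed_eq (by fun_prop) (by fun_prop)
  have h2 : IsClosed {ξ : L.CotTorus | ξ.2.2.2 ^ 2 = (L.f₂ ξ.2.1 - κ₁) * (κ₂ - L.f₂ ξ.2.1)} :=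
    isClosed_eq (by fun_prop) (by fun_prop)
  have h3 : IsOpen {ξ : L.CotTorus | 0 < s (Quotient.mk _ ξ)} :=
    isOpen_lt continuous_const (hs.comp continuous_quotient_mk')
  have : (Quotient.mk'' ⁻¹' {ξ | ξ ∈ L.level κ₁ κ₂ ∧ 0 < s ξ} : Set L.CotTorus)
      = ({ξ : L.CotTorus | ξ.2.2.1 ^ 2 = (L.f₁ ξ.1 - κ₁) * (L.f₁ ξ.1 - κ₂)} ∩
        {ξ : L.CotTorus | ξ.2.2.2 ^ 2 = (L.f₂ ξ.2.1 - κ₁) * (κ₂ - L.f₂ ξ.2.1)}) ∩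
        {ξ : L.CotTorus | 0 < s (Quotient.mk _ ξ)} := by
    ext ξ
    exact and_congr_left fun _ => hκ.mk_mem_level ξ
  rw [this]
  exact (h1.measurableSet.inter h2.measurableSet).inter h3.measurableSet

/-- The rearrangement of a product of two plane curves to a subset of phase space. -/
def rearrange (z : (ℝ × ℝ) × (ℝ × ℝ)) : E := (z.1.1, z.2.1, z.1.2, z.2.2)

theorem continuous_rearrange : Continuous rearrange := by unfold rearrange; fun_prop

/-! ### The case `κ₂ < ν₁` -/

/-- The function on the circle whose sign separates the two bands of `θ₂`. -/
noncomputable def band₂ (L : LiouvilleTable) : L.T₂ → ℝ :=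
  Function.Periodic.lift (f := fun t : ℝ => Real.cos (2 * Real.pi * t / L.ω₂)) (c := L.ω₂) (by
    intro t
    have := L.ω₂_pos.ne'
    simp only
    rw [show 2 * Real.pi * (t + L.ω₂) / L.ω₂ = 2 * Real.pi * t / L.ω₂ + 2 * Real.pi by
      field_simp, Real.cos_add_two_pi])

/-- The function on the circle whose sign separates the two bands of `θ₁`. -/
noncomputable def band₁ (L : LiouvilleTable) : L.T₁ → ℝ :=
  Function.Periodic.lift (f := fun t : ℝ => Real.sin (2 * Real.pi * t / L.ω₁)) (c := L.ω₁) (by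
    intro t
    have := L.ω₁_pos.ne'
    simp only
    rw [show 2 * Real.pi * (t + L.ω₁) / L.ω₁ = 2 * Real.pi * t / L.ω₁ + 2 * Real.pi by
      field_simp, Real.sin_add_two_pi])

theorem band₂_half_sub (b : L.T₂) : L.band₂ (L.half₂ - b) = -L.band₂ b := by
  induction b using QuotientAddGroup.induction_on with
  | H t =>
    have := L.ω₂_pos.ne'
    change Real.cos (2 * Real.pi * (L.ω₂ / 2 - t) / L.ω₂) = -Real.cos (2 * Real.pi * t / L.ω₂)
    rw [← Real.cos_pi_sub]
    congr 1
    field_simp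

theorem band₁_neg (a : L.T₁) : L.band₁ (-a) = -L.band₁ a := by
  induction a using QuotientAddGroup.induction_on with
  | H t =>
    change Real.sin (2 * Real.pi * (-t) / L.ω₁) = -Real.sin (2 * Real.pi * t / L.ω₁)
    rw [← Real.sin_neg]
    congr 1
    ring

/-- The function which separates the components of a level set with `κ₂ < ν₁`. -/
noncomputable def sepA (L : LiouvilleTable) : L.CotΓ → ℝ :=
  L.liftCot (fun ξ => ξ.2.2.1 * L.band₂ ξ.2.1) (by
    intro ξ; simp only [ι, band₂_half_sub]; ring)

/-- The function which separates the components of a level set with `ν₁ < κ₂`. -/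
noncomputable def sepB (L : LiouvilleTable) : L.CotΓ → ℝ :=
  L.liftCot (fun ξ => ξ.2.2.2 * L.band₁ ξ.1) (by
    intro ξ; simp only [ι, band₁_neg]; ring)

theorem continuous_sepA : Continuous L.sepA := by
  refine Continuous.quotient_lift ?_ _
  have : Continuous L.band₂ := Continuous.quotient_lift (by fun_prop) _
  fun_prop

theorem continuous_sepB : Continuous L.sepB := by
  refine Continuous.quotient_lift ?_ _
  have : Continuous L.band₁ := Continuous.quotient_lift (by fun_prop) _
  fun_prop

theorem sepA_cov (x : E) :
    L.sepA (L.cov x) = x.2.2.1 * Real.cos (2 * Real.pi * x.2.1 / L.ω₂) := rfl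

theorem sepB_cov (x : E) :
    L.sepB (L.cov x) = x.2.2.2 * Real.sin (2 * Real.pi * x.1 / L.ω₁) := rfl

theorem cos_pos_of_band {t : ℝ} (h : t ∈ Ioo (-(L.ω₂ / 4)) (L.ω₂ / 4)) :
    0 < Real.cos (2 * Real.pi * t / L.ω₂) := by
  have hw := L.ω₂_pos
  have hpi := Real.pi_pos
  apply Real.cos_pos_of_mem_Ioo
  constructor
  · rw [lt_div_iff₀ hw]; nlinarith [h.1]
  · rw [div_lt_iff₀ hw]; nlinarith [h.2]

theorem band_of_cos_pos {t : ℝ} (h : t ∈ Ico (-(L.ω₂ / 4)) (-(L.ω₂ / 4) + L.ω₂))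
    (hc : 0 < Real.cos (2 * Real.pi * t / L.ω₂)) : t ∈ Ioo (-(L.ω₂ / 4)) (L.ω₂ / 4) := by
  have hw := L.ω₂_pos
  have hpi := Real.pi_pos
  refine ⟨lt_of_le_of_ne h.1 ?_, ?_⟩
  · rintro rfl
    rw [show 2 * Real.pi * (-(L.ω₂ / 4)) / L.ω₂ = -(Real.pi / 2) by field_simp; norm_num,
      Real.cos_neg, Real.cos_pi_div_two] at hc
    exact lt_irrefl _ hc
  · by_contra! hcon
    refine absurd hc (not_lt.2 (Real.cos_nonpos_of_pi_div_two_le_of_le ?_ ?_))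
    · rw [le_div_iff₀ hw]; nlinarith
    · rw [div_le_iff₀ hw]; nlinarith [h.2]

theorem sin_pos_of_band {t : ℝ} (h : t ∈ Ioo 0 (L.ω₁ / 2)) :
    0 < Real.sin (2 * Real.pi * t / L.ω₁) := by
  have hw := L.ω₁_pos
  have hpi := Real.pi_pos
  apply Real.sin_pos_of_mem_Ioo
  constructor
  · have := h.1; positivity
  · rw [div_lt_iff₀ hw]; nlinarith [h.2]

theorem band_of_sin_pos {t : ℝ} (h : t ∈ Ico 0 (0 + L.ω₁))
    (hc : 0 < Real.sin (2 * Real.pi * t / L.ω₁)) : t ∈ Ioo 0 (L.ω₁ / 2) := by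
  have hw := L.ω₁_pos
  have hpi := Real.pi_pos
  refine ⟨lt_of_le_of_ne h.1 ?_, ?_⟩
  · rintro rfl
    simp at hc
  · by_contra! hcon
    have h1 : Real.pi ≤ 2 * Real.pi * t / L.ω₁ := by rw [le_div_iff₀ hw]; nlinarith
    have h2 : 2 * Real.pi * t / L.ω₁ < 2 * Real.pi := by rw [div_lt_iff₀ hw]; nlinarith [h.2]
    have h3 := Real.sin_nonneg_of_nonneg_of_le_pi (x := 2 * Real.pi * t / L.ω₁ - Real.pi)
      (by linarith) (by linarith)
    rw [Real.sin_sub_pi] at h3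
    linarith

theorem IsParam.Q₁_pos (hκ : L.IsParam κ₁ κ₂) (h : κ₂ < L.ν₁) (t : ℝ) : 0 < L.Q₁ κ₁ κ₂ t :=
  mul_pos (by linarith [L.ν₁_le t, L.ν₁_pos, hκ.neg]) (by linarith [L.ν₁_le t])

theorem IsParam.Q₂_pos (hκ : L.IsParam κ₁ κ₂) (h : L.ν₁ < κ₂) (t : ℝ) : 0 < L.Q₂ κ₁ κ₂ t :=
  mul_pos (by linarith [L.nonneg₂ t, hκ.neg]) (by linarith [L.le_ν₁ t])

theorem IsParam.Q₁_nonneg_iff (hκ : L.IsParam κ₁ κ₂) (t : ℝ) :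
    0 ≤ L.Q₁ κ₁ κ₂ t ↔ κ₂ ≤ L.φ₁ t := by
  have : 0 < L.φ₁ t - κ₁ := by linarith [L.ν₁_le t, L.ν₁_pos, hκ.neg]
  rw [Q₁, mul_nonneg_iff_of_pos_left this, sub_nonneg]

theorem IsParam.Q₂_nonneg_iff (hκ : L.IsParam κ₁ κ₂) (t : ℝ) :
    0 ≤ L.Q₂ κ₁ κ₂ t ↔ L.φ₂ t ≤ κ₂ := by
  have : 0 < L.φ₂ t - κ₁ := by linarith [L.nonneg₂ t, hκ.neg]
  rw [Q₂, mul_nonneg_iff_of_pos_left this, sub_nonneg]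

/-- For `κ₂ < ν₁` the momentum `p₁` never vanishes, as `Q₁ > 0`. The cosine vanishes only where `φ₂
= ν₁ > κ₂`, which `p₂² ≥ 0` forbids. Both factors change sign under the involution, so their product
descends to the quotient. -/
theorem IsParam.sepA_ne_zero (hκ : L.IsParam κ₁ κ₂) (h : κ₂ < L.ν₁) (ξ : L.CotΓ)
    (hξ : ξ ∈ L.level κ₁ κ₂) : L.sepA ξ ≠ 0 := by
  obtain ⟨x, rfl⟩ := cov_surjective ξ
  obtain ⟨h1, h2⟩ := (hκ.cov_mem_level x).1 hξ
  rw [sepA_cov]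
  refine mul_ne_zero ?_ ?_
  · intro h0
    have := hκ.Q₁_pos h x.1
    rw [← h1, h0] at this
    norm_num at this
  · intro h0
    obtain ⟨k, hk⟩ := Real.cos_eq_zero_iff.1 h0
    have hw := L.ω₂_pos.ne'
    have hpi := Real.pi_pos.ne'
    have : L.φ₂ x.2.1 = L.ν₁ := by
      refine (L.φ₂_eq_max _).2 ⟨k, ?_⟩
      field_simp at hk ⊢
      linarith
    have h3 := (hκ.Q₂_nonneg_iff x.2.1).1 (by rw [← h2]; positivity)
    linarith

theorem IsParam.sepB_ne_zero (hκ : L.IsParam κ₁ κ₂) (h : L.ν₁ < κ₂) (ξ : L.CotΓ)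
    (hξ : ξ ∈ L.level κ₁ κ₂) : L.sepB ξ ≠ 0 := by
  obtain ⟨x, rfl⟩ := cov_surjective ξ
  obtain ⟨h1, h2⟩ := (hκ.cov_mem_level x).1 hξ
  rw [sepB_cov]
  refine mul_ne_zero ?_ ?_
  · intro h0
    have := hκ.Q₂_pos h x.2.1
    rw [← h2, h0] at this
    norm_num at this
  · intro h0
    obtain ⟨k, hk⟩ := Real.sin_eq_zero_iff.1 h0
    have hw := L.ω₁_pos.ne'
    have hpi := Real.pi_pos.ne'
    have : L.φ₁ x.1 = L.ν₁ := by
      refine (L.φ₁_eq_min _).2 ⟨k, ?_⟩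
      field_simp at hk ⊢
      linarith
    have h3 := (hκ.Q₁_nonneg_iff x.1).1 (by rw [← h1]; positivity)
    linarith

/-- The torus with `κ₂ < ν₁`. -/
def torusA (L : LiouvilleTable) (κ₁ κ₂ : ℝ) : Set L.CotΓ :=
  {ξ | ξ ∈ L.level κ₁ κ₂ ∧ 0 < L.sepA ξ}

/-- The torus with `ν₁ < κ₂`. -/
def torusB (L : LiouvilleTable) (κ₁ κ₂ : ℝ) : Set L.CotΓ :=
  {ξ | ξ ∈ L.level κ₁ κ₂ ∧ 0 < L.sepB ξ}

/-- Normal form of a point: the involution makes `p₁` positive, the positive sign of `sepA` then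
selects the band of `θ₂` around `0`, and translations bring the angles into one period. -/
theorem exists_deck_A {x : E} (hx : L.cov x ∈ L.torusA κ₁ κ₂) :
    ∃ σ a b, L.IsDeck σ a b ∧ (∃ k : ℤ, a = k * L.ω₁) ∧ 0 < σ * x.2.2.1 ∧
      σ * x.1 + a ∈ Ico 0 L.ω₁ ∧ σ * x.2.1 + b ∈ Ioo (-(L.ω₂ / 4)) (L.ω₂ / 4) := by
  have key : ∃ σ b, L.IsDeck σ 0 b ∧ 0 < σ * x.2.2.1 := by
    have hs := hx.2
    have hp : x.2.2.1 ≠ 0 := by rintro h0; rw [sepA_cov, h0] at hs; simp at hs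
    rcases lt_or_gt_of_ne hp with h | h
    · exact ⟨-1, L.ω₂ / 2, by simpa using isDeck_neg (L := L) 0 0, by linarith⟩
    · exact ⟨1, 0, by simpa using isDeck_one (L := L) 0 0, by linarith⟩
  obtain ⟨σ, b, hd, hp⟩ := key
  obtain ⟨k, hk⟩ := exists_int_add_mem_Ico L.ω₁_pos 0 (σ * x.1)
  obtain ⟨l, hl⟩ := exists_int_add_mem_Ico L.ω₂_pos (-(L.ω₂ / 4)) (σ * x.2.1 + b)
  have hd' := hd.add k l
  refine ⟨σ, _, _, hd', ⟨k, zero_add _⟩, hp, by simpa using hk, ?_⟩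
  rw [← add_assoc]
  refine band_of_cos_pos hl ?_
  have h1 := ((hd'.mem_iff x _).2 hx).2
  rw [sepA_cov] at h1
  simp only [deck, ← add_assoc] at h1
  exact (mul_pos_iff_of_pos_left hp).1 h1

/-- As in the other case, but the involution shifts `θ₂` by `ω₂ / 2`. The form of `b` is recorded
because it determines the seam of the chart. -/
theorem exists_deck_B {x : E} (hx : L.cov x ∈ L.torusB κ₁ κ₂) :
    ∃ σ a b, L.IsDeck σ a b ∧ (∃ k : ℤ, b = k * (L.ω₂ / 2)) ∧ 0 < σ * x.2.2.2 ∧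
      σ * x.2.1 + b ∈ Ico 0 L.ω₂ ∧ σ * x.1 + a ∈ Ioo 0 (L.ω₁ / 2) := by
  have key : ∃ σ, ∃ m : ℤ, L.IsDeck σ 0 (m * (L.ω₂ / 2)) ∧ 0 < σ * x.2.2.2 := by
    have hs := hx.2
    have hp : x.2.2.2 ≠ 0 := by rintro h0; rw [sepB_cov, h0] at hs; simp at hs
    rcases lt_or_gt_of_ne hp with h | h
    · exact ⟨-1, 1, by simpa using isDeck_neg (L := L) 0 0, by linarith⟩
    · exact ⟨1, 0, by simpa using isDeck_one (L := L) 0 0, by linarith⟩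
  obtain ⟨σ, m, hd, hp⟩ := key
  obtain ⟨k, hk⟩ := exists_int_add_mem_Ico L.ω₁_pos 0 (σ * x.1)
  obtain ⟨l, hl⟩ := exists_int_add_mem_Ico L.ω₂_pos 0 (σ * x.2.1 + m * (L.ω₂ / 2))
  have hd' := hd.add k l
  refine ⟨σ, _, _, hd', ⟨m + 2 * l, by push_cast; ring⟩, hp, by simpa [add_assoc] using hl, ?_⟩
  rw [zero_add]
  refine band_of_sin_pos hk ?_
  have h1 := ((hd'.mem_iff x _).2 hx).2
  rw [sepB_cov] at h1
  simp only [deck, zero_add] at h1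
  exact (mul_pos_iff_of_pos_left hp).1 h1

/-- For `κ₂ < ν₁` the angle `θ₁` rotates and `θ₂` librates: the torus is the image of the graph of
`√Q₁` over a closed period times the oval `p₂² = Q₂` in the band around `θ₂ = 0`. -/
theorem IsParam.isLiouvilleTorus_A (hκ : L.IsParam κ₁ κ₂) (hL : L.IsClassical) (h : κ₂ < L.ν₁) :
    L.IsLiouvilleTorus (L.torusA κ₁ κ₂) := by
  set B := {t | t ∈ Icc (-(L.ω₂ / 4)) (L.ω₂ / 4) ∧ L.φ₂ t ≤ κ₂} with hB
  have hw := L.ω₂_pos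
  have hBc : IsCompact B :=
    isCompact_Icc.inter_right (isClosed_le L.smooth₂.continuous continuous_const)
  have hBp : IsPreconnected B := (hL.profile₂.ordConnected_sublevel κ₂).isPreconnected
  have hB0 : ∀ t ∈ B, 0 ≤ L.Q₂ κ₁ κ₂ t := fun t ht => (hκ.Q₂_nonneg_iff t).2 ht.2
  obtain ⟨r, hr, hr0⟩ := hL.profile₂.exists_eq (c := κ₂) (by rw [φ₂_zero]; exact hκ.pos)
    (by rw [φ₂_quarter]; exact h)
  have hrB : r ∈ B := ⟨⟨by linarith [hr.1], hr.2.le⟩, hr0.le⟩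
  have hQ1 := (L.contDiff_Q₁ κ₁ κ₂).continuous
  have hQ2 := (L.contDiff_Q₂ κ₁ κ₂).continuous
  set O₁ := (fun t => (t, √(L.Q₁ κ₁ κ₂ t))) '' Icc 0 L.ω₁ with hO₁
  set O₂ := {z : ℝ × ℝ | z.1 ∈ B ∧ z.2 ^ 2 = L.Q₂ κ₁ κ₂ z.1} with hO₂
  refine hκ.isLiouvilleTorus hL continuous_sepA (hκ.sepA_ne_zero h) (K := rearrange '' (O₁ ×ˢ O₂))
    ?_ ?_ ?_ ?_
  · exact ((isCompact_graph isCompact_Icc hQ1.sqrt).prod (isCompact_oval hBc hQ2 hB0)).image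
      continuous_rearrange
  · exact ((isPreconnected_Icc.image _ (by fun_prop)).prod
      (isPreconnected_oval hBp hQ2 hB0 hrB (by rw [Q₂, hr0]; ring))).image _
      continuous_rearrange.continuousOn
  · exact ⟨_, ((0, √(L.Q₁ κ₁ κ₂ 0)), (r, 0)), ⟨⟨0, ⟨le_rfl, L.ω₁_pos.le⟩, rfl⟩,
      ⟨hrB, by simp [Q₂, hr0]⟩⟩, rfl⟩
  · ext ξ
    constructor
    · rintro ⟨_, ⟨⟨_, ⟨b, p⟩⟩, ⟨⟨t, ht, rfl⟩, ⟨hb, hp⟩⟩, rfl⟩, rfl⟩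
      simp only at hb hp
      refine ⟨(hκ.cov_mem_level _).2 ⟨Real.sq_sqrt (hκ.Q₁_pos h t).le, hp⟩, ?_⟩
      rw [sepA_cov]
      refine mul_pos (Real.sqrt_pos.2 (hκ.Q₁_pos h t)) (cos_pos_of_band ?_)
      simp only [rearrange]
      refine ⟨lt_of_le_of_ne hb.1.1 ?_, lt_of_le_of_ne hb.1.2 ?_⟩
      · rintro rfl
        have := hb.2
        rw [L.even₂, φ₂_quarter] at this
        linarith
      · rintro rfl
        have := hb.2
        rw [φ₂_quarter] at this
        linarith
    · intro hξ
      obtain ⟨x, rfl⟩ := cov_surjective ξ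
      obtain ⟨σ, a, b, hd, -, hp, h1, h2⟩ := exists_deck_A hξ
      have hξ' := (hd.mem_iff x _).2 hξ
      obtain ⟨e1, e2⟩ := (hκ.cov_mem_level _).1 hξ'.1
      simp only [deck] at e1 e2
      rw [← hd.cov_eq]
      refine ⟨_, ⟨((σ * x.1 + a, σ * x.2.2.1), (σ * x.2.1 + b, σ * x.2.2.2)),
        ⟨⟨_, ⟨h1.1, h1.2.le⟩, ?_⟩, ⟨⟨⟨h2.1.le, h2.2.le⟩, ?_⟩, e2⟩⟩, rfl⟩, rfl⟩
      · simp only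
        rw [← e1, Real.sqrt_sq hp.le]
      · exact (hκ.Q₂_nonneg_iff _).1 (by rw [← e2]; positivity)

/-- For `ν₁ < κ₂` the roles are exchanged: `θ₁` librates around `ω₁ / 4` and `θ₂` rotates. -/
theorem IsParam.isLiouvilleTorus_B (hκ : L.IsParam κ₁ κ₂) (hL : L.IsClassical) (h : L.ν₁ < κ₂) :
    L.IsLiouvilleTorus (L.torusB κ₁ κ₂) := by
  set B := {t | t ∈ Icc 0 (L.ω₁ / 2) ∧ κ₂ ≤ L.φ₁ t} with hB
  have hw := L.ω₁_pos
  have hBc : IsCompact B :=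
    isCompact_Icc.inter_right (isClosed_le continuous_const L.smooth₁.continuous)
  have hBp : IsPreconnected B := (hL.profile₁.ordConnected_superlevel κ₂).isPreconnected
  have hB0 : ∀ t ∈ B, 0 ≤ L.Q₁ κ₁ κ₂ t := fun t ht => (hκ.Q₁_nonneg_iff t).2 ht.2
  obtain ⟨r, hr, hr0⟩ := hL.profile₁.exists_eq (c := κ₂) (by rw [φ₁_zero]; exact h)
    (by rw [hL.φ₁_quarter]; exact hκ.hi)
  have hrB : r ∈ B := ⟨⟨hr.1.le, by linarith [hr.2]⟩, hr0.ge⟩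
  have hQ1 := (L.contDiff_Q₁ κ₁ κ₂).continuous
  have hQ2 := (L.contDiff_Q₂ κ₁ κ₂).continuous
  set O₁ := {z : ℝ × ℝ | z.1 ∈ B ∧ z.2 ^ 2 = L.Q₁ κ₁ κ₂ z.1} with hO₁
  set O₂ := (fun t => (t, √(L.Q₂ κ₁ κ₂ t))) '' Icc 0 L.ω₂ with hO₂
  refine hκ.isLiouvilleTorus hL continuous_sepB (hκ.sepB_ne_zero h) (K := rearrange '' (O₁ ×ˢ O₂))
    ?_ ?_ ?_ ?_
  · exact ((isCompact_oval hBc hQ1 hB0).prod (isCompact_graph isCompact_Icc hQ2.sqrt)).image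
      continuous_rearrange
  · exact ((isPreconnected_oval hBp hQ1 hB0 hrB (by rw [Q₁, hr0]; ring)).prod
      (isPreconnected_Icc.image _ (by fun_prop))).image _ continuous_rearrange.continuousOn
  · exact ⟨_, ((r, 0), (0, √(L.Q₂ κ₁ κ₂ 0))), ⟨⟨hrB, by simp [Q₁, hr0]⟩,
      ⟨0, ⟨le_rfl, L.ω₂_pos.le⟩, rfl⟩⟩, rfl⟩
  · ext ξ
    constructor
    · rintro ⟨_, ⟨⟨⟨b, p⟩, _⟩, ⟨⟨hb, hp⟩, ⟨t, ht, rfl⟩⟩, rfl⟩, rfl⟩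
      simp only at hb hp
      refine ⟨(hκ.cov_mem_level _).2 ⟨hp, Real.sq_sqrt (hκ.Q₂_pos h t).le⟩, ?_⟩
      rw [sepB_cov]
      refine mul_pos (Real.sqrt_pos.2 (hκ.Q₂_pos h t)) (sin_pos_of_band ?_)
      simp only [rearrange]
      refine ⟨lt_of_le_of_ne hb.1.1 ?_, lt_of_le_of_ne hb.1.2 ?_⟩
      · rintro rfl
        have := hb.2
        rw [φ₁_zero] at this
        linarith
      · rintro rfl
        have := hb.2
        rw [(L.φ₁_eq_min _).2 ⟨1, by norm_num⟩] at this
        linarith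
    · intro hξ
      obtain ⟨x, rfl⟩ := cov_surjective ξ
      obtain ⟨σ, a, b, hd, -, hp, h1, h2⟩ := exists_deck_B hξ
      have hξ' := (hd.mem_iff x _).2 hξ
      obtain ⟨e1, e2⟩ := (hκ.cov_mem_level _).1 hξ'.1
      simp only [deck] at e1 e2
      rw [← hd.cov_eq]
      refine ⟨_, ⟨((σ * x.1 + a, σ * x.2.2.1), (σ * x.2.1 + b, σ * x.2.2.2)),
        ⟨⟨⟨⟨h2.1.le, h2.2.le⟩, ?_⟩, e1⟩, ⟨_, ⟨h1.1, h1.2.le⟩, ?_⟩⟩, rfl⟩, rfl⟩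
      · exact (hκ.Q₁_nonneg_iff _).1 (by rw [← e1]; positivity)
      · simp only
        rw [← e2, Real.sqrt_sq hp.le]

end LiouvilleTable

/-! ### The two angle charts -/

namespace LiouvilleTable

variable {L : LiouvilleTable} {κ₁ κ₂ : ℝ}

theorem cos_pos_of_libDomain {t : ℝ} (h : t ∈ libDomain 0 L.ω₂) :
    0 < Real.cos (2 * Real.pi * t / L.ω₂) := by
  have hw := L.ω₂_pos.ne'
  rcases h with h | h
  · exact cos_pos_of_band (by simpa using h)
  · have h' : t - L.ω₂ ∈ Ioo (-(L.ω₂ / 4)) (L.ω₂ / 4) :=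
      ⟨by linarith [h.1], by linarith [h.2]⟩
    have := cos_pos_of_band h'
    rwa [show 2 * Real.pi * (t - L.ω₂) / L.ω₂ = 2 * Real.pi * t / L.ω₂ - 2 * Real.pi by
      field_simp, Real.cos_sub_two_pi] at this

theorem sin_pos_of_libDomain {t : ℝ} (h : t ∈ libDomain (L.ω₁ / 4) L.ω₁) :
    0 < Real.sin (2 * Real.pi * t / L.ω₁) := by
  have hw := L.ω₁_pos.ne'
  rcases h with h | h
  · exact sin_pos_of_band ⟨by linarith [h.1], by linarith [h.2]⟩
  · have h' : t - L.ω₁ ∈ Ioo 0 (L.ω₁ / 2) := ⟨by linarith [h.1], by linarith [h.2]⟩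
    have := sin_pos_of_band h'
    rwa [show 2 * Real.pi * (t - L.ω₁) / L.ω₁ = 2 * Real.pi * t / L.ω₁ - 2 * Real.pi by
      field_simp, Real.sin_sub_two_pi] at this

theorem IsParam.graph_mem_level (hκ : L.IsParam κ₁ κ₂) {s₁ s₂ : ℝ → ℝ} {v : ℝ × ℝ}
    (h₁ : s₁ v.1 = 1 ∨ s₁ v.1 = -1) (h₂ : s₂ v.2 = 1 ∨ s₂ v.2 = -1)
    (hQ₁ : 0 ≤ L.Q₁ κ₁ κ₂ v.1) (hQ₂ : 0 ≤ L.Q₂ κ₁ κ₂ v.2) :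
    L.cov (L.graph κ₁ κ₂ s₁ s₂ v) ∈ L.level κ₁ κ₂ := by
  refine (hκ.cov_mem_level _).2 ⟨?_, ?_⟩
  · simp only [graph, mul_pow, Real.sq_sqrt hQ₁]
    rcases h₁ with h | h <;> rw [h] <;> ring
  · simp only [graph, mul_pow, Real.sq_sqrt hQ₂]
    rcases h₂ with h | h <;> rw [h] <;> ring

theorem Ioo_inj {T s t : ℝ} {k : ℤ} (hT : 0 < T) (hs : s ∈ Ioo 0 T) (ht : t ∈ Ioo 0 T)
    (hk : t = s + k * T) : s = t := by
  suffices k = 0 by rw [hk, this]; simp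
  refine int_eq_zero_of_abs_mul_lt hT ?_
  have e : k * T = t - s := by linarith
  rw [e, abs_lt]
  constructor <;> linarith [hs.1, hs.2, ht.1, ht.2]

/-- The chart of the torus with `κ₂ < ν₁`. -/
noncomputable def chartA (hκ : L.IsParam κ₁ κ₂) (h : κ₂ < L.ν₁) :
    L.TorusChart κ₁ κ₂ (L.torusA κ₁ κ₂) where
  I₁ := Ioo 0 L.ω₁
  I₂ := libDomain 0 L.ω₂ ∩ {t | 0 < L.Q₂ κ₁ κ₂ t}
  s₁ := fun _ => 1
  s₂ := libSign 0 L.ω₂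
  exc₁ := range fun k : ℤ => (k : ℝ) * L.ω₁
  exc₂ := ∅
  subset_level := fun _ hξ => hξ.1
  isOpen₁ := isOpen_Ioo
  isOpen₂ := (isOpen_libDomain _ _).inter
    (isOpen_lt continuous_const (L.contDiff_Q₂ κ₁ κ₂).continuous)
  sign₁ := fun _ _ => Or.inl rfl
  sign₂ := fun t _ => libSign_eq _ _ t
  const₁ := fun _ _ => .of_forall fun _ => rfl
  const₂ := fun _ ht => libSign_const L.ω₂_pos ht.1
  pos₁ := fun t _ => hκ.Q₁_pos h t
  pos₂ := fun _ ht => ht.2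
  mapsTo := by
    intro v hv
    refine ⟨hκ.graph_mem_level (Or.inl rfl) (libSign_eq _ _ _) (hκ.Q₁_pos h _).le hv.2.2.le, ?_⟩
    rw [sepA_cov]
    refine mul_pos ?_ (cos_pos_of_libDomain hv.2.1)
    simpa [graph] using hκ.Q₁_pos h v.1
  injOn := by
    intro v hv w hw he
    have hv1 := Real.sqrt_pos.2 (hκ.Q₁_pos h v.1)
    have hw1 := Real.sqrt_pos.2 (hκ.Q₁_pos h w.1)
    rcases cov_eq_cov he with ⟨k, l, hkl⟩ | ⟨k, l, hkl⟩
    · simp only [graph, Prod.mk.injEq] at hkl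
      obtain ⟨e1, e2, e3, e4⟩ := hkl
      exact Prod.ext (Ioo_inj L.ω₁_pos hv.1 hw.1 e1) (libDomain_inj L.ω₂_pos hv.2.1 hw.2.1 e2
        (Real.sqrt_pos.2 hv.2.2) (Real.sqrt_pos.2 hw.2.2) e4.symm)
    -- The involution would reverse `p₁`, which is positive at both points.
    · simp only [graph, Prod.mk.injEq] at hkl
      linarith [hkl.2.2.1]
  countable₁ := countable_range _
  countable₂ := countable_empty
  cover := by
    intro x hx hp1 hp2 hx1 hx2
    obtain ⟨σ, a, b, hd, ⟨k, rfl⟩, hp, h1, h2⟩ := exists_deck_A hx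
    have hσ : σ ≠ 0 := by rintro rfl; simp at hp
    obtain ⟨e1, e2⟩ := (hκ.cov_mem_level _).1 ((hd.mem_iff x _).2 hx).1
    simp only [deck] at e1 e2
    -- A translation of `θ₂` by a full period encodes a negative sign of `p₂`.
    obtain ⟨l, hl, hl'⟩ := libDomain_cover (c := 0) L.ω₂_pos (by simpa using h2)
      (mul_ne_zero hσ hp2) e2
    have hd' := hd.add 0 l
    refine ⟨σ, _, _, hd', ⟨⟨?_, ?_⟩, ?_, ?_⟩, ?_⟩
    · simp only [Int.cast_zero, zero_mul, add_zero]
      refine lt_of_le_of_ne h1.1 fun h0 => hx1 ?_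
      rcases hd.sign with hs | hs
      · exact ⟨-k, by simp only [hs] at h0; push_cast; linarith⟩
      · exact ⟨k, by simp only [hs] at h0; linarith⟩
    · simpa using h1.2
    · simp only
      rw [← add_assoc]; exact hl
    · change 0 < L.Q₂ κ₁ κ₂ _
      rw [Q₂, hd'.φ₂_eq, ← Q₂, ← ((hκ.cov_mem_level _).1 hx.1).2]
      positivity
    · refine Prod.ext rfl (Prod.ext rfl (Prod.ext ?_ ?_))
      · simp only [deck, graph, Int.cast_zero, zero_mul, add_zero, one_mul]
        rw [← e1, Real.sqrt_sq hp.le]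
      · simp only [deck, graph]
        rw [hl', ← add_assoc]
        congr 2
        rw [Q₂, Q₂, hd.φ₂_eq, add_assoc, hd'.φ₂_eq]

/-- The chart of the torus with `ν₁ < κ₂`. -/
noncomputable def chartB (hκ : L.IsParam κ₁ κ₂) (h : L.ν₁ < κ₂) :
    L.TorusChart κ₁ κ₂ (L.torusB κ₁ κ₂) where
  I₁ := libDomain (L.ω₁ / 4) L.ω₁ ∩ {t | 0 < L.Q₁ κ₁ κ₂ t}
  I₂ := Ioo 0 L.ω₂
  s₁ := libSign (L.ω₁ / 4) L.ω₁
  s₂ := fun _ => 1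
  exc₁ := ∅
  exc₂ := range fun k : ℤ => (k : ℝ) * (L.ω₂ / 2)
  subset_level := fun _ hξ => hξ.1
  isOpen₁ := (isOpen_libDomain _ _).inter
    (isOpen_lt continuous_const (L.contDiff_Q₁ κ₁ κ₂).continuous)
  isOpen₂ := isOpen_Ioo
  sign₁ := fun t _ => libSign_eq _ _ t
  sign₂ := fun _ _ => Or.inl rfl
  const₁ := fun _ ht => libSign_const L.ω₁_pos ht.1
  const₂ := fun _ _ => .of_forall fun _ => rfl
  pos₁ := fun _ ht => ht.2
  pos₂ := fun t _ => hκ.Q₂_pos h t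
  mapsTo := by
    intro v hv
    refine ⟨hκ.graph_mem_level (libSign_eq _ _ _) (Or.inl rfl) hv.1.2.le (hκ.Q₂_pos h _).le, ?_⟩
    rw [sepB_cov]
    refine mul_pos ?_ (sin_pos_of_libDomain hv.1.1)
    simpa [graph] using hκ.Q₂_pos h v.2
  injOn := by
    intro v hv w hw he
    have hv1 := Real.sqrt_pos.2 (hκ.Q₂_pos h v.2)
    have hw1 := Real.sqrt_pos.2 (hκ.Q₂_pos h w.2)
    rcases cov_eq_cov he with ⟨k, l, hkl⟩ | ⟨k, l, hkl⟩
    · simp only [graph, Prod.mk.injEq] at hkl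
      obtain ⟨e1, e2, e3, e4⟩ := hkl
      exact Prod.ext (libDomain_inj L.ω₁_pos hv.1.1 hw.1.1 e1
        (Real.sqrt_pos.2 hv.1.2) (Real.sqrt_pos.2 hw.1.2) e3.symm)
        (Ioo_inj L.ω₂_pos hv.2 hw.2 e2)
    · simp only [graph, Prod.mk.injEq] at hkl
      linarith [hkl.2.2.2]
  countable₁ := countable_empty
  countable₂ := countable_range _
  cover := by
    intro x hx hp1 hp2 hx1 hx2
    obtain ⟨σ, a, b, hd, ⟨k, rfl⟩, hp, h1, h2⟩ := exists_deck_B hx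
    have hσ : σ ≠ 0 := by rintro rfl; simp at hp
    obtain ⟨e1, e2⟩ := (hκ.cov_mem_level _).1 ((hd.mem_iff x _).2 hx).1
    simp only [deck] at e1 e2
    obtain ⟨l, hl, hl'⟩ := libDomain_cover (c := L.ω₁ / 4) (t := σ * x.1 + a)
      L.ω₁_pos ⟨by linarith [h2.1], by linarith [h2.2]⟩ (mul_ne_zero hσ hp1) e1
    have hd' := hd.add l 0
    refine ⟨σ, _, _, hd', ⟨⟨?_, ?_⟩, ?_, ?_⟩, ?_⟩
    · simp only
      rw [← add_assoc]; exact hl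
    · change 0 < L.Q₁ κ₁ κ₂ _
      rw [Q₁, hd'.φ₁_eq, ← Q₁, ← ((hκ.cov_mem_level _).1 hx.1).1]
      positivity
    · simp only [Int.cast_zero, zero_mul, add_zero]
      refine lt_of_le_of_ne h1.1 fun h0 => hx2 ?_
      rcases hd.sign with hs | hs
      · exact ⟨-k, by simp only [hs] at h0; push_cast; linarith⟩
      · exact ⟨k, by simp only [hs] at h0; linarith⟩
    · simpa using h1.2
    · refine Prod.ext rfl (Prod.ext rfl (Prod.ext ?_ ?_))
      · simp only [deck, graph]
        rw [hl', ← add_assoc]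
        congr 2
        rw [Q₁, Q₁, hd.φ₁_eq, add_assoc, hd'.φ₁_eq]
      · simp only [deck, graph, Int.cast_zero, zero_mul, add_zero, one_mul]
        rw [← e2, Real.sqrt_sq hp.le]

end LiouvilleTable

/-! ### Folding the line onto a quarter period -/

/-- The retraction of `ℝ` to `[0, T / 4]` which identifies `t`, `-t` and `T / 2 - t`. -/
noncomputable def fold (T t : ℝ) : ℝ := |t - round (t / (T / 2)) * (T / 2)|

theorem measurable_fold (T : ℝ) : Measurable (fold T) := by
  unfold fold
  have : Measurable fun t : ℝ => round (t / (T / 2)) := by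
    simp only [round_eq]
    exact Int.measurable_floor.comp (by fun_prop)
  have h2 : Measurable fun t : ℝ => ((round (t / (T / 2)) : ℤ) : ℝ) :=
    (measurable_of_countable (fun n : ℤ => (n : ℝ))).comp this
  have h3 : Measurable fun t : ℝ => t - (round (t / (T / 2)) : ℝ) * (T / 2) := by fun_prop
  exact h3.abs

theorem apply_fold {α : Type*} {g : ℝ → α} {T : ℝ} (h1 : ∀ t, g (-t) = g t)
    (h2 : ∀ t, g (T / 2 - t) = g t) (t : ℝ) : g (fold T t) = g t := by
  have hp : Function.Periodic g (T / 2) := by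
    intro t
    rw [← h1 t, ← h2 (-t)]; congr 1; ring
  have key : ∀ u, g |u| = g u := fun u => by
    rcases abs_choice u with e | e <;> rw [e]
    exact h1 u
  rw [fold, key, hp.sub_int_mul_eq]

theorem fold_eq {T σ s : ℝ} (hσ : σ = 1 ∨ σ = -1) (m : ℤ) (hs : s ∈ Ioo 0 (T / 4)) :
    fold T (σ * s + m * (T / 2)) = s := by
  have hT : 0 < T := by linarith [hs.1, hs.2]
  have hT2 : T / 2 ≠ 0 := by linarith
  have h0 : round (σ * s / (T / 2)) = 0 := by
    rw [round_eq_zero_iff]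
    have h1 : s / (T / 2) < 1 / 2 := by rw [div_lt_iff₀ (by linarith)]; linarith [hs.2]
    have h2 : 0 < s / (T / 2) := div_pos hs.1 (by linarith)
    rcases hσ with rfl | rfl
    · rw [one_mul]; constructor <;> linarith
    · rw [neg_one_mul, neg_div]; constructor <;> linarith
  have h1 : round ((σ * s + m * (T / 2)) / (T / 2)) = m := by
    rw [add_div, mul_div_cancel_right₀ _ hT2, round_add_intCast, h0, zero_add]
  rw [fold, h1, add_sub_cancel_right, abs_mul, abs_of_pos hs.1]
  rcases hσ with rfl | rfl <;> simp

/-- On each quarter branch `fold` inverts a reflection or translation of the line, and these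
preserve Lebesgue measure. -/
theorem map_fold_of_preimage {T σ : ℝ} (hσ : σ = 1 ∨ σ = -1) (m : ℤ) {S : Set ℝ}
    (hS : MeasurableSet S) (h : (fun s => σ * s + m * (T / 2)) ⁻¹' S = Ioo 0 (T / 4)) :
    Measure.map (fold T) (volume.restrict S) = volume.restrict (Ioo 0 (T / 4)) := by
  have hmp : MeasurePreserving (fun s => σ * s + m * (T / 2)) volume volume := by
    have h2 : MeasurePreserving (fun s => s + m * (T / 2)) (volume : Measure ℝ) volume :=
      measurePreserving_add_right _ _
    rcases hσ with rfl | rfl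
    · simpa using h2
    · simp only [neg_one_mul]
      exact h2.comp (Measure.measurePreserving_neg volume)
  rw [← (hmp.restrict_preimage hS).map_eq, h,
    Measure.map_map (measurable_fold T) hmp.measurable]
  conv_rhs => rw [← Measure.map_id (μ := volume.restrict (Ioo 0 (T / 4)))]
  refine Measure.map_congr ?_
  filter_upwards [ae_restrict_mem measurableSet_Ioo] with s hs
  exact fold_eq hσ m hs

theorem map_fold_right {T : ℝ} (m : ℤ) :
    Measure.map (fold T) (volume.restrict (Ioo (m * (T / 2)) (m * (T / 2) + T / 4)))
      = volume.restrict (Ioo 0 (T / 4)) := by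
  refine map_fold_of_preimage (Or.inl rfl) m measurableSet_Ioo ?_
  ext s
  simp only [mem_preimage, mem_Ioo]
  constructor <;> rintro ⟨h1, h2⟩ <;> constructor <;> linarith

theorem map_fold_left {T : ℝ} (m : ℤ) :
    Measure.map (fold T) (volume.restrict (Ioo (m * (T / 2) - T / 4) (m * (T / 2))))
      = volume.restrict (Ioo 0 (T / 4)) := by
  refine map_fold_of_preimage (Or.inr rfl) m measurableSet_Ioo ?_
  ext s
  simp only [mem_preimage, mem_Ioo]
  constructor <;> rintro ⟨h1, h2⟩ <;> constructor <;> linarith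

theorem restrict_Ioo_add {a b c : ℝ} (h1 : a ≤ b) (h2 : b ≤ c) :
    (volume : Measure ℝ).restrict (Ioo a c)
      = volume.restrict (Ioo a b) + volume.restrict (Ioo b c) := by
  rw [restrict_Ioo_eq_restrict_Ioc, restrict_Ioo_eq_restrict_Ioc, restrict_Ioo_eq_restrict_Ioc,
    ← Ioc_union_Ioc_eq_Ioc h1 h2, Measure.restrict_union (Ioc_disjoint_Ioc_of_le le_rfl)
      measurableSet_Ioc]

/-- The set `J` covers a quarter period four times. -/
def FoldsTo (T : ℝ) (J : Set ℝ) : Prop :=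
  Measure.map (fold T) (volume.restrict J) = (4 : ENNReal) • volume.restrict (Ioo 0 (T / 4))

theorem map_fold_mid {T : ℝ} (hT : 0 < T) (m : ℤ) :
    Measure.map (fold T) (volume.restrict (Ioo (m * (T / 2) - T / 4) (m * (T / 2) + T / 4)))
      = (2 : ENNReal) • volume.restrict (Ioo 0 (T / 4)) := by
  rw [restrict_Ioo_add (b := m * (T / 2)) (by linarith) (by linarith),
    Measure.map_add _ _ (measurable_fold T), map_fold_left, map_fold_right, two_smul]

theorem map_fold_period {T : ℝ} (hT : 0 < T) (m : ℤ) :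
    Measure.map (fold T) (volume.restrict (Ioo (m * (T / 2)) ((m + 1) * (T / 2))))
      = (2 : ENNReal) • volume.restrict (Ioo 0 (T / 4)) := by
  have h := map_fold_left (T := T) (m + 1)
  push_cast at h
  rw [show ((m : ℝ) + 1) * (T / 2) - T / 4 = m * (T / 2) + T / 4 by ring] at h
  rw [restrict_Ioo_add (b := m * (T / 2) + T / 4) (by linarith) (by linarith),
    Measure.map_add _ _ (measurable_fold T), map_fold_right, h, two_smul]

theorem four_smul' (ρ : Measure ℝ) :
    (2 : ENNReal) • ρ + (2 : ENNReal) • ρ = (4 : ENNReal) • ρ := by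
  rw [← add_smul]; norm_num

theorem foldsTo_Ioo {T : ℝ} (hT : 0 < T) : FoldsTo T (Ioo 0 T) := by
  have h0 := map_fold_period hT 0
  have h1 := map_fold_period hT 1
  norm_num at h0 h1
  rw [FoldsTo, restrict_Ioo_add (b := T / 2) (by linarith) (by linarith),
    Measure.map_add _ _ (measurable_fold T), h0, ← four_smul', ← h1]
  congr 3
  ring_nf

theorem map_fold_libDomain {c T : ℝ} (hT : 0 < T) :
    Measure.map (fold T) (volume.restrict (libDomain c T))
      = Measure.map (fold T) (volume.restrict (Ioo (c - T / 4) (c + T / 4)))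
        + Measure.map (fold T) (volume.restrict (Ioo (c + 3 * T / 4) (c + 5 * T / 4))) := by
  rw [libDomain, Measure.restrict_union _ measurableSet_Ioo,
    Measure.map_add _ _ (measurable_fold T)]
  rw [Set.disjoint_left]
  intro t h1 h2
  linarith [h1.2, h2.1]

theorem foldsTo_libDomain_zero {T : ℝ} (hT : 0 < T) : FoldsTo T (libDomain 0 T) := by
  have h0 := map_fold_mid hT 0
  have h1 := map_fold_mid hT 2
  push_cast at h0 h1
  rw [FoldsTo, map_fold_libDomain hT, ← four_smul']
  conv_rhs => rw [← h0]
  congr 1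
  · congr 3 <;> ring
  · rw [h0, ← h1]
    congr 3 <;> ring

theorem foldsTo_libDomain_quarter {T : ℝ} (hT : 0 < T) : FoldsTo T (libDomain (T / 4) T) := by
  have h0 := map_fold_period hT 0
  have h1 := map_fold_period hT 2
  push_cast at h0 h1
  rw [FoldsTo, map_fold_libDomain hT, ← four_smul']
  conv_rhs => rw [← h0]
  congr 1
  · congr 3 <;> ring
  · rw [h0, ← h1]
    congr 3 <;> ring

theorem map_fold_prod {T₁ T₂ : ℝ} {J₁ J₂ : Set ℝ} (h1 : FoldsTo T₁ J₁) (h2 : FoldsTo T₂ J₂) :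
    Measure.map (Prod.map (fold T₁) (fold T₂)) (volume.restrict (J₁ ×ˢ J₂))
      = (16 : ENNReal) • volume.restrict (Ioo 0 (T₁ / 4) ×ˢ Ioo 0 (T₂ / 4)) := by
  rw [Measure.volume_eq_prod, ← Measure.prod_restrict, ← Measure.prod_restrict,
    ← Measure.map_prod_map _ _ (measurable_fold _) (measurable_fold _), h1, h2,
    Measure.prod_smul_left, Measure.prod_smul_right, smul_smul]
  norm_num

/-- A symmetric integrand takes the same values on all branches; each angle domain contributes four
of them, whence `16 = 4 · 4`. -/
theorem setIntegral_fold {T₁ T₂ : ℝ} {J₁ J₂ : Set ℝ} (h1 : FoldsTo T₁ J₁) (h2 : FoldsTo T₂ J₂)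
    {g : ℝ × ℝ → ℝ} (hg : Measurable g) (hs : ∀ v, g (Prod.map (fold T₁) (fold T₂) v) = g v) :
    ∫ v in J₁ ×ˢ J₂, g v = 16 * ∫ v in Ioo 0 (T₁ / 4) ×ˢ Ioo 0 (T₂ / 4), g v := by
  have hm := (measurable_fold T₁).prodMap (measurable_fold T₂)
  have := integral_map (μ := volume.restrict (J₁ ×ˢ J₂)) hm.aemeasurable
    (hg.aestronglyMeasurable (μ := Measure.map (Prod.map (fold T₁) (fold T₂))
      (volume.restrict (J₁ ×ˢ J₂))))
  simp only [hs] at this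
  rw [← this, map_fold_prod h1 h2, integral_smul_measure]
  simp

theorem setLIntegral_fold {T₁ T₂ : ℝ} {J₁ J₂ : Set ℝ} (h1 : FoldsTo T₁ J₁) (h2 : FoldsTo T₂ J₂)
    {g : ℝ × ℝ → ENNReal} (hg : Measurable g)
    (hs : ∀ v, g (Prod.map (fold T₁) (fold T₂) v) = g v) :
    ∫⁻ v in J₁ ×ˢ J₂, g v = 16 * ∫⁻ v in Ioo 0 (T₁ / 4) ×ˢ Ioo 0 (T₂ / 4), g v := by
  have hm := (measurable_fold T₁).prodMap (measurable_fold T₂)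
  have := lintegral_map (μ := volume.restrict (J₁ ×ˢ J₂)) hg hm
  simp only [hs] at this
  rw [← this, map_fold_prod h1 h2, lintegral_smul_measure, smul_eq_mul]

/-! ### Reduction of torus integrals to a quarter period -/

namespace LiouvilleTable

variable {L : LiouvilleTable} {κ₁ κ₂ : ℝ} {Λ : Set L.CotΓ}

theorem IsClassical.φ₁_fold (hL : L.IsClassical) (t : ℝ) : L.φ₁ (fold L.ω₁ t) = L.φ₁ t :=
  apply_fold L.even₁ hL.symm₁ t

theorem φ₂_fold (t : ℝ) : L.φ₂ (fold L.ω₂ t) = L.φ₂ t :=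
  apply_fold L.even₂ L.symm₂ t

namespace TorusChart

theorem density_fold (hL : L.IsClassical) (v : ℝ × ℝ) :
    density L κ₁ κ₂ (Prod.map (fold L.ω₁) (fold L.ω₂) v) = density L κ₁ κ₂ v := by
  simp only [density, Prod.map, hL.φ₁_fold, φ₂_fold]

/-- Roots of non-positive numbers and division by zero give `0`, so the density may be integrated
over the full angle domains, which do not depend on `κ₁`, `κ₂`. -/
theorem density_eq_zero {v : ℝ × ℝ} (h : ¬(0 < L.Q₁ κ₁ κ₂ v.1 ∧ 0 < L.Q₂ κ₁ κ₂ v.2)) :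
    density L κ₁ κ₂ v = 0 := by
  rw [density, LegendreMoment.kernel]
  rcases not_and_or.1 h with h | h
  · have : √((L.φ₁ v.1 - κ₁) * (L.φ₁ v.1 - κ₂)) = 0 := Real.sqrt_eq_zero_of_nonpos (not_lt.1 h)
    rw [this]; simp
  · have : √((L.φ₂ v.2 - κ₁) * (κ₂ - L.φ₂ v.2)) = 0 := Real.sqrt_eq_zero_of_nonpos (not_lt.1 h)
    rw [this]; simp

variable (c : L.TorusChart κ₁ κ₂ Λ)

theorem setIntegral_leray (hκ : L.IsParam κ₁ κ₂) (hL : L.IsClassical) (hΛ : MeasurableSet Λ)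
    {f : L.CotΓ → ℝ} (hf : Measurable f) :
    ∫ ξ in Λ, f ξ ∂(L.lerayMeasure Λ) = ∫ v in c.V, density L κ₁ κ₂ v * f (L.cov (c.ψ v)) := by
  have hm := aemeasurable_cov c.isLocalParam fun v => ENNReal.ofReal (density L κ₁ κ₂ v)
  rw [c.lerayMeasure_eq hκ hL, measure, setIntegral_map hΛ hf.aestronglyMeasurable hm,
    Measure.restrict_eq_self_of_ae_mem, integral_withDensity_eq_integral_toReal_smul]
  · simp only [ENNReal.toReal_ofReal (density_nonneg _), smul_eq_mul]
  · exact measurable_density.ennreal_ofReal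
  · exact .of_forall fun _ => ENNReal.ofReal_lt_top
  · refine withDensity_absolutelyContinuous _ _ ?_
    filter_upwards [ae_restrict_mem c.isOpen_V.measurableSet] with v hv
    exact c.mapsTo hv

theorem leray_apply_le (hκ : L.IsParam κ₁ κ₂) (hL : L.IsClassical) :
    L.lerayMeasure Λ Λ ≤ ∫⁻ v in c.V, ENNReal.ofReal (density L κ₁ κ₂ v) := by
  have hm := aemeasurable_cov c.isLocalParam fun v => ENNReal.ofReal (density L κ₁ κ₂ v)
  refine (measure_mono (subset_univ _)).trans ?_
  rw [c.lerayMeasure_eq hκ hL, measure, Measure.map_apply_of_aemeasurable hm MeasurableSet.univ,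
    preimage_univ, withDensity_apply _ MeasurableSet.univ, Measure.restrict_univ]

/-- If a mean value over a torus vanishes, so does an integral over a quarter of a period in both
angles. -/
theorem integral_eq_zero (hκ : L.IsParam κ₁ κ₂) (hL : L.IsClassical) (hΛ : MeasurableSet Λ)
    {J₁ J₂ : Set ℝ} (h₁ : FoldsTo L.ω₁ J₁) (h₂ : FoldsTo L.ω₂ J₂)
    (hJ : MeasurableSet (J₁ ×ˢ J₂))
    (hV : c.V = (J₁ ×ˢ J₂) ∩ {v | 0 < L.Q₁ κ₁ κ₂ v.1 ∧ 0 < L.Q₂ κ₁ κ₂ v.2})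
    {f : L.CotΓ → ℝ} (hf : Measurable f) {g : ℝ × ℝ → ℝ} (hg : Measurable g)
    (hs : ∀ v, g (Prod.map (fold L.ω₁) (fold L.ω₂) v) = g v) {C : ℝ} (hC : C ≠ 0)
    (hfg : ∀ v ∈ c.V, f (L.cov (c.ψ v)) = C * g v)
    (hint : IntegrableOn (density L κ₁ κ₂) (Ioo 0 (L.ω₁ / 4) ×ˢ Ioo 0 (L.ω₂ / 4)))
    (h0 : ((L.lerayMeasure Λ).real Λ)⁻¹ * ∫ ξ in Λ, f ξ ∂(L.lerayMeasure Λ) = 0) :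
    ∫ v in Ioo 0 (L.ω₁ / 4) ×ˢ Ioo 0 (L.ω₂ / 4), density L κ₁ κ₂ v * g v = 0 := by
  -- An infinite total mass would make the normalizing factor `0` by convention and the hypothesis
  -- empty; integrability of the density excludes this.
  have hfin : L.lerayMeasure Λ Λ ≠ ⊤ := by
    refine ne_top_of_le_ne_top ?_ ((c.leray_apply_le hκ hL).trans
      (lintegral_mono_set (hV ▸ inter_subset_left)))
    rw [setLIntegral_fold h₁ h₂ measurable_density.ennreal_ofReal
      fun v => by rw [density_fold hL]]
    refine ENNReal.mul_ne_top (by norm_num) ?_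
    have := hint.hasFiniteIntegral
    rw [hasFiniteIntegral_iff_ofReal (.of_forall density_nonneg)] at this
    exact this.ne
  have hzero : ∫ ξ in Λ, f ξ ∂(L.lerayMeasure Λ) = 0 := by
    rcases mul_eq_zero.1 h0 with h | h
    · rw [inv_eq_zero, measureReal_eq_zero_iff hfin] at h
      rw [Measure.restrict_eq_zero.2 h, integral_zero_measure]
    · exact h
  rw [c.setIntegral_leray hκ hL hΛ hf] at hzero
  have e1 : ∫ v in c.V, density L κ₁ κ₂ v * f (L.cov (c.ψ v))
      = C * ∫ v in c.V, density L κ₁ κ₂ v * g v := by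
    rw [← integral_const_mul]
    refine setIntegral_congr_fun c.isOpen_V.measurableSet fun v hv => ?_
    simp only [hfg v hv]
    ring
  have e2 : ∫ v in J₁ ×ˢ J₂, density L κ₁ κ₂ v * g v = ∫ v in c.V, density L κ₁ κ₂ v * g v := by
    refine setIntegral_eq_of_subset_of_forall_sdiff_eq_zero hJ (hV ▸ inter_subset_left) ?_
    intro v hv
    rw [density_eq_zero, zero_mul]
    intro h
    exact hv.2 (hV ▸ ⟨hv.1, h⟩)
  rw [e1, ← e2, setIntegral_fold (g := fun v => density L κ₁ κ₂ v * g v) h₁ h₂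
    (measurable_density.mul hg) fun v => by rw [density_fold hL, hs]] at hzero
  rcases mul_eq_zero.1 hzero with h | h
  · exact absurd h hC
  · exact (mul_eq_zero.1 h).resolve_left (by norm_num)

end TorusChart
end LiouvilleTable

/-! ### Symmetry in the angles and the two densities -/

namespace LiouvilleTable

variable {L : LiouvilleTable} {κ₁ κ₂ : ℝ}

theorem continuous_πΓ : Continuous L.πΓ := by
  refine Continuous.quotient_lift ?_ _
  refine Continuous.subtype_mk ?_ _
  refine continuous_quotient_mk'.comp ?_
  unfold base
  fun_prop

theorem measurable_pairT : Measurable L.pairT := by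
  have h1 : Measurable fun ξ : L.CotTorus => L.f₁ ξ.1 :=
    (L.continuous_f₁.comp continuous_fst).measurable
  have h2 : Measurable fun ξ : L.CotTorus => L.f₂ ξ.2.1 :=
    (L.continuous_f₂.comp (continuous_fst.comp continuous_snd)).measurable
  have h3 : Measurable fun ξ : L.CotTorus => L.g₃ (L.base ξ) := by
    simp only [g₃_base]; fun_prop
  have h4 : Measurable L.normSqT := by
    have : L.normSqT = fun ξ => _ := funext L.normSqT_eq
    rw [this]
    fun_prop
  unfold pairT p₃T
  fun_prop

theorem measurable_normalDensity : Measurable L.normalDensity :=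
  measurable_from_quotient.2 measurable_pairT.inv

/-- The values of a function on the boundary in the angles. -/
noncomputable def angleValue (K : C(L.Γ, ℝ)) (v : ℝ × ℝ) : ℝ := K (L.πΓ (L.cov (v.1, v.2, 0, 0)))

theorem continuous_angleValue (K : C(L.Γ, ℝ)) : Continuous (angleValue K) :=
  K.continuous.comp (continuous_πΓ.comp (L.continuous_cov.comp (by fun_prop)))

section symmetry

variable {K : C(L.Γ, ℝ)} (hK : L.IsGInvariant K)
include hK

theorem angleValue_neg₁ (s t : ℝ) : angleValue K (-s, t) = angleValue K (s, t) :=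
  hK _ (Subgroup.subset_closure (Or.inl rfl)) _ _ rfl

theorem angleValue_sub₁ (s t : ℝ) : angleValue K (L.ω₁ / 2 - s, t) = angleValue K (s, t) :=
  hK _ (Subgroup.subset_closure (Or.inr (Or.inl rfl))) _ _ rfl

theorem angleValue_neg₂ (s t : ℝ) : angleValue K (s, -t) = angleValue K (s, t) :=
  hK _ (Subgroup.subset_closure (Or.inr (Or.inr rfl))) _ _ rfl

/-- This reflection is not one of the generators of `G(X)`: it comes from the identification of
points by `σ₁`, combined with evenness in `θ₁`. -/
theorem angleValue_sub₂ (s t : ℝ) : angleValue K (s, L.ω₂ / 2 - t) = angleValue K (s, t) := by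
  rw [← angleValue_neg₁ hK s t]
  have h := ((isDeck_neg (L := L) 0 0).cov_eq (-s, t, 0, 0))
  simp only [deck] at h
  norm_num at h
  rw [angleValue, angleValue, ← h]
  congr 4
  ext <;> simp
  ring

theorem angleValue_fold (v : ℝ × ℝ) :
    angleValue K (Prod.map (fold L.ω₁) (fold L.ω₂) v) = angleValue K v := by
  obtain ⟨s, t⟩ := v
  simp only [Prod.map]
  rw [apply_fold (g := fun s => angleValue K (s, fold L.ω₂ t)) (fun s => angleValue_neg₁ hK s _)
    (fun s => angleValue_sub₁ hK s _)]
  exact apply_fold (g := fun t => angleValue K (s, t)) (fun t => angleValue_neg₂ hK s t)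
    (fun t => angleValue_sub₂ hK s t) t

end symmetry

/-- The function which represents `⟨π⁺(ξ), n_g⟩⁻¹` in the angles, up to a constant. -/
noncomputable def normalWeight (L : LiouvilleTable) (v : ℝ × ℝ) : ℝ :=
  √((L.φ₁ v.1 - L.ν₃) * (L.φ₂ v.2 - L.ν₃))

theorem continuous_normalWeight : Continuous L.normalWeight := by
  have h1 : Continuous L.φ₁ := L.smooth₁.continuous
  have h2 : Continuous L.φ₂ := L.smooth₂.continuous
  unfold normalWeight
  fun_prop

theorem normalWeight_pos (v : ℝ × ℝ) : 0 < L.normalWeight v :=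
  Real.sqrt_pos.2 (mul_pos (by linarith [L.ν₁_le v.1, L.ν₁_pos, L.ν₃_neg])
    (by linarith [L.nonneg₂ v.2, L.ν₃_neg]))

/-- `⟨π⁺(ξ), n_g⟩ = √(1 - |ξ|²)`, which on the level set is `√((κ₁ - ν₃)(κ₂ - ν₃))` divided by
`√g₃`. -/
theorem IsParam.normalDensity_eq (hκ : L.IsParam κ₁ κ₂) {x : E} (hx : L.cov x ∈ L.level κ₁ κ₂) :
    L.normalDensity (L.cov x)
      = (√((κ₁ - L.ν₃) * (κ₂ - L.ν₃)))⁻¹ * L.normalWeight (x.1, x.2.1) := by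
  obtain ⟨h1, h2⟩ := (hκ.cov_mem_level x).1 hx
  set ξ : L.CotTorus := ((x.1 : L.T₁), (x.2.1 : L.T₂), x.2.2.1, x.2.2.2) with hξ
  have h := one_sub_normSqT ξ (cov_lt hx) h1 h2
  have hg := L.g₃_base_pos ξ
  have hs := Real.sqrt_pos.2 hg
  change (L.pairT ξ)⁻¹ = _
  rw [pairT, p₃T, h, Real.sqrt_div' _ hg.le]
  have e : L.normalWeight (x.1, x.2.1) = √(L.g₃ (L.base ξ)) := by
    rw [normalWeight, g₃_base]; rfl
  rw [e]
  field_simp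

/-- The admissible densities are constant multiples of functions of the angles. -/
theorem exists_weight {μ : L.CotΓ → ℝ} (hμ : μ = (fun _ => 1) ∨ μ = L.normalDensity)
    (hL : L.IsClassical) :
    Measurable μ ∧ ∃ w : C(ℝ × ℝ, ℝ), (∀ v, 0 < w v) ∧
      (∀ v, w (Prod.map (fold L.ω₁) (fold L.ω₂) v) = w v) ∧
      ∀ κ₁ κ₂, L.IsParam κ₁ κ₂ → ∃ C : ℝ, C ≠ 0 ∧ ∀ x : E, L.cov x ∈ L.level κ₁ κ₂ →
        μ (L.cov x) = C * w (x.1, x.2.1) := by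
  rcases hμ with rfl | rfl
  · exact ⟨measurable_const, 1, fun _ => one_pos, fun _ => rfl,
      fun _ _ _ => ⟨1, one_ne_zero, fun x _ => by simp⟩⟩
  · refine ⟨measurable_normalDensity, ⟨L.normalWeight, continuous_normalWeight⟩, normalWeight_pos,
      fun v => ?_, fun κ₁ κ₂ hκ => ⟨_, ?_, fun x hx => hκ.normalDensity_eq hx⟩⟩
    · simp only [ContinuousMap.coe_mk, normalWeight, Prod.map, hL.φ₁_fold, φ₂_fold]
    · have h := L.ν₃_neg
      exact inv_ne_zero (Real.sqrt_pos.2 (mul_pos (by linarith [hκ.lo])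
        (by linarith [hκ.pos]))).ne'

/-! ### Injectivity on a quarter period and conclusion -/

/-- A quarter of a period in both angles. -/
def quarter (L : LiouvilleTable) : Set (ℝ × ℝ) := Ioo 0 (L.ω₁ / 4) ×ˢ Ioo 0 (L.ω₂ / 4)

/-- The closure of `quarter`. -/
def closedQuarter (L : LiouvilleTable) : Set (ℝ × ℝ) := Icc 0 (L.ω₁ / 4) ×ˢ Icc 0 (L.ω₂ / 4)

/-- The torus is chosen according to the side of `ν₁` on which `κ₂` lies. After folding, both cases
produce the same integral over the quarter. -/
theorem IsParam.integral_eq_zero (hκ : L.IsParam κ₁ κ₂) (hL : L.IsClassical)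
    {μ : L.CotΓ → ℝ} (hμ : Measurable μ) {K : C(L.Γ, ℝ)} (hK : L.IsGInvariant K)
    (hR : ∀ Λ : Set L.CotΓ, L.IsLiouvilleTorus Λ → Λ ⊆ L.U₁ ∪ L.U₂ → L.radon K μ Λ = 0)
    {w : C(ℝ × ℝ, ℝ)} (hw : ∀ v, w (Prod.map (fold L.ω₁) (fold L.ω₂) v) = w v)
    {C : ℝ} (hC : C ≠ 0)
    (hμw : ∀ x : E, L.cov x ∈ L.level κ₁ κ₂ → μ (L.cov x) = C * w (x.1, x.2.1))
    (hint : IntegrableOn (TorusChart.density L κ₁ κ₂) L.quarter) :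
    ∫ v in L.quarter, TorusChart.density L κ₁ κ₂ v * (angleValue K v * w v) = 0 := by
  have hf : Measurable fun ξ => K (L.πΓ ξ) * μ ξ :=
    (measurable_from_quotient.2
      ((K.continuous.comp continuous_πΓ).comp continuous_quotient_mk').measurable).mul hμ
  have hg : Measurable fun v => angleValue K v * w v :=
    ((continuous_angleValue K).mul w.continuous).measurable
  have hs : ∀ v, (fun v => angleValue K v * w v) (Prod.map (fold L.ω₁) (fold L.ω₂) v)
      = (fun v => angleValue K v * w v) v := fun v => by
    simp only [angleValue_fold hK, hw]
  have hfg : ∀ {Λ : Set L.CotΓ} (c : L.TorusChart κ₁ κ₂ Λ), ∀ v ∈ c.V,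
      K (L.πΓ (L.cov (c.ψ v))) * μ (L.cov (c.ψ v)) = C * (angleValue K v * w v) := by
    intro Λ c v hv
    rw [hμw (c.ψ v) (c.subset_level (c.mapsTo hv))]
    change angleValue K v * (C * w v) = _
    ring
  rcases lt_or_gt_of_ne hκ.ne with h | h
  · refine (chartA hκ h).integral_eq_zero hκ hL (hκ.measurableSet continuous_sepA)
      (foldsTo_Ioo L.ω₁_pos) (foldsTo_libDomain_zero L.ω₂_pos)
      (isOpen_Ioo.prod (isOpen_libDomain _ _)).measurableSet ?_ hf hg hs hC (hfg _) hint
      (hR _ (hκ.isLiouvilleTorus_A hL h) fun ξ hξ => level_subset hκ hξ.1)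
    ext v
    exact ⟨fun hv => ⟨⟨hv.1, hv.2.1⟩, hκ.Q₁_pos h _, hv.2.2⟩,
      fun hv => ⟨hv.1.1, hv.1.2, hv.2.2⟩⟩
  · refine (chartB hκ h).integral_eq_zero hκ hL (hκ.measurableSet continuous_sepB)
      (foldsTo_libDomain_quarter L.ω₁_pos) (foldsTo_Ioo L.ω₂_pos)
      ((isOpen_libDomain _ _).prod isOpen_Ioo).measurableSet ?_ hf hg hs hC (hfg _) hint
      (hR _ (hκ.isLiouvilleTorus_B hL h) fun ξ hξ => level_subset hκ hξ.1)
    ext v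
    exact ⟨fun hv => ⟨⟨hv.1.1, hv.2⟩, hv.1.2, hκ.Q₂_pos h _⟩,
      fun hv => ⟨⟨hv.1.1, hv.2.1⟩, hv.1.2⟩⟩

theorem restrict_closedQuarter :
    (volume : Measure (ℝ × ℝ)).restrict L.closedQuarter = volume.restrict L.quarter := by
  rw [closedQuarter, quarter, Measure.volume_eq_prod, ← Measure.prod_restrict,
    ← Measure.prod_restrict, restrict_Ioo_eq_restrict_Icc, restrict_Ioo_eq_restrict_Icc]

theorem isCompact_closedQuarter : IsCompact L.closedQuarter := isCompact_Icc.prod isCompact_Icc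

/-- Compactness of the closed quarter is needed for Stone–Weierstrass; there `(φ₁, φ₂)` is injective
by strict monotonicity. The thresholds are `a = ν₁`, `b = ν₀`, `m = ν₃`, and the parameters `s`, `c`
are the roots `κ₁`, `κ₂`. -/
theorem IsClassical.angleValue_eq_zero (hL : L.IsClassical)
    {μ : L.CotΓ → ℝ} (hμ : μ = (fun _ => 1) ∨ μ = L.normalDensity)
    {K : C(L.Γ, ℝ)} (hK : L.IsGInvariant K)
    (hR : ∀ Λ : Set L.CotΓ, L.IsLiouvilleTorus Λ → Λ ⊆ L.U₁ ∪ L.U₂ → L.radon K μ Λ = 0) :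
    ∀ v ∈ L.quarter, angleValue K v = 0 := by
  obtain ⟨hm, w, hw0, hw, hμw⟩ := exists_weight hμ hL
  have hRm : MeasurableSet L.closedQuarter := isCompact_closedQuarter.measurableSet
  have : CompactSpace L.closedQuarter := isCompact_iff_compactSpace.1 isCompact_closedQuarter
  have : IsFiniteMeasure (Measure.comap (Subtype.val : L.closedQuarter → ℝ × ℝ) volume) := by
    refine ⟨?_⟩
    rw [comap_subtype_coe_apply hRm, image_univ, Subtype.range_coe]
    exact isCompact_closedQuarter.measure_lt_top
  let x : C(L.closedQuarter, ℝ) := ⟨fun z => L.φ₁ z.1.1, L.smooth₁.continuous.comp (by fun_prop)⟩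
  let y : C(L.closedQuarter, ℝ) := ⟨fun z => L.φ₂ z.1.2, L.smooth₂.continuous.comp (by fun_prop)⟩
  let k : C(L.closedQuarter, ℝ) := ⟨fun z => angleValue K z,
    (continuous_angleValue K).comp continuous_subtype_val⟩
  let u : C(L.closedQuarter, ℝ) := ⟨fun z => w z, w.continuous.comp continuous_subtype_val⟩
  have hmap : Measure.map (Subtype.val : L.closedQuarter → ℝ × ℝ) (Measure.comap Subtype.val volume)
      = volume.restrict L.quarter := by
    rw [map_comap_subtype_coe hRm, restrict_closedQuarter]
  have hae : ∀ {p : ℝ × ℝ → Prop}, (∀ᵐ z : L.closedQuarter ∂(Measure.comap Subtype.val volume), p z) ↔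
      ∀ᵐ v ∂(volume.restrict L.quarter), p v := by
    intro p
    rw [← hmap, (MeasurableEmbedding.subtype_coe hRm).ae_map_iff]
  have key := LegendreMoment.ae_eq_zero_of_kernel_integral
    (P := Measure.comap (Subtype.val : L.closedQuarter → ℝ × ℝ) volume) x y k u (a := L.ν₁) (b := L.ν₀)
    (m := L.ν₃) L.ν₃_neg (fun z => L.nonneg₂ _) (fun z => L.le_ν₁ _) (fun z => L.ν₁_le _)
    (fun z => by rw [← hL.φ₁_quarter]; exact (hL.profile₁.mem_Icc _).2) ?_ (fun z => hw0 _) ?_ ?_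
  · have key' := (hae (p := fun v => angleValue K v = 0)).1 key
    have hopen : IsOpen L.quarter := isOpen_Ioo.prod isOpen_Ioo
    exact Measure.eqOn_open_of_ae_eq (f := angleValue K) (g := fun _ => 0) key' hopen
      (continuous_angleValue K).continuousOn continuousOn_const
  · refine (hae (p := fun v => L.φ₂ v.2 < L.φ₁ v.1)).2 ?_
    filter_upwards [ae_restrict_mem (measurableSet_Ioo.prod measurableSet_Ioo)] with v hv
    refine (L.le_ν₁ _).trans_lt ?_
    rw [← L.φ₁_zero]
    exact hL.profile₁.strictMonoOn ⟨le_rfl, hv.1.1.le.trans hv.1.2.le⟩ ⟨hv.1.1.le, hv.1.2.le⟩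
      hv.1.1
  · intro p q h1 h2
    exact Subtype.ext (Prod.ext (hL.profile₁.strictMonoOn.injOn p.2.1 q.2.1 h1)
      (hL.profile₂.strictMonoOn.injOn p.2.2 q.2.2 h2))
  · intro s hs c hc hca hi
    have hκ : L.IsParam s c := ⟨hs.1, hs.2, hc.1, hc.2, hca⟩
    obtain ⟨C, hC, hμ'⟩ := hμw s c hκ
    have hi' : IntegrableOn (TorusChart.density L s c) L.quarter := by
      rw [IntegrableOn, ← hmap, (MeasurableEmbedding.subtype_coe hRm).integrable_map_iff]
      exact hi.div_const 2
    have h0 := hκ.integral_eq_zero hL hm hK hR hw hC hμ' hi'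
    rw [← hmap, (MeasurableEmbedding.subtype_coe hRm).integral_map] at h0
    have : ∀ z : L.closedQuarter,
        TorusChart.density L s c z * (angleValue K z * w z)
          = (1 / 2) * ((k z * u z) * LegendreMoment.kernel s c (x z) (y z)) := by
      intro z
      simp only [TorusChart.density, k, u, x, y, ContinuousMap.coe_mk]
      ring
    simp only [this, integral_const_mul] at h0
    linarith

theorem exists_cov_eq (z : L.Γ) : ∃ v : ℝ × ℝ, z = L.πΓ (L.cov (v.1, v.2, 0, 0)) := by
  obtain ⟨z, ⟨a, b, t⟩, hq, rfl⟩ := z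
  induction a using QuotientAddGroup.induction_on with
  | H r =>
  induction b using QuotientAddGroup.induction_on with
  | H s =>
  have hN := L.N_pos
  rcases hq with hq | hq
  · refine ⟨(r, s), Subtype.ext ?_⟩
    have : t = ⟨L.N, by constructor <;> linarith⟩ := Subtype.ext hq
    change L.σ (r, s, t) = _
    rw [this]
    rfl
  -- A point with `θ₃ = -N` is moved to `θ₃ = N` by `σ₂`, which reverses `θ₂`.
  · refine ⟨(r, -s), Subtype.ext (Quotient.sound (Or.inr (Or.inr (Or.inl ?_))))⟩
    have : L.negI t = ⟨L.N, by constructor <;> linarith⟩ := Subtype.ext (by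
      change -t.1 = L.N
      simp only at hq
      linarith)
    simp only [σ₂, this]
    rfl

end LiouvilleTable

theorem mainTheorem2 (L : LiouvilleTable) (hL : L.IsClassical)
    (μ : L.CotΓ → ℝ) (hμ : μ = (fun _ => 1) ∨ μ = L.normalDensity)
    (K : C(L.Γ, ℝ)) (hK : L.IsGInvariant K)
    (hR : ∀ Λ : Set L.CotΓ, L.IsLiouvilleTorus Λ → Λ ⊆ L.U₁ ∪ L.U₂ → L.radon K μ Λ = 0) :
    K = 0 := by
  have h0 := hL.angleValue_eq_zero hμ hK hR
  have h1 : ∀ v ∈ closure L.quarter, LiouvilleTable.angleValue K v = 0 := fun v hv =>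
    closure_minimal h0 (isClosed_eq (LiouvilleTable.continuous_angleValue K) continuous_const) hv
  -- Folding brings every angle into the closed quarter period, to which the vanishing extends by
  -- continuity.
  have hcl : ∀ {T : ℝ}, 0 < T → ∀ t, fold T t ∈ closure (Ioo 0 (T / 4)) := by
    intro T hT t
    rw [closure_Ioo (by linarith)]
    refine ⟨abs_nonneg _, ?_⟩
    have h := abs_sub_round (t / (T / 2))
    have e : t - round (t / (T / 2)) * (T / 2)
        = (t / (T / 2) - round (t / (T / 2))) * (T / 2) := by
      field_simp
    rw [fold, e, abs_mul, abs_of_pos (show 0 < T / 2 by linarith)]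
    nlinarith
  ext z
  obtain ⟨v, rfl⟩ := LiouvilleTable.exists_cov_eq z
  change LiouvilleTable.angleValue K v = 0
  rw [← LiouvilleTable.angleValue_fold hK]
  refine h1 _ ?_
  rw [LiouvilleTable.quarter, closure_prod_eq]
  exact ⟨hcl L.ω₁_pos _, hcl L.ω₂_pos _⟩
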